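/- Let $\mathbf k$ be a unital commutative $\mathbb Q$-algebra and $A$ a unital associative $\mathbf k$-algebra such that $\mathbf k\to A$ is a $\mathbf k$-split injection; put $\bar A=A/\mathbf k$. Notation. $\Omega=\Omega A$ is the dg algebra of noncommutative differential forms of $A$ (generated by $A$ and the symbols $da$, $\mathbf k$-linear in $a\in A$, with $d(ab)=da\cdot b+a\cdot db$), and $\bar\Omega=\Omega/\mathbf k$. On $\bar\Omega$ let $b$ be the Hochschild differential, $b(\alpha\,da)=(-1)^{|\alpha|}(\alpha a-a\alpha)$, $b|_{\bar\Omega^0}=0$; let $\kappa(\alpha\,da)=(-1)^{|\alpha|}da\,\alpha$ be the Karoubi operator (on forms of positive degree) and $B|_{\bar\Omega^n}=(1+\kappa+\dots+\kappa^n)d$ the Connes differential. Let $\Omega_t=\Omega A*_{\mathbf k}\mathbf k[t]$ (with $dt=0$), bigraded by de Rham degree $p$ and degree $q$ in $t$; $\overline{DR}=\Omega/(\mathbf k+[\Omega,\Omega])$ and $\overline{DR}_t=\Omega_t/(\mathbf k[t]+[\Omega_t,\Omega_t])$, with supercommutators with respect to the de Rham degree; $f_\natural$ is the class of $f$. The differential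 $d$ acts on both. Let $i_t$ be the differential on $\overline{DR}_t$ induced by the superderivation of $\Omega_t$ with $t\mapsto0$, $a\mapsto0$, $da\mapsto at-ta$. Set $R=\mathbf k((u))/u\mathbf k[[u]]$, so that $M\otimes R$ consists of the finite sums $\sum_{r\ge0}f_ru^{-r}$ with $f_r\in M$. The homological degree of an element of $\overline{DR}_t^{p,q}u^{-r}$ (or of $\bar\Omega^pu^{-r}$) is $p+2r$, and the internal degree of an element of $\overline{DR}_t^{p,q}u^{-r}$ is $p+q+r$. Define $\overline{HD}_n(A)=H_n(\overline{DR},d)$; $\overline{HC}_\ell(A)=H_\ell(\bar\Omega\otimes R,\,b-uB)$; and, for $\ell,m\in\mathbb Z$, let $\overline{EHC}_\ell(A,m)$ be the homology in homological degree $\ell$ of the component of internal degree $\ell-m$ of $(\overline{DR}_t\otimes R,\ i_t-u\,d)$. Let $H(\overline{DR}_t/d\,\overline{DR}_t,\,i_t)^{p,q}$ denote the component of bidegree $(p,q)$. The Tsygan map $E=\sum_{q\ge0}E^q:\bar\Omega\to\prod_{q\ge 0}\overline{DR}_t^{\bullet,q}$ is given by $$E(a_0\,da_1\cdots da_n)=\sum_{k_0,\dots,k_n\ge0}\frac{1}{(k_0+\dots+k_n+n)!}\,(a_0t^{k_0}\,da_1\,t^{k_1}\cdots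 da_n\,t^{k_n})_\natural ,$$ where $E^q$ is the part of degree $q$ in $t$; $E$ is extended $R$-linearly, and $\mathsf w_K$ is the projection to internal degree $K$. Proposition. (i) The assignments $$\pi_m:\ \sum_{r\ge0} f_ru^{-r}\mapsto f_m \bmod t,\qquad \pi_-:\ \sum_{r\ge0} f_ru^{-r}\mapsto f_0 \bmod \operatorname{im} d$$ induce isomorphisms, for all integers $\ell$ and $m$, $$\pi_m:\overline{EHC}_\ell(A,m)\ \xrightarrow{\ \sim\ }\ \overline{HD}_{\ell-2m}(A)\quad(m>0),\qquad \pi_-:\overline{EHC}_\ell(A,m)\ \xrightarrow{\ \sim\ }\ H(\overline{DR}_t/d\,\overline{DR}_t,\ i_t)^{\ell,-m}\quad(m\le0).$$ (ii) For all $\ell$ and all $m\le0$, the assignment $\sum_r f_ru^{-r}\mapsto f_0\bmod\operatorname{im}B$ induces an isomorphism (the Cuntz–Quillen isomorphism) $\overline{HC}_\ell(A)\xrightarrow{\sim}H_\ell(\bar\Omega/B\bar\Omega,\,b)$; the maps $\mathsf w_{\ell-m}\circ E$ and $E^{-m}$ induce maps on homology; and the diagram $$\begin{array}{ccc} H_\ell(\bar\Omega\otimes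 R,\ b-uB) & \xrightarrow{\ \mathsf w_{\ell-m}\circ E\ } & \overline{EHC}_\ell(A,m)\\ {\scriptstyle\cong}\big\downarrow & & \big\downarrow{\scriptstyle\pi_-}\\ H_\ell(\bar\Omega/B\bar\Omega,\ b) & \xrightarrow{\ E^{-m}\ } & H(\overline{DR}_t/d\,\overline{DR}_t,\ i_t)^{\ell,-m} \end{array}$$ commutes. -/

import Mathlib

namespace ExtendedCyclic

universe u v

/-! ### Noncommutative forms with free even variables adjoined -/

/-- Generators of the algebra of forms: `a`, `d a` for `a : A`, and the variables `x : X`. -/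
inductive Gen (A : Type v) (X : Type) : Type v
  | of (a : A) : Gen A X
  | d (a : A) : Gen A X
  | var (x : X) : Gen A X

section Forms

variable (k : Type u) [CommRing k] (A : Type v) [Ring A] [Algebra k A] (X : Type)

/-- The defining relations: `A` is a `k`-subalgebra, `a ↦ d a` is `k`-linear, and
`d (a b) = d a · b + a · d b` (hence `d 1 = 0`). No relation is imposed on the variables. -/
inductive Rel : FreeAlgebra k (Gen A X) → FreeAlgebra k (Gen A X) → Prop
  | of_algebraMap (r : k) :
      Rel (FreeAlgebra.ι k (Gen.of (algebraMap k A r))) (algebraMap k _ r)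
  | of_add (a b : A) : Rel (FreeAlgebra.ι k (Gen.of (a + b)))
      (FreeAlgebra.ι k (Gen.of a) + FreeAlgebra.ι k (Gen.of b))
  | of_mul (a b : A) : Rel (FreeAlgebra.ι k (Gen.of (a * b)))
      (FreeAlgebra.ι k (Gen.of a) * FreeAlgebra.ι k (Gen.of b))
  | d_add (a b : A) : Rel (FreeAlgebra.ι k (Gen.d (a + b)))
      (FreeAlgebra.ι k (Gen.d a) + FreeAlgebra.ι k (Gen.d b))
  | d_smul (r : k) (a : A) : Rel (FreeAlgebra.ι k (Gen.d (r • a)))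
      (r • FreeAlgebra.ι k (Gen.d a))
  | d_mul (a b : A) : Rel (FreeAlgebra.ι k (Gen.d (a * b)))
      (FreeAlgebra.ι k (Gen.d a) * FreeAlgebra.ι k (Gen.of b) +
        FreeAlgebra.ι k (Gen.of a) * FreeAlgebra.ι k (Gen.d b))

/-- `Forms k A X` is the free product over `k` of the algebra `Ω A` of noncommutative differential
forms with the free algebra `k⟨X⟩`. For `X` empty it is `Ω A`, for `X` a point it is
`Ω_t A = Ω A * k[t] = Ω (A * k[t]) / (d t)`. -/
def Forms : Type (max u v) := RingQuot (Rel k A X)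

instance : Ring (Forms k A X) := inferInstanceAs (Ring (RingQuot (Rel k A X)))
instance : Algebra k (Forms k A X) := inferInstanceAs (Algebra k (RingQuot (Rel k A X)))

/-- The quotient map. -/
def Forms.mk : FreeAlgebra k (Gen A X) →ₐ[k] Forms k A X := RingQuot.mkAlgHom k (Rel k A X)

variable {A X}

theorem Forms.mk_rel {x y : FreeAlgebra k (Gen A X)} (h : Rel k A X x y) :
    Forms.mk k A X x = Forms.mk k A X y :=
  RingQuot.mkAlgHom_rel k h

/-- The class of a generator. -/
def gen (g : Gen A X) : Forms k A X := Forms.mk k A X (FreeAlgebra.ι k g)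

variable (A X)

/-- The inclusion `A → Forms k A X`. -/
def ofA : A →ₐ[k] Forms k A X :=
  AlgHom.ofLinearMap
    { toFun := fun a => gen k (Gen.of a)
      map_add' := fun a b => by
        simpa [gen] using Forms.mk_rel k (Rel.of_add (k := k) (X := X) a b)
      map_smul' := fun r a => by
        have h1 := Forms.mk_rel k (Rel.of_mul (k := k) (X := X) (algebraMap k A r) a)
        have h2 := Forms.mk_rel k (Rel.of_algebraMap (k := k) (A := A) (X := X) r)
        rw [map_mul, h2, AlgHom.commutes] at h1
        simpa [gen, Algebra.smul_def] using h1 }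
    (by
      have h2 := Forms.mk_rel k (Rel.of_algebraMap (k := k) (A := A) (X := X) 1)
      simpa [gen] using h2)
    (fun a b => by
      simpa [gen] using Forms.mk_rel k (Rel.of_mul (k := k) (X := X) a b))

/-- The map `a ↦ d a`. -/
def dA : A →ₗ[k] Forms k A X where
  toFun := fun a => gen k (Gen.d a)
  map_add' := fun a b => by
    simpa [gen] using Forms.mk_rel k (Rel.d_add (k := k) (X := X) a b)
  map_smul' := fun r a => by
    simpa [gen] using Forms.mk_rel k (Rel.d_smul (k := k) (X := X) r a)

theorem dA_mul (a b : A) :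
    dA k A X (a * b) = dA k A X a * ofA k A X b + ofA k A X a * dA k A X b := by
  have h := Forms.mk_rel k (Rel.d_mul (k := k) (X := X) a b)
  rw [map_add, map_mul, map_mul] at h
  exact h

theorem dA_one : dA k A X 1 = 0 := by
  have h := dA_mul k A X 1 1
  simpa using h

variable {A}

/-- The variable `x`, as an element of `Forms k A X`. -/
def var (A : Type v) [Ring A] [Algebra k A] {X : Type} (x : X) : Forms k A X := gen k (Gen.var x)

theorem gen_of (a : A) : gen k (Gen.of a) = ofA k A X a := rfl
theorem gen_d (a : A) : gen k (Gen.d a) = dA k A X a := rfl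
theorem gen_var (x : X) : gen k (Gen.var x) = var k A x := rfl

variable {X}

/-- A product of generators. -/
def word (w : List (Gen A X)) : Forms k A X := (w.map (gen k)).prod

theorem word_cons (g : Gen A X) (w : List (Gen A X)) : word k (g :: w) = gen k g * word k w := by
  simp [word]

theorem word_append (w w' : List (Gen A X)) : word k (w ++ w') = word k w * word k w' := by
  simp [word]

theorem span_word : Submodule.span k (Set.range (word k (A := A) (X := X))) = ⊤ := by
  rw [eq_top_iff]
  rintro x -
  obtain ⟨y, rfl⟩ : ∃ y, Forms.mk k A X y = x := RingQuot.mkAlgHom_surjective k (Rel k A X) x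
  induction y using FreeAlgebra.induction with
  | grade0 r =>
    rw [AlgHom.commutes, Algebra.algebraMap_eq_smul_one]
    exact Submodule.smul_mem _ _ (Submodule.subset_span ⟨[], by simp [word]⟩)
  | grade1 g => exact Submodule.subset_span ⟨[g], by simp [word, gen]⟩
  | mul a b ha hb =>
    rw [map_mul]
    have := Submodule.mul_mem_mul ha hb
    rw [Submodule.span_mul_span] at this
    refine Submodule.span_mono ?_ this
    rintro _ ⟨_, ⟨w, rfl⟩, _, ⟨w', rfl⟩, rfl⟩
    exact ⟨w ++ w', word_append k w w'⟩
  | add a b ha hb => rw [map_add]; exact Submodule.add_mem _ ha hb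

/-- Induction on forms through left multiplication by generators. -/
theorem Forms.induction {P : Forms k A X → Prop} (h0 : P 0) (h1 : P 1)
    (hadd : ∀ x y, P x → P y → P (x + y)) (hsmul : ∀ (r : k) x, P x → P (r • x))
    (hof : ∀ a x, P x → P (ofA k A X a * x)) (hd : ∀ a x, P x → P (dA k A X a * x))
    (hvar : ∀ v x, P x → P (var k A v * x)) (x : Forms k A X) : P x := by
  have hx : x ∈ Submodule.span k (Set.range (word k (A := A) (X := X))) := by
    rw [span_word]; trivial
  induction hx using Submodule.span_induction with
  | mem x hx =>
    obtain ⟨w, rfl⟩ := hx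
    induction w with
    | nil => simpa [word] using h1
    | cons g w ih =>
      rw [word_cons]
      cases g with
      | of a => exact hof a _ ih
      | d a => exact hd a _ ih
      | var v => exact hvar v _ ih
  | zero => exact h0
  | add x y _ _ hx hy => exact hadd x y hx hy
  | smul r x _ hx => exact hsmul r x hx

/-- The universal property of `Forms k A X`. -/
def Forms.lift {S : Type*} [Semiring S] [Algebra k S] (f : A →ₐ[k] S) (δ : A →ₗ[k] S)
    (hδ : ∀ a b, δ (a * b) = δ a * f b + f a * δ b) (x : X → S) : Forms k A X →ₐ[k] S :=
  RingQuot.liftAlgHom k ⟨FreeAlgebra.lift k (fun g => match g with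
    | Gen.of a => f a
    | Gen.d a => δ a
    | Gen.var v => x v), by
      intro y z h
      cases h <;> simp [hδ]⟩

section lift
variable {S : Type*} [Semiring S] [Algebra k S] (f : A →ₐ[k] S) (δ : A →ₗ[k] S)
    (hδ : ∀ a b, δ (a * b) = δ a * f b + f a * δ b) (x : X → S)

@[simp] theorem Forms.lift_ofA (a : A) : Forms.lift k f δ hδ x (ofA k A X a) = f a :=
  (RingQuot.liftAlgHom_mkAlgHom_apply k _ _ _).trans (by simp)
@[simp] theorem Forms.lift_dA (a : A) : Forms.lift k f δ hδ x (dA k A X a) = δ a :=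
  (RingQuot.liftAlgHom_mkAlgHom_apply k _ _ _).trans (by simp)
@[simp] theorem Forms.lift_var (v : X) : Forms.lift k f δ hδ x (var k A v) = x v :=
  (RingQuot.liftAlgHom_mkAlgHom_apply k _ _ _).trans (by simp)
end lift

variable (A X)

/-- The parity automorphism `ω ↦ (-1)^p ω` for `ω` of de Rham degree `p`. -/
def parity : Forms k A X →ₐ[k] Forms k A X :=
  Forms.lift k (ofA k A X) (-dA k A X) (by
    intro a b; simp only [LinearMap.neg_apply, dA_mul]; noncomm_ring) (var k A)

variable {A X}

@[simp] theorem parity_ofA (a : A) : parity k A X (ofA k A X a) = ofA k A X a := by simp [parity]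
@[simp] theorem parity_dA (a : A) : parity k A X (dA k A X a) = -dA k A X a := by simp [parity]
@[simp] theorem parity_var (v : X) : parity k A X (var k A v) = var k A v := by simp [parity]

@[simp] theorem parity_parity (x : Forms k A X) : parity k A X (parity k A X x) = x := by
  induction x using Forms.induction <;> simp_all

section oddDer

variable (D₀ D₁ : A →ₗ[k] Forms k A X)
    (h₀ : ∀ a b, D₀ (a * b) = D₀ a * ofA k A X b + ofA k A X a * D₀ b)
    (h₁ : ∀ a b, D₁ (a * b) = D₁ a * ofA k A X b - dA k A X a * D₀ b +
      (D₀ a * dA k A X b + ofA k A X a * D₁ b))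

/-- The algebra homomorphism `ω ↦ [[parity ω, D ω], [0, ω]]` encoding the odd derivation `D` of
`Forms k A X` with `D a = D₀ a`, `D (d a) = D₁ a` and `D x = 0` for every variable `x`. -/
def oddDerHom : Forms k A X →ₐ[k] Matrix (Fin 2) (Fin 2) (Forms k A X) :=
  Forms.lift k
    (AlgHom.ofLinearMap
      { toFun := fun a => !![ofA k A X a, D₀ a; 0, ofA k A X a]
        map_add' := fun a b => by simp
        map_smul' := fun r a => by simp }
      (by
        have h := h₀ 1 1
        have h' : D₀ 1 = 0 := by simpa using h
        simp [← Matrix.ext_iff, Fin.forall_fin_two, h'])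
      (fun a b => by
        simp [h₀, add_comm]))
    { toFun := fun a => !![-dA k A X a, D₁ a; 0, dA k A X a]
      map_add' := fun a b => by simp [add_comm]
      map_smul' := fun r a => by simp }
    (fun a b => by
      simp only [← Matrix.ext_iff, Fin.forall_fin_two]
      simp [h₁, dA_mul]
      constructor <;> abel)
    (fun v => !![var k A v, 0; 0, var k A v])

/-- The odd derivation `D` of `Forms k A X` with `D a = D₀ a`, `D (d a) = D₁ a` and `D x = 0` for
every variable `x`. -/
def oddDer : Forms k A X →ₗ[k] Forms k A X :=
  (Matrix.entryLinearMap k (Forms k A X) (0 : Fin 2) (1 : Fin 2)).comp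
    (oddDerHom k D₀ D₁ h₀ h₁).toLinearMap

theorem oddDer_ofA (a : A) : oddDer k D₀ D₁ h₀ h₁ (ofA k A X a) = D₀ a := by
  simp [oddDer, oddDerHom]
theorem oddDer_dA (a : A) : oddDer k D₀ D₁ h₀ h₁ (dA k A X a) = D₁ a := by
  simp [oddDer, oddDerHom]
theorem oddDer_var (v : X) : oddDer k D₀ D₁ h₀ h₁ (var k A v) = 0 := by
  simp [oddDer, oddDerHom]
theorem oddDer_one : oddDer k D₀ D₁ h₀ h₁ 1 = 0 := by
  simp [oddDer, oddDerHom]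

theorem oddDer_mul (x y : Forms k A X) : oddDer k D₀ D₁ h₀ h₁ (x * y) =
    oddDer k D₀ D₁ h₀ h₁ x * y + parity k A X x * oddDer k D₀ D₁ h₀ h₁ y := by
  have key : ∀ x, oddDerHom k D₀ D₁ h₀ h₁ x 0 0 = parity k A X x ∧
      oddDerHom k D₀ D₁ h₀ h₁ x 1 0 = 0 ∧ oddDerHom k D₀ D₁ h₀ h₁ x 1 1 = x := by
    intro x
    induction x using Forms.induction with
    | h0 => simp
    | h1 => simp
    | hadd x y hx hy => simp [hx, hy]
    | hsmul r x hx => simp [hx]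
    | hof a x hx =>
      have : oddDerHom k D₀ D₁ h₀ h₁ (ofA k A X a) = !![ofA k A X a, D₀ a; 0, ofA k A X a] := by
        simp [oddDerHom]
      simp [Matrix.mul_apply, Fin.sum_univ_two, hx, this]
    | hd a x hx =>
      have : oddDerHom k D₀ D₁ h₀ h₁ (dA k A X a) = !![-dA k A X a, D₁ a; 0, dA k A X a] := by
        simp [oddDerHom]
      simp [Matrix.mul_apply, Fin.sum_univ_two, hx, this]
    | hvar v x hx =>
      have : oddDerHom k D₀ D₁ h₀ h₁ (var k A v) = !![var k A v, 0; 0, var k A v] := by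
        simp [oddDerHom]
      simp [Matrix.mul_apply, Fin.sum_univ_two, hx, this]
  simp [oddDer, Matrix.mul_apply, Fin.sum_univ_two, key, add_comm]

end oddDer

end Forms

section Grading

variable (k : Type u) [CommRing k] (A : Type v) [Ring A] [Algebra k A] (X : Type)

variable {A X} in
/-- de Rham degree of a generator. -/
def Gen.deg : Gen A X → ℤ
  | Gen.of _ => 0
  | Gen.d _ => 1
  | Gen.var _ => 0

variable {A X} in
/-- Degree of a generator in the variables. -/
def Gen.varDeg : Gen A X → ℤ
  | Gen.of _ => 0
  | Gen.d _ => 0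
  | Gen.var _ => 1

/-- The forms of de Rham degree `p` and of degree `q` in the variables: the span of the words with
`p` differentials and `q` variables (zero if `p < 0` or `q < 0`). -/
def forms (p q : ℤ) : Submodule k (Forms k A X) :=
  Submodule.span k {ω | ∃ w : List (Gen A X),
    (w.map Gen.deg).sum = p ∧ (w.map Gen.varDeg).sum = q ∧ word k w = ω}

variable {A X}

theorem word_mem_forms (w : List (Gen A X)) :
    word k w ∈ forms k A X (w.map Gen.deg).sum (w.map Gen.varDeg).sum :=
  Submodule.subset_span ⟨w, rfl, rfl, rfl⟩

theorem ofA_mem (a : A) : ofA k A X a ∈ forms k A X 0 0 := by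
  simpa [word, gen_of, Gen.deg, Gen.varDeg] using word_mem_forms k [Gen.of (X := X) a]
theorem dA_mem (a : A) : dA k A X a ∈ forms k A X 1 0 := by
  simpa [word, gen_d, Gen.deg, Gen.varDeg] using word_mem_forms k [Gen.d (X := X) a]
theorem var_mem (x : X) : var k A x ∈ forms k A X 0 1 := by
  simpa [word, gen_var, Gen.deg, Gen.varDeg] using word_mem_forms k [Gen.var (A := A) x]
theorem one_mem_forms : (1 : Forms k A X) ∈ forms k A X 0 0 := by
  simpa [word] using word_mem_forms k ([] : List (Gen A X))

theorem forms_mul {p q p' q' : ℤ} {x y : Forms k A X} (hx : x ∈ forms k A X p q)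
    (hy : y ∈ forms k A X p' q') : x * y ∈ forms k A X (p + p') (q + q') := by
  have := Submodule.mul_mem_mul hx hy
  unfold forms at this
  rw [Submodule.span_mul_span] at this
  refine Submodule.span_mono ?_ this
  rintro _ ⟨_, ⟨w, h1, h2, rfl⟩, _, ⟨w', h1', h2', rfl⟩, rfl⟩
  exact ⟨w ++ w', by simp [h1, h1'], by simp [h2, h2'], word_append k w w'⟩

theorem parity_word (w : List (Gen A X)) :
    parity k A X (word k w) = (w.map Gen.deg).sum.negOnePow • word k w := by
  induction w with
  | nil => simp [word]
  | cons g w ih =>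
    rw [word_cons, map_mul, ih]
    cases g with
    | of a =>
      rw [gen_of, parity_ofA, Units.smul_def, Units.smul_def, mul_smul_comm]
      simp only [List.map_cons, List.sum_cons, Gen.deg, zero_add]
    | d a =>
      rw [gen_d, parity_dA, Units.smul_def, Units.smul_def, mul_smul_comm]
      simp only [List.map_cons, List.sum_cons, Gen.deg, Int.negOnePow_add, Int.negOnePow_one]
      simp only [Units.val_mul, Units.val_neg, Units.val_one, neg_mul, one_mul, neg_smul, smul_neg]
    | var x =>
      rw [gen_var, parity_var, Units.smul_def, Units.smul_def, mul_smul_comm]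
      simp only [List.map_cons, List.sum_cons, Gen.deg, zero_add]

theorem parity_of_mem {p q : ℤ} {x : Forms k A X} (hx : x ∈ forms k A X p q) :
    parity k A X x = p.negOnePow • x := by
  induction hx using Submodule.span_induction with
  | mem x hx =>
    obtain ⟨w, rfl, -, rfl⟩ := hx
    exact parity_word k w
  | zero => simp
  | add x y _ _ hx hy => simp [hx, hy]
  | smul r x _ hx => rw [map_smul, hx, smul_comm]

/-- A map shifting degrees on words shifts degrees. -/
theorem oddDer_mem (D₀ D₁ : A →ₗ[k] Forms k A X) (h₀ h₁) (e e' : ℤ)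
    (hD₀ : ∀ a, D₀ a ∈ forms k A X e e') (hD₁ : ∀ a, D₁ a ∈ forms k A X (1 + e) e')
    {p q : ℤ} {x : Forms k A X} (hx : x ∈ forms k A X p q) :
    oddDer k D₀ D₁ h₀ h₁ x ∈ forms k A X (p + e) (q + e') := by
  induction hx using Submodule.span_induction with
  | zero => simp
  | add x y _ _ hx hy => rw [map_add]; exact Submodule.add_mem _ hx hy
  | smul r x _ hx => rw [map_smul]; exact Submodule.smul_mem _ _ hx
  | mem x hx =>
    obtain ⟨w, rfl, rfl, rfl⟩ := hx
    induction w with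
    | nil =>
      have : word k ([] : List (Gen A X)) = 1 := by simp [word]
      rw [this, oddDer_one]; exact Submodule.zero_mem _
    | cons g w ih =>
      rw [word_cons, oddDer_mul]
      have hw := word_mem_forms k w
      cases g with
      | of a =>
        refine Submodule.add_mem _ ?_ ?_
        · have := forms_mul k (hD₀ a) hw
          rw [gen_of, oddDer_ofA]
          convert this using 2 <;> simp [Gen.deg, Gen.varDeg] <;> ring
        · have := forms_mul k (ofA_mem k (X := X) a) ih
          rw [gen_of, parity_ofA]
          convert this using 2 <;> simp [Gen.deg, Gen.varDeg]
      | d a =>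
        refine Submodule.add_mem _ ?_ ?_
        · have := forms_mul k (hD₁ a) hw
          rw [gen_d, oddDer_dA]
          convert this using 2 <;> simp [Gen.deg, Gen.varDeg] <;> ring
        · have := forms_mul k (dA_mem k (X := X) a) ih
          rw [gen_d, parity_dA, neg_mul]
          refine Submodule.neg_mem _ ?_
          convert this using 2 <;> simp [Gen.deg, Gen.varDeg] <;> ring
      | var x =>
        refine Submodule.add_mem _ ?_ ?_
        · rw [gen_var, oddDer_var]; simp
        · have := forms_mul k (var_mem k (A := A) x) ih
          rw [gen_var, parity_var]
          convert this using 2 <;> simp [Gen.deg, Gen.varDeg] <;> ring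

variable (A X)

/-- `[Ω, Ω]`: the span of the graded commutators `x y - (-1)^{|x||y|} y x`, where `|·|` is the
de Rham degree. -/
def comm : Submodule k (Forms k A X) :=
  Submodule.span k {z | ∃ (p q p' q' : ℤ), ∃ x ∈ forms k A X p q, ∃ y ∈ forms k A X p' q',
    z = x * y - (p * p').negOnePow • (y * x)}

/-- The subalgebra `k⟨X⟩` generated by the variables: `k` for `X` empty, `k[t]` for `X` a point. -/
def consts : Submodule k (Forms k A X) :=
  Subalgebra.toSubmodule (Algebra.adjoin k (Set.range (var k A (X := X))))

/-- The reduced forms `Ω / k⟨X⟩`. -/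
abbrev OmegaBar : Type (max u v) := Forms k A X ⧸ consts k A X

/-- The reduced commutator quotient `Ω / (k⟨X⟩ + [Ω, Ω])`. -/
abbrev DRBar : Type (max u v) := Forms k A X ⧸ (consts k A X ⊔ comm k A X)

/-- The class `ω♮` in the reduced commutator quotient. -/
def nat : Forms k A X →ₗ[k] DRBar k A X := (consts k A X ⊔ comm k A X).mkQ

/-- The component of bidegree `(p, q)` of the reduced commutator quotient. -/
def drForms (p q : ℤ) : Submodule k (DRBar k A X) := (forms k A X p q).map (nat k A X)

variable {A X}

theorem oddDer_consts (D₀ D₁ : A →ₗ[k] Forms k A X) (h₀ h₁) {x : Forms k A X}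
    (hx : x ∈ consts k A X) : oddDer k D₀ D₁ h₀ h₁ x = 0 := by
  change x ∈ Algebra.adjoin k _ at hx
  induction hx using Algebra.adjoin_induction with
  | mem x hx => obtain ⟨v, rfl⟩ := hx; exact oddDer_var k D₀ D₁ h₀ h₁ v
  | algebraMap r => rw [Algebra.algebraMap_eq_smul_one, map_smul, oddDer_one, smul_zero]
  | add x y _ _ hx hy => rw [map_add, hx, hy, add_zero]
  | mul x y _ _ hx hy => rw [oddDer_mul, hx, hy]; simp

theorem oddDer_comm (D₀ D₁ : A →ₗ[k] Forms k A X) (h₀ h₁) (e e' : ℤ) (he : Odd e)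
    (hD₀ : ∀ a, D₀ a ∈ forms k A X e e') (hD₁ : ∀ a, D₁ a ∈ forms k A X (1 + e) e')
    {x : Forms k A X} (hx : x ∈ comm k A X) : oddDer k D₀ D₁ h₀ h₁ x ∈ comm k A X := by
  induction hx using Submodule.span_induction with
  | zero => simp
  | add x y _ _ hx hy => rw [map_add]; exact Submodule.add_mem _ hx hy
  | smul r x _ hx => rw [map_smul]; exact Submodule.smul_mem _ _ hx
  | mem z hz =>
    obtain ⟨p, q, p', q', x, hx, y, hy, rfl⟩ := hz
    have hDx := oddDer_mem k D₀ D₁ h₀ h₁ e e' hD₀ hD₁ hx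
    have hDy := oddDer_mem k D₀ D₁ h₀ h₁ e e' hD₀ hD₁ hy
    have h1 : _ ∈ comm k A X := Submodule.subset_span ⟨_, _, _, _, _, hDx, _, hy, rfl⟩
    have h2 : _ ∈ comm k A X := Submodule.subset_span ⟨_, _, _, _, _, hx, _, hDy, rfl⟩
    have h3 := Submodule.add_mem _ h1 (Submodule.smul_of_tower_mem _ (p.negOnePow : ℤ) h2)
    convert h3 using 1
    rw [map_sub, Units.smul_def, map_zsmul, oddDer_mul, oddDer_mul, parity_of_mem k hx,
      parity_of_mem k hy]
    simp only [Units.smul_def, add_mul, mul_add, Int.negOnePow_add, Units.val_mul, smul_sub,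
      smul_add, smul_smul, smul_mul_assoc]
    have e1 : ((p * e).negOnePow : ℤ) = p.negOnePow := by
      rcases Int.even_or_odd p with h | h
      · rw [Int.negOnePow_even _ h, Int.negOnePow_even _ (h.mul_right e)]
      · rw [Int.negOnePow_odd _ h, Int.negOnePow_odd _ (h.mul he)]
    have e2 : ((e * p').negOnePow : ℤ) = p'.negOnePow := by
      rcases Int.even_or_odd p' with h | h
      · rw [Int.negOnePow_even _ h, Int.negOnePow_even _ (h.mul_left e)]
      · rw [Int.negOnePow_odd _ h, Int.negOnePow_odd _ (he.mul h)]
    have e3 : (p.negOnePow : ℤ) * p.negOnePow = 1 := by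
      rw [← Units.val_mul, ← Int.negOnePow_add, Int.negOnePow_even _ ⟨p, rfl⟩]; rfl
    rw [e1, e2]
    have e4 : (p.negOnePow : ℤ) * (((p * p').negOnePow : ℤ) * p.negOnePow) =
        (p * p').negOnePow := by
      rw [mul_comm, mul_assoc, e3, mul_one]
    rw [e4]
    abel

/-- An odd derivation that is homogeneous of odd degree, on the reduced commutator quotient. -/
def oddDerDR (D₀ D₁ : A →ₗ[k] Forms k A X)
    (h₀ : ∀ a b, D₀ (a * b) = D₀ a * ofA k A X b + ofA k A X a * D₀ b)
    (h₁ : ∀ a b, D₁ (a * b) = D₁ a * ofA k A X b - dA k A X a * D₀ b +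
      (D₀ a * dA k A X b + ofA k A X a * D₁ b)) (e e' : ℤ) (he : Odd e)
    (hD₀ : ∀ a, D₀ a ∈ forms k A X e e') (hD₁ : ∀ a, D₁ a ∈ forms k A X (1 + e) e') :
    DRBar k A X →ₗ[k] DRBar k A X :=
  Submodule.mapQ _ _ (oddDer k D₀ D₁ h₀ h₁) (sup_le
    (fun x hx => by
      rw [Submodule.mem_comap, oddDer_consts k D₀ D₁ h₀ h₁ hx]; exact Submodule.zero_mem _)
    (fun x hx => Submodule.mem_sup_right (oddDer_comm k D₀ D₁ h₀ h₁ e e' he hD₀ hD₁ hx)))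

variable (A X)

/-- The de Rham differential: `d (a) = d a`, `d (d a) = 0`, `d x = 0`,
`d (ω η) = d ω · η + (-1)^{|ω|} ω · d η`. -/
def dOmega : Forms k A X →ₗ[k] Forms k A X :=
  oddDer k (dA k A X) 0 (dA_mul k A X) (by intro a b; simp)

/-- The de Rham differential on the reduced commutator quotient. -/
def dDR : DRBar k A X →ₗ[k] DRBar k A X :=
  oddDerDR k (dA k A X) 0 (dA_mul k A X) (by intro a b; simp) 1 0 odd_one
    (dA_mem k) (fun _ => Submodule.zero_mem _)

theorem dDR_nat (x : Forms k A X) : dDR k A X (nat k A X x) = nat k A X (dOmega k A X x) := rfl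

end Grading

section Contraction

variable (k : Type u) [CommRing k] (A : Type v) [Ring A] [Algebra k A]

/-- The variable `t` of `Ω_t`. -/
def t : Forms k A Unit := var k A ()

/-- `a ↦ [a, t]`. -/
def adT : A →ₗ[k] Forms k A Unit :=
  (LinearMap.mulRight k (t k A) - LinearMap.mulLeft k (t k A)).comp (ofA k A Unit).toLinearMap

theorem adT_apply (a : A) : adT k A a = ofA k A Unit a * t k A - t k A * ofA k A Unit a := rfl

theorem adT_mul (a b : A) :
    adT k A (a * b) = adT k A a * ofA k A Unit b + ofA k A Unit a * adT k A b := by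
  simp only [adT_apply, map_mul]; noncomm_ring

theorem adT_mem (a : A) : adT k A a ∈ forms k A Unit (1 + -1) 1 := by
  have h1 := forms_mul k (ofA_mem k (X := Unit) a) (var_mem k (A := A) ())
  have h2 := forms_mul k (var_mem k (A := A) ()) (ofA_mem k (X := Unit) a)
  exact Submodule.sub_mem _ h1 h2

/-- The contraction `i_t` on `Ω_t`: the odd derivation with `i_t (a) = 0`, `i_t (d a) = [a, t]`,
`i_t (t) = 0`. -/
def contr : Forms k A Unit →ₗ[k] Forms k A Unit :=
  oddDer k 0 (adT k A) (by intro a b; simp) (by intro a b; simp [adT_mul])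

/-- The contraction `i_t` on the reduced commutator quotient of `Ω_t`. -/
def contrDR : DRBar k A Unit →ₗ[k] DRBar k A Unit :=
  oddDerDR k 0 (adT k A) (by intro a b; simp) (by intro a b; simp [adT_mul]) (-1) 1
    (by decide) (fun _ => Submodule.zero_mem _) (adT_mem k A)

theorem contrDR_nat (x : Forms k A Unit) :
    contrDR k A (nat k A Unit x) = nat k A Unit (contr k A x) := rfl

theorem parity_dOmega (X : Type) (x : Forms k A X) :
    parity k A X (dOmega k A X x) = -dOmega k A X (parity k A X x) := by
  induction x using Forms.induction with
  | h0 => simp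
  | h1 => simp [dOmega, oddDer_one]
  | hadd x y hx hy => simp [hx, hy, add_comm]
  | hsmul r x hx => simp [hx]
  | hof a x hx => simp [dOmega, oddDer_mul, oddDer_ofA] at hx ⊢; simp [hx, add_comm]
  | hd a x hx => simp [dOmega, oddDer_mul, oddDer_dA] at hx ⊢; simp [hx]
  | hvar v x hx => simp [dOmega, oddDer_mul, oddDer_var] at hx ⊢; simp [hx]

theorem parity_contr (x : Forms k A Unit) :
    parity k A Unit (contr k A x) = -contr k A (parity k A Unit x) := by
  have ht : parity k A Unit (t k A) = t k A := parity_var k ()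
  induction x using Forms.induction with
  | h0 => simp
  | h1 => simp [contr, oddDer_one]
  | hadd x y hx hy => simp [hx, hy, add_comm]
  | hsmul r x hx => simp [hx]
  | hof a x hx => simp [contr, oddDer_mul, oddDer_ofA] at hx ⊢; simp [hx]
  | hd a x hx => simp [contr, oddDer_mul, oddDer_dA, adT_apply, ht] at hx ⊢; simp [hx]
  | hvar v x hx => simp [contr, oddDer_mul, oddDer_var] at hx ⊢; simp [hx]

/-- `d i_t + i_t d` is the derivation `ω ↦ [ω, t]`. -/
theorem dOmega_contr (x : Forms k A Unit) :
    dOmega k A Unit (contr k A x) + contr k A (dOmega k A Unit x) = x * t k A - t k A * x := by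
  have hd : ∀ x y, dOmega k A Unit (x * y) =
      dOmega k A Unit x * y + parity k A Unit x * dOmega k A Unit y := oddDer_mul k _ _ _ _
  have hc : ∀ x y, contr k A (x * y) =
      contr k A x * y + parity k A Unit x * contr k A y := oddDer_mul k _ _ _ _
  have hd1 : ∀ a, dOmega k A Unit (ofA k A Unit a) = dA k A Unit a := oddDer_ofA k _ _ _ _
  have hd2 : ∀ a, dOmega k A Unit (dA k A Unit a) = 0 := oddDer_dA k _ _ _ _
  have hd3 : ∀ v, dOmega k A Unit (var k A v) = 0 := oddDer_var k _ _ _ _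
  have hc1 : ∀ a, contr k A (ofA k A Unit a) = 0 := oddDer_ofA k _ _ _ _
  have hc2 : ∀ a, contr k A (dA k A Unit a) = adT k A a := oddDer_dA k _ _ _ _
  have hc3 : ∀ v, contr k A (var k A v) = 0 := oddDer_var k _ _ _ _
  have key : ∀ x y, dOmega k A Unit (contr k A (x * y)) + contr k A (dOmega k A Unit (x * y)) =
      (dOmega k A Unit (contr k A x) + contr k A (dOmega k A Unit x)) * y +
      x * (dOmega k A Unit (contr k A y) + contr k A (dOmega k A Unit y)) := by
    intro x y
    simp only [hc, hd, map_add, parity_dOmega, parity_contr, parity_parity, neg_mul, add_mul,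
      mul_add]
    abel
  have ht : dOmega k A Unit (t k A) = 0 := hd3 ()
  induction x using Forms.induction with
  | h0 => simp
  | h1 => simp [contr, dOmega, oddDer_one]
  | hadd x y hx hy => simp only [map_add, add_mul, mul_add, add_sub_add_comm, ← hx, ← hy]; abel
  | hsmul r x hx => simp only [map_smul, ← smul_add, hx, smul_mul_assoc, mul_smul_comm, smul_sub]
  | hof a x hx => rw [key, hx, hc1, hd1, hc2, adT_apply]; simp only [map_zero]; noncomm_ring
  | hd a x hx =>
    rw [key, hx, hc2, hd2, adT_apply, map_sub, hd, hd, ht, hd1]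
    simp [show parity k A Unit (t k A) = t k A from parity_var k ()]
    noncomm_ring
  | hvar v x hx =>
    rw [key, hx, hc3, hd3]
    simp [t]; noncomm_ring

theorem exists_sum_forms (X : Type) (x : Forms k A X) :
    x ∈ Submodule.span k {y | ∃ p q, y ∈ forms k A X p q} := by
  have hx : x ∈ Submodule.span k (Set.range (word k (A := A) (X := X))) := by
    rw [span_word]; trivial
  refine Submodule.span_mono ?_ hx
  rintro _ ⟨w, rfl⟩
  exact ⟨_, _, word_mem_forms k w⟩

/-- The differentials `d` and `i_t` anticommute on the reduced commutator quotient. -/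
theorem contrDR_dDR (x : DRBar k A Unit) :
    contrDR k A (dDR k A Unit x) = -dDR k A Unit (contrDR k A x) := by
  obtain ⟨x, rfl⟩ : ∃ y, nat k A Unit y = x := Submodule.mkQ_surjective _ x
  rw [eq_neg_iff_add_eq_zero, add_comm, dDR_nat, contrDR_nat, contrDR_nat, dDR_nat, ← map_add,
    dOmega_contr]
  refine (Submodule.Quotient.mk_eq_zero _).2 (Submodule.mem_sup_right ?_)
  have hx := exists_sum_forms k A Unit x
  induction hx using Submodule.span_induction with
  | zero => simp
  | add x y _ _ hx hy =>
    rw [add_mul, mul_add, add_sub_add_comm]; exact Submodule.add_mem _ hx hy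
  | smul r x _ hx =>
    rw [smul_mul_assoc, mul_smul_comm, ← smul_sub]; exact Submodule.smul_mem _ _ hx
  | mem x hx =>
    obtain ⟨p, q, hx⟩ := hx
    exact Submodule.subset_span ⟨p, q, 0, 1, x, hx, t k A, var_mem k (), by simp⟩

/-- The algebra homomorphism `Ω_t → Ω`, `t ↦ 0`. -/
def modT : Forms k A Unit →ₐ[k] Forms k A Empty :=
  Forms.lift k (ofA k A Empty) (dA k A Empty) (dA_mul k A Empty) (fun _ => 0)

theorem modT_mem {p q : ℤ} {x : Forms k A Unit} (hx : x ∈ forms k A Unit p q) :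
    modT k A x ∈ forms k A Empty p q := by
  induction hx using Submodule.span_induction with
  | zero => simp
  | add x y _ _ hx hy => rw [map_add]; exact Submodule.add_mem _ hx hy
  | smul r x _ hx => rw [map_smul]; exact Submodule.smul_mem _ _ hx
  | mem x hx =>
    obtain ⟨w, rfl, rfl, rfl⟩ := hx
    induction w with
    | nil => simpa [word] using one_mem_forms k
    | cons g w ih =>
      rw [word_cons, map_mul, List.map_cons, List.sum_cons, List.map_cons, List.sum_cons]
      refine forms_mul k ?_ ih
      cases g with
      | of a => simpa [gen_of, modT, Gen.deg, Gen.varDeg] using ofA_mem k a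
      | d a => simpa [gen_d, modT, Gen.deg, Gen.varDeg] using dA_mem k a
      | var x => simp [gen_var, modT]

/-- Reduction modulo `t`, from the reduced commutator quotient of `Ω_t` to that of `Ω`. -/
def modTDR : DRBar k A Unit →ₗ[k] DRBar k A Empty :=
  Submodule.mapQ _ _ (modT k A).toLinearMap (sup_le
    (fun x hx => Submodule.mem_sup_left (by
      change x ∈ Algebra.adjoin k _ at hx
      change modT k A x ∈ Algebra.adjoin k _
      induction hx using Algebra.adjoin_induction with
      | mem x hx => obtain ⟨v, rfl⟩ := hx; simp [modT]
      | algebraMap r => rw [AlgHom.commutes]; exact Subalgebra.algebraMap_mem _ r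
      | add x y _ _ hx hy => rw [map_add]; exact Subalgebra.add_mem _ hx hy
      | mul x y _ _ hx hy => rw [map_mul]; exact Subalgebra.mul_mem _ hx hy))
    (fun x hx => Submodule.mem_sup_right (by
      change modT k A x ∈ comm k A Empty
      induction hx using Submodule.span_induction with
      | zero => simp
      | add x y _ _ hx hy => rw [map_add]; exact Submodule.add_mem _ hx hy
      | smul r x _ hx => rw [map_smul]; exact Submodule.smul_mem _ _ hx
      | mem z hz =>
        obtain ⟨p, q, p', q', x, hx, y, hy, rfl⟩ := hz
        exact Submodule.subset_span ⟨p, q, p', q', _, modT_mem k A hx, _, modT_mem k A hy, by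
          simp [Units.smul_def]⟩)))

end Contraction

section Recursion

variable (k : Type u) [CommRing k] (A : Type v) [Ring A] [Algebra k A]

/-- The algebra `Ω A` of noncommutative differential forms. -/
abbrev Omega : Type (max u v) := Forms k A Empty

variable (M : Type*) [AddCommGroup M] [Module k M]

/-- Data of a linear map `F` on `Ω`: its values `F a` on `A`, and its values `F (ω · d a)`, which
must vanish for `a = 1`. -/
def SplitData : Submodule k ((A →ₗ[k] M) × (Omega k A →ₗ[k] A →ₗ[k] M)) where
  carrier := {F | ∀ ω, F.2 ω 1 = 0}
  add_mem' := by intro F G hF hG ω; simp [hF ω, hG ω]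
  zero_mem' := by intro ω; simp
  smul_mem' := by intro r F hF ω; simp [hF ω]

variable {A M}

/-- Passing from the data of `F` to the data of `F (- · a)`, for `a : A`. -/
def splitA (a : A) : Module.End k (SplitData k A M) where
  toFun F := ⟨(F.1.1.comp (LinearMap.mulRight k a), LinearMap.mk₂ k
      (fun ω b => F.1.2 ω (b * a) - F.1.2 (ω * ofA k A Empty b) a)
      (by intros; simp only [map_add, add_mul, LinearMap.add_apply]; abel)
      (by intros; simp only [map_smul, smul_mul_assoc, LinearMap.smul_apply, smul_sub])
      (by intros; simp only [map_add, add_mul, mul_add, LinearMap.add_apply]; abel)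
      (by intros; simp only [map_smul, smul_mul_assoc, mul_smul_comm, LinearMap.smul_apply,
        smul_sub])), by intro ω; simp⟩
  map_add' F G := by
    ext
    · simp
    · simp; abel
  map_smul' r F := by
    ext
    · simp
    · simp [smul_sub]

/-- Passing from the data of `F` to the data of `F (- · d a)`, for `a : A`. -/
def splitD (a : A) : Module.End k (SplitData k A M) where
  toFun F := ⟨((F.1.2.flip a).comp (ofA k A Empty).toLinearMap, LinearMap.mk₂ k
      (fun ω b => F.1.2 (ω * dA k A Empty b) a)
      (by intros; simp only [map_add, add_mul, LinearMap.add_apply])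
      (by intros; simp only [map_smul, smul_mul_assoc, LinearMap.smul_apply])
      (by intros; simp only [map_add, mul_add, LinearMap.add_apply])
      (by intros; simp only [map_smul, mul_smul_comm, LinearMap.smul_apply])),
      by intro ω; simp [dA_one]⟩
  map_add' F G := by
    ext
    · simp
    · simp
  map_smul' r F := by
    ext
    · simp
    · simp

theorem splitA_fst (a : A) (F : SplitData k A M) (c : A) :
    (splitA k a F).1.1 c = F.1.1 (c * a) := rfl
theorem splitA_snd (a : A) (F : SplitData k A M) (ω : Omega k A) (b : A) :
    (splitA k a F).1.2 ω b = F.1.2 ω (b * a) - F.1.2 (ω * ofA k A Empty b) a := rfl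
theorem splitD_fst (a : A) (F : SplitData k A M) (c : A) :
    (splitD k a F).1.1 c = F.1.2 (ofA k A Empty c) a := rfl
theorem splitD_snd (a : A) (F : SplitData k A M) (ω : Omega k A) (b : A) :
    (splitD k a F).1.2 ω b = F.1.2 (ω * dA k A Empty b) a := rfl

theorem SplitData.ext' {F G : SplitData k A M} (h1 : ∀ c, F.1.1 c = G.1.1 c)
    (h2 : ∀ ω b, F.1.2 ω b = G.1.2 ω b) : F = G :=
  Subtype.ext (Prod.ext (LinearMap.ext h1) (LinearMap.ext fun ω => LinearMap.ext (h2 ω)))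

variable (A M)

/-- `splitA` as an algebra homomorphism. -/
def splitAHom : A →ₐ[k] Module.End k (SplitData k A M) :=
  AlgHom.ofLinearMap
    { toFun := splitA k
      map_add' := fun a b => LinearMap.ext fun F => SplitData.ext' k
        (fun c => by simp [splitA_fst, mul_add])
        (fun ω c => by simp [splitA_snd, mul_add]; abel)
      map_smul' := fun r a => LinearMap.ext fun F => SplitData.ext' k
        (fun c => by simp [splitA_fst])
        (fun ω c => by simp [splitA_snd, smul_sub]) }
    (LinearMap.ext fun F => SplitData.ext' k
        (fun c => by simp [splitA_fst])
        (fun ω c => by simp [splitA_snd, F.2 _]))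
    (fun a b => LinearMap.ext fun F => SplitData.ext' k
        (fun c => by simp [splitA_fst, mul_assoc])
        (fun ω c => by simp [splitA_snd, mul_assoc]))

/-- `splitD` as a linear map. -/
def splitDHom : A →ₗ[k] Module.End k (SplitData k A M) where
  toFun := splitD k
  map_add' := fun a b => LinearMap.ext fun F => SplitData.ext' k
    (fun c => by simp [splitD_fst])
    (fun ω c => by simp [splitD_snd])
  map_smul' := fun r a => LinearMap.ext fun F => SplitData.ext' k
    (fun c => by simp [splitD_fst])
    (fun ω c => by simp [splitD_snd])

theorem splitDHom_mul (a b : A) : splitDHom k A M (a * b) =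
    splitDHom k A M a * splitAHom k A M b + splitAHom k A M a * splitDHom k A M b :=
  LinearMap.ext fun F => SplitData.ext' k
    (fun c => by
      change (splitD k (a * b) F).1.1 c = (splitD k a (splitA k b F)).1.1 c +
        (splitA k a (splitD k b F)).1.1 c
      simp [splitD_fst, splitA_fst, splitA_snd])
    (fun ω c => by
      change (splitD k (a * b) F).1.2 ω c = (splitD k a (splitA k b F)).1.2 ω c +
        (splitA k a (splitD k b F)).1.2 ω c
      simp [splitD_snd, splitA_snd, dA_mul, mul_add, mul_assoc])

/-- The resulting action of `Ω` on split data: `ω` takes the data of `F` to those of `F (- · ω)`. -/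
def splitAction : Omega k A →ₐ[k] Module.End k (SplitData k A M) :=
  Forms.lift k (A := A) (X := Empty) (S := Module.End k (SplitData k A M))
    (splitAHom k A M) (splitDHom k A M) (splitDHom_mul k A M) Empty.elim

theorem splitAction_ofA (a : A) : splitAction k A M (ofA k A Empty a) = splitA k a := by
  simp [splitAction]; rfl
theorem splitAction_dA (a : A) : splitAction k A M (dA k A Empty a) = splitD k a := by
  simp [splitAction]; rfl

variable {A M}

/-- The linear map `F` on `Ω` with prescribed values `F a = f₀ a` on `A` and
`F (ω · d a) = f₁ ω a`, where `f₁ ω 1 = 0`. -/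
def splitRec (f₀ : A →ₗ[k] M) (f₁ : Omega k A →ₗ[k] A →ₗ[k] M) (h : ∀ ω, f₁ ω 1 = 0) :
    Omega k A →ₗ[k] M where
  toFun ω := (splitAction k A M ω ⟨(f₀, f₁), h⟩).1.1 1
  map_add' := by intros; simp
  map_smul' := by intros; simp

theorem splitRec_ofA (f₀ : A →ₗ[k] M) (f₁ : Omega k A →ₗ[k] A →ₗ[k] M) (h) (a : A) :
    splitRec k f₀ f₁ h (ofA k A Empty a) = f₀ a := by
  simp [splitRec, splitAction_ofA, splitA_fst]

theorem splitRec_mul_dA (f₀ : A →ₗ[k] M) (f₁ : Omega k A →ₗ[k] A →ₗ[k] M) (h)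
    (ω : Omega k A) (a : A) :
    splitRec k f₀ f₁ h (ω * dA k A Empty a) = f₁ ω a := by
  have key : ∀ ω : Omega k A,
      (∀ c, (splitAction k A M ω (splitD k a ⟨(f₀, f₁), h⟩)).1.1 c =
        f₁ (ofA k A Empty c * ω) a) ∧
      (∀ β b, (splitAction k A M ω (splitD k a ⟨(f₀, f₁), h⟩)).1.2 β b =
        f₁ (β * dA k A Empty b * ω) a) := by
    intro ω
    induction ω using Forms.induction with
    | h0 => simp
    | h1 => simp [splitD_fst, splitD_snd]
    | hadd x y hx hy => simp [hx, hy, mul_add]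
    | hsmul r x hx => simp [hx]
    | hof e x hx =>
      simp only [map_mul, splitAction_ofA, Module.End.mul_apply, splitA_fst, splitA_snd, hx]
      simp [dA_mul, mul_add, add_mul, mul_assoc]
    | hd e x hx =>
      simp only [map_mul, splitAction_dA, Module.End.mul_apply, splitD_fst, splitD_snd, hx]
      simp [mul_assoc]
    | hvar v x hx => exact v.elim
  have := (key ω).1 1
  simp only [splitRec, LinearMap.coe_mk, AddHom.coe_mk, map_mul, splitAction_dA,
    Module.End.mul_apply]
  rw [this]; simp

end Recursion

section Operators

variable (k : Type u) [CommRing k] (A : Type v) [Ring A] [Algebra k A]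

/-- The Hochschild differential: `b (a) = 0`, `b (ω · d a) = (-1)^{|ω|} (ω a - a ω)`. -/
def hochschild : Omega k A →ₗ[k] Omega k A :=
  splitRec k 0 (LinearMap.mk₂ k
    (fun ω a => parity k A Empty ω * ofA k A Empty a - ofA k A Empty a * parity k A Empty ω)
    (by intros; simp only [map_add, add_mul, mul_add]; abel)
    (by intros; simp [smul_sub])
    (by intros; simp only [map_add, add_mul, mul_add]; abel)
    (by intros; simp [smul_sub])) (by intro ω; simp)

/-- The Karoubi operator: `κ (ω · d a) = (-1)^{|ω|} d a · ω`, and `κ = id` in degree `0`. -/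
def karoubi : Omega k A →ₗ[k] Omega k A :=
  splitRec k (ofA k A Empty).toLinearMap (LinearMap.mk₂ k
    (fun ω a => dA k A Empty a * parity k A Empty ω)
    (by intros; simp only [map_add, mul_add])
    (by intros; simp)
    (by intros; simp only [map_add, add_mul])
    (by intros; simp)) (by intro ω; simp [dA_one])

/-- The algebra homomorphism `Ω → Ω[s]`, `a ↦ a`, `d a ↦ s · d a`; the coefficient of `s ^ n` of the
image of `ω` is the component of `ω` of degree `n`. -/
noncomputable def degSplit : Omega k A →ₐ[k] Polynomial (Omega k A) :=
  Forms.lift k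
    ((Polynomial.CAlgHom (R := k) (A := Omega k A)).comp (ofA k A Empty))
    ((LinearMap.mulRight k (Polynomial.X : Polynomial (Omega k A))).comp
      ((Polynomial.CAlgHom (R := k) (A := Omega k A)).toLinearMap.comp (dA k A Empty)))
    (by
      intro a b
      simp [dA_mul, add_mul, mul_assoc, Polynomial.X_mul_C])
    (fun v => v.elim)

/-- The linear map on `Ω` given by `T n` on the component of degree `n`. -/
noncomputable def byDegree {M : Type*} [AddCommGroup M] [Module k M] (T : ℕ → Omega k A →ₗ[k] M) :
    Omega k A →ₗ[k] M :=
  (Polynomial.lsum T).comp (degSplit k A).toLinearMap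

/-- The Connes differential `B = (1 + κ + ⋯ + κ ^ n) d` in degree `n`. -/
noncomputable def connes : Omega k A →ₗ[k] Omega k A :=
  byDegree k A fun n => (∑ j ∈ Finset.range (n + 1), karoubi k A ^ j) ∘ₗ dOmega k A Empty

variable {k A}

theorem hochschild_ofA (a : A) : hochschild k A (ofA k A Empty a) = 0 := by
  simp [hochschild, splitRec_ofA]
theorem hochschild_mul_dA (ω : Omega k A) (a : A) : hochschild k A (ω * dA k A Empty a) =
    parity k A Empty ω * ofA k A Empty a - ofA k A Empty a * parity k A Empty ω := by
  simp [hochschild, splitRec_mul_dA]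
theorem karoubi_ofA (a : A) : karoubi k A (ofA k A Empty a) = ofA k A Empty a := by
  simp [karoubi, splitRec_ofA]
theorem karoubi_mul_dA (ω : Omega k A) (a : A) : karoubi k A (ω * dA k A Empty a) =
    dA k A Empty a * parity k A Empty ω := by
  simp [karoubi, splitRec_mul_dA]

theorem degSplit_of_mem {p : ℕ} {x : Omega k A} (hx : x ∈ forms k A Empty p 0) :
    degSplit k A x = Polynomial.monomial p x := by
  have key : ∀ w : List (Gen A Empty), ∃ n : ℕ, (w.map Gen.deg).sum = n ∧
      degSplit k A (word k w) = Polynomial.monomial n (word k w) := by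
    intro w
    induction w with
    | nil => exact ⟨0, by simp, by simp [word]⟩
    | cons g w ih =>
      obtain ⟨n, h1, h2⟩ := ih
      cases g with
      | of a =>
        refine ⟨n, by simp [Gen.deg, h1], ?_⟩
        rw [word_cons, map_mul, h2, gen_of]
        simp [degSplit, Polynomial.C_mul_monomial]
      | d a =>
        refine ⟨n + 1, by simp [Gen.deg, h1, add_comm], ?_⟩
        rw [word_cons, map_mul, h2, gen_d]
        simp [degSplit, mul_assoc, Polynomial.X_mul_monomial, Polynomial.C_mul_monomial]
      | var v => exact v.elim
  induction hx using Submodule.span_induction with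
  | zero => simp
  | add x y _ _ hx hy => simp [hx, hy]
  | smul r x _ hx => rw [map_smul, hx, Polynomial.smul_monomial]
  | mem x hx =>
    obtain ⟨w, h1, -, rfl⟩ := hx
    obtain ⟨n, h2, h3⟩ := key w
    have : n = p := by exact_mod_cast h2.symm.trans h1
    rw [h3, this]

theorem byDegree_of_mem {M : Type*} [AddCommGroup M] [Module k M] (T : ℕ → Omega k A →ₗ[k] M)
    {p : ℕ} {x : Omega k A} (hx : x ∈ forms k A Empty p 0) : byDegree k A T x = T p x := by
  simp [byDegree, degSplit_of_mem hx, Polynomial.lsum, Polynomial.sum_monomial_index]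

end Operators

section Mixed

variable (k : Type u) [CommRing k] {A : Type v} [Ring A] [Algebra k A]

/-- The product `d a₁ ⋯ d aₙ`. -/
def dword (l : List A) : Omega k A := (l.map (dA k A Empty)).prod

theorem dword_cons (a : A) (l : List A) : dword k (a :: l) = dA k A Empty a * dword k l := by
  simp [dword]
theorem dword_concat (l : List A) (a : A) : dword k (l ++ [a]) = dword k l * dA k A Empty a := by
  simp [dword]

theorem dOmega_dword (l : List A) : dOmega k A Empty (dword k l) = 0 := by
  induction l with
  | nil => simp [dword, dOmega, oddDer_one]
  | cons a l ih =>
    rw [dword_cons, dOmega, oddDer_mul, oddDer_dA, ← dOmega, ih]; simp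

theorem dOmega_ofA_mul (a : A) (x : Omega k A) : dOmega k A Empty (ofA k A Empty a * x) =
    dA k A Empty a * x + ofA k A Empty a * dOmega k A Empty x := by
  rw [dOmega, oddDer_mul, oddDer_ofA, parity_ofA]

theorem dOmega_normal (a : A) (l : List A) :
    dOmega k A Empty (ofA k A Empty a * dword k l) = dword k (a :: l) := by
  rw [dOmega_ofA_mul, dOmega_dword, dword_cons]; simp

theorem forms_le_normal (w : List (Gen A Empty)) : word k w ∈ Submodule.span k
    {x | ∃ (a : A) (l : List A), (l.length : ℤ) = (w.map Gen.deg).sum ∧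
      x = ofA k A Empty a * dword k l} := by
  induction w with
  | nil => exact Submodule.subset_span ⟨1, [], by simp, by simp [word, dword]⟩
  | cons g w ih =>
    rw [word_cons]
    generalize word k w = y at ih
    induction ih using Submodule.span_induction with
    | zero => simp
    | add x y _ _ hx hy => rw [mul_add]; exact Submodule.add_mem _ hx hy
    | smul r x _ hx => rw [mul_smul_comm]; exact Submodule.smul_mem _ _ hx
    | mem x hx =>
      obtain ⟨a, l, hl, rfl⟩ := hx
      cases g with
      | of e =>
        exact Submodule.subset_span ⟨e * a, l, by simp [Gen.deg, hl], by
          rw [gen_of, map_mul, mul_assoc]⟩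
      | d e =>
        have : gen k (Gen.d e) * (ofA k A Empty a * dword k l) =
            ofA k A Empty 1 * dword k ((e * a) :: l) - ofA k A Empty e * dword k (a :: l) := by
          rw [gen_d, dword_cons, dword_cons, dA_mul, map_one]; noncomm_ring
        rw [this]
        refine Submodule.sub_mem _ (Submodule.subset_span ⟨_, _, ?_, rfl⟩)
          (Submodule.subset_span ⟨_, _, ?_, rfl⟩) <;> simp [Gen.deg, ← hl, add_comm]
      | var v => exact v.elim

theorem mem_normal {p q : ℤ} {x : Omega k A} (hx : x ∈ forms k A Empty p q) :
    x ∈ Submodule.span k {x | ∃ (a : A) (l : List A), (l.length : ℤ) = p ∧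
      x = ofA k A Empty a * dword k l} := by
  induction hx using Submodule.span_induction with
  | zero => simp
  | add x y _ _ hx hy => exact Submodule.add_mem _ hx hy
  | smul r x _ hx => exact Submodule.smul_mem _ _ hx
  | mem x hx =>
    obtain ⟨w, rfl, -, rfl⟩ := hx
    exact forms_le_normal k w

theorem normal_mem (a : A) (l : List A) :
    ofA k A Empty a * dword k l ∈ forms k A Empty l.length 0 := by
  have h : dword k l ∈ forms k A Empty l.length 0 := by
    induction l with
    | nil => simpa [dword] using one_mem_forms k
    | cons b l ih =>
      rw [dword_cons]
      have := forms_mul k (dA_mem k (X := Empty) b) ih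
      rwa [List.length_cons, Nat.cast_succ, add_comm]
  simpa using forms_mul k (ofA_mem k a) h

/-- Linear maps on `Ω` are determined by their values on the forms `a₀ d a₁ ⋯ d aₙ`. -/
theorem Omega.hom_ext {M : Type*} [AddCommGroup M] [Module k M] {f g : Omega k A →ₗ[k] M}
    (h : ∀ a l, f (ofA k A Empty a * dword k l) = g (ofA k A Empty a * dword k l)) : f = g := by
  refine LinearMap.ext_on (span_word k) ?_
  rintro _ ⟨w, rfl⟩
  have hw := forms_le_normal k w
  generalize word k w = y at hw
  induction hw using Submodule.span_induction with
  | zero => simp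
  | add x y _ _ hx hy => simp [hx, hy]
  | smul r x _ hx => simp [hx]
  | mem x hx => obtain ⟨a, l, -, rfl⟩ := hx; exact h a l

/-- `Ω` is spanned by `A` and the forms `ω · d a`. -/
theorem Omega.hom_ext' {M : Type*} [AddCommGroup M] [Module k M] {f g : Omega k A →ₗ[k] M}
    (h0 : ∀ a, f (ofA k A Empty a) = g (ofA k A Empty a))
    (h1 : ∀ ω a, f (ω * dA k A Empty a) = g (ω * dA k A Empty a)) : f = g := by
  refine Omega.hom_ext k fun a l => ?_
  rcases l.eq_nil_or_concat' with rfl | ⟨l, b, rfl⟩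
  · simpa [dword] using h0 a
  · rw [dword_concat, ← mul_assoc, h1]

theorem hochschild_comp_self : hochschild k A ∘ₗ hochschild k A = 0 := by
  refine Omega.hom_ext' k (fun a => by simp [hochschild_ofA]) fun ω a => ?_
  have key : hochschild k A ∘ₗ (LinearMap.mulRight k (ofA k A Empty a) -
      LinearMap.mulLeft k (ofA k A Empty a)) = 0 := by
    refine Omega.hom_ext' k (fun b => ?_) fun η b => ?_
    · simp [← map_mul, hochschild_ofA]
    · have : η * dA k A Empty b * ofA k A Empty a =
          η * dA k A Empty (b * a) - (η * ofA k A Empty b) * dA k A Empty a := by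
        rw [dA_mul]; noncomm_ring
      simp only [LinearMap.comp_apply, LinearMap.sub_apply, LinearMap.mulRight_apply,
        LinearMap.mulLeft_apply, this, map_sub, ← mul_assoc, hochschild_mul_dA, map_mul, parity_ofA,
        LinearMap.zero_apply]
      noncomm_ring
  have := LinearMap.congr_fun key (parity k A Empty ω)
  simpa [hochschild_mul_dA] using this

theorem hochschild_hochschild (x : Omega k A) : hochschild k A (hochschild k A x) = 0 :=
  LinearMap.congr_fun (hochschild_comp_self k) x

theorem dOmega_dOmega (x : Omega k A) : dOmega k A Empty (dOmega k A Empty x) = 0 := by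
  have : dOmega k A Empty ∘ₗ dOmega k A Empty = 0 := Omega.hom_ext k fun a l => by
    simp [dOmega_normal, dOmega_dword]
  exact LinearMap.congr_fun this x

/-- `b d + d b = 1 - κ`. -/
theorem hochschild_dOmega (x : Omega k A) :
    hochschild k A (dOmega k A Empty x) + dOmega k A Empty (hochschild k A x) =
      x - karoubi k A x := by
  have : hochschild k A ∘ₗ dOmega k A Empty + dOmega k A Empty ∘ₗ hochschild k A =
      LinearMap.id - karoubi k A := by
    refine Omega.hom_ext' k (fun a => ?_) fun ω a => ?_
    · have h : dOmega k A Empty (ofA k A Empty a) = 1 * dA k A Empty a := by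
        rw [dOmega, oddDer_ofA, one_mul]
      simp only [LinearMap.add_apply, LinearMap.sub_apply, LinearMap.comp_apply,
        LinearMap.id_apply, h, hochschild_mul_dA, hochschild_ofA, karoubi_ofA]
      simp
    · have h1 : ∀ a, dOmega k A Empty (ofA k A Empty a) = dA k A Empty a :=
        fun a => oddDer_ofA k _ _ _ _ a
      have h2 : ∀ a, dOmega k A Empty (dA k A Empty a) = 0 := fun a => oddDer_dA k _ _ _ _ a
      have h3 : ∀ x y, dOmega k A Empty (x * y) =
        dOmega k A Empty x * y + parity k A Empty x * dOmega k A Empty y := oddDer_mul k _ _ _ _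
      simp only [LinearMap.add_apply, LinearMap.sub_apply, LinearMap.comp_apply, LinearMap.id_apply,
        karoubi_mul_dA, h3, h2, mul_zero, add_zero, hochschild_mul_dA, map_sub, h1, parity_dOmega,
        parity_parity, parity_ofA]
      noncomm_ring
  exact LinearMap.congr_fun this x

theorem karoubi_hochschild (x : Omega k A) :
    karoubi k A (hochschild k A x) = hochschild k A (karoubi k A x) := by
  have h1 := hochschild_dOmega k (hochschild k A x)
  have h2 := congrArg (hochschild k A) (hochschild_dOmega k x)
  rw [hochschild_hochschild, map_zero, add_zero] at h1
  rw [map_add, hochschild_hochschild, zero_add, map_sub, h1] at h2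
  exact sub_right_injective h2

theorem parity_pow_dA (n : ℕ) (a : A) :
    ((parity k A Empty).toLinearMap ^ n) (dA k A Empty a) = (-1 : ℤ) ^ n • dA k A Empty a := by
  induction n with
  | zero => simp
  | succ n ih => rw [pow_succ', Module.End.mul_apply, ih]; simp [pow_succ]

theorem parity_pow_mul (n : ℕ) (x y : Omega k A) :
    ((parity k A Empty).toLinearMap ^ n) (x * y) =
      ((parity k A Empty).toLinearMap ^ n) x * ((parity k A Empty).toLinearMap ^ n) y := by
  induction n with
  | zero => simp
  | succ n ih => rw [pow_succ', Module.End.mul_apply, ih]; simp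

theorem parity_pow_ofA (n : ℕ) (a : A) :
    ((parity k A Empty).toLinearMap ^ n) (ofA k A Empty a) = ofA k A Empty a := by
  induction n with
  | zero => simp
  | succ n ih => rw [pow_succ', Module.End.mul_apply, ih]; simp

theorem parity_dword (l : List A) :
    parity k A Empty (dword k l) = (-1 : ℤ) ^ l.length • dword k l := by
  induction l with
  | nil => simp [dword]
  | cons a l ih => rw [dword_cons, map_mul, ih, parity_dA, mul_smul_comm, List.length_cons, pow_succ,
      mul_neg_one, neg_smul, neg_mul, smul_neg]

theorem karoubi_pow_dword (l : List A) (x : Omega k A) :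
    (karoubi k A ^ l.length) (x * dword k l) =
      dword k l * ((parity k A Empty).toLinearMap ^ l.length) x := by
  induction l using List.reverseRecOn generalizing x with
  | nil => simp [dword]
  | append_singleton l a ih =>
    rw [List.length_append, List.length_singleton, pow_succ, Module.End.mul_apply, dword_concat,
      ← mul_assoc, karoubi_mul_dA, map_mul (parity k A Empty), parity_dword, mul_smul_comm, mul_smul_comm, map_zsmul,
      ← mul_assoc, ih, parity_pow_mul, parity_pow_dA, pow_succ, Module.End.mul_apply,
      smul_mul_assoc, mul_smul_comm, smul_smul, ← mul_pow]
    simp [mul_assoc]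

theorem hochschild_mem {n : ℕ} {x : Omega k A} (hx : x ∈ forms k A Empty ((n : ℤ) + 1) 0) :
    hochschild k A x ∈ forms k A Empty n 0 := by
  replace hx := mem_normal k hx
  induction hx using Submodule.span_induction with
  | zero => simp
  | add x y _ _ hx hy => rw [map_add]; exact Submodule.add_mem _ hx hy
  | smul r x _ hx => rw [map_smul]; exact Submodule.smul_mem _ _ hx
  | mem x hx =>
    obtain ⟨a, l, hl, rfl⟩ := hx
    rcases l.eq_nil_or_concat' with rfl | ⟨l, b, rfl⟩
    · simp at hl; omega
    · have hl' : (l.length : ℤ) = n := by simpa using hl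
      rw [dword_concat, ← mul_assoc, hochschild_mul_dA, parity_of_mem k (normal_mem k a l)]
      have h := normal_mem k a l
      rw [hl'] at h
      refine Submodule.sub_mem _ ?_ ?_
      · rw [Units.smul_def, smul_mul_assoc]
        exact Submodule.smul_of_tower_mem _ _ (by simpa using forms_mul k h (ofA_mem k b))
      · rw [Units.smul_def, mul_smul_comm]
        exact Submodule.smul_of_tower_mem _ _ (by simpa using forms_mul k (ofA_mem k b) h)

theorem karoubi_pow_dOmega {n : ℕ} {x : Omega k A} (hx : x ∈ forms k A Empty n 0) :
    (karoubi k A ^ (n + 1)) (dOmega k A Empty x) = dOmega k A Empty x := by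
  replace hx := mem_normal k hx
  induction hx using Submodule.span_induction with
  | zero => simp
  | add x y _ _ hx hy => simp only [map_add, hx, hy]
  | smul r x _ hx => simp only [map_smul, hx]
  | mem x hx =>
    obtain ⟨a, l, hl, rfl⟩ := hx
    have hl' : l.length = n := by exact_mod_cast hl
    have h := karoubi_pow_dword k (a :: l) 1
    have h1 : ((parity k A Empty).toLinearMap ^ (a :: l).length) (1 : Omega k A) = 1 := by
      rw [← map_one (ofA k A Empty), parity_pow_ofA]
    rw [h1, one_mul, mul_one, List.length_cons, hl'] at h
    rw [dOmega_normal, h]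

theorem connes_of_mem {n : ℕ} {x : Omega k A} (hx : x ∈ forms k A Empty n 0) :
    connes k A x = ∑ j ∈ Finset.range (n + 1), (karoubi k A ^ j) (dOmega k A Empty x) := by
  rw [connes, byDegree_of_mem _ hx]; simp

theorem karoubi_pow_hochschild (j : ℕ) (x : Omega k A) :
    hochschild k A ((karoubi k A ^ j) x) = (karoubi k A ^ j) (hochschild k A x) := by
  induction j with
  | zero => simp
  | succ j ih => rw [pow_succ', Module.End.mul_apply, Module.End.mul_apply, ← karoubi_hochschild, ih]

theorem karoubi_pow_normal (a : A) (l : List A) :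
    (karoubi k A ^ (l.length + 1)) (ofA k A Empty a * dword k l) =
      ofA k A Empty a * dword k l -
        dOmega k A Empty (hochschild k A (ofA k A Empty a * dword k l)) := by
  rw [pow_succ', Module.End.mul_apply, karoubi_pow_dword, parity_pow_ofA]
  have h1 : hochschild k A (dword k l * dA k A Empty a) = (-1 : ℤ) ^ l.length •
      (dword k l * ofA k A Empty a - ofA k A Empty a * dword k l) := by
    rw [hochschild_mul_dA, parity_dword, smul_sub, smul_mul_assoc, mul_smul_comm]
  have h2 : karoubi k A (dword k l * dA k A Empty a) = (-1 : ℤ) ^ l.length •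
      dOmega k A Empty (ofA k A Empty a * dword k l) := by
    rw [karoubi_mul_dA, parity_dword, mul_smul_comm, dOmega_normal, dword_cons]
  have h3 : dword k l * ofA k A Empty a = ofA k A Empty a * dword k l +
      (-1 : ℤ) ^ l.length • hochschild k A (dword k l * dA k A Empty a) := by
    rw [h1, smul_smul, ← mul_pow]; simp
  rw [h3, map_add, map_zsmul, karoubi_hochschild, h2, map_zsmul, smul_smul, ← mul_pow]
  have h4 := hochschild_dOmega k (ofA k A Empty a * dword k l)
  simp only [neg_mul_neg, mul_one, one_pow, one_smul]
  rw [eq_sub_iff_add_eq, add_assoc, h4]; abel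

/-- The differentials `b` and `B` anticommute. -/
theorem hochschild_connes (x : Omega k A) :
    hochschild k A (connes k A x) = -connes k A (hochschild k A x) := by
  have : hochschild k A ∘ₗ connes k A = -(connes k A ∘ₗ hochschild k A) := by
    refine Omega.hom_ext k fun a l => ?_
    have h := normal_mem k a l
    simp only [LinearMap.comp_apply, LinearMap.neg_apply]
    set f := ofA k A Empty a * dword k l with hf
    rw [connes_of_mem k h, map_sum]
    have e1 : ∀ j, hochschild k A ((karoubi k A ^ j) (dOmega k A Empty f)) =
        ((karoubi k A ^ j) f - (karoubi k A ^ (j + 1)) f) -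
          (karoubi k A ^ j) (dOmega k A Empty (hochschild k A f)) := by
      intro j
      rw [karoubi_pow_hochschild, eq_sub_of_add_eq (hochschild_dOmega k f), map_sub, map_sub,
        pow_succ, Module.End.mul_apply]
    simp only [e1]
    rw [Finset.sum_sub_distrib, Finset.sum_range_sub', karoubi_pow_normal k a l, ← hf]
    rcases l.eq_nil_or_concat' with rfl | ⟨l, b, rfl⟩
    · have : f = ofA k A Empty a := by simp [hf, dword]
      simp [this, hochschild_ofA]
    · have hb : hochschild k A f ∈ forms k A Empty l.length 0 :=
        hochschild_mem k (by simpa using h)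
      rw [connes_of_mem k hb, List.length_append, List.length_singleton, Finset.sum_range_succ,
        karoubi_pow_dOmega k hb]
      simp
  exact LinearMap.congr_fun this x

end Mixed

section ReducedForms

variable (k : Type u) [CommRing k] (A : Type v) [Ring A] [Algebra k A]

/-- The reduced forms `Ω / k`. -/
abbrev OmegaR : Type (max u v) := OmegaBar k A Empty

/-- The component of degree `p` of the reduced forms. -/
def omegaForms (p : ℤ) : Submodule k (OmegaR k A) := (forms k A Empty p 0).map (consts k A Empty).mkQ

variable {k A} in
theorem mem_consts_empty {x : Omega k A} (hx : x ∈ consts k A Empty) :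
    ∃ r : k, x = ofA k A Empty (algebraMap k A r) := by
  change x ∈ Algebra.adjoin k _ at hx
  rw [Set.range_eq_empty, Algebra.adjoin_empty] at hx
  obtain ⟨r, rfl⟩ := Algebra.mem_bot.1 hx
  exact ⟨r, by rw [AlgHom.commutes]⟩

/-- The Hochschild differential on reduced forms. -/
def hochschildR : OmegaR k A →ₗ[k] OmegaR k A :=
  Submodule.mapQ _ _ (hochschild k A) (fun x hx => by
    obtain ⟨r, rfl⟩ := mem_consts_empty hx
    rw [Submodule.mem_comap, hochschild_ofA]; exact Submodule.zero_mem _)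

theorem connes_consts {x : Omega k A} (hx : x ∈ consts k A Empty) : connes k A x = 0 := by
  have h0 := oddDer_consts k (dA k A Empty) 0 (dA_mul k A Empty) (by intro a b; simp) hx
  obtain ⟨r, rfl⟩ := mem_consts_empty hx
  have h1 : ofA k A Empty (algebraMap k A r) ∈ forms k A Empty (0 : ℕ) 0 := ofA_mem k _
  rw [connes_of_mem k h1, dOmega, h0]; simp

/-- The Connes differential on reduced forms. -/
noncomputable def connesR : OmegaR k A →ₗ[k] OmegaR k A :=
  Submodule.mapQ _ _ (connes k A) (fun x hx => by
    rw [Submodule.mem_comap, connes_consts k A hx]; exact Submodule.zero_mem _)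

theorem hochschildR_connesR (x : OmegaR k A) :
    hochschildR k A (connesR k A x) = -connesR k A (hochschildR k A x) := by
  obtain ⟨x, rfl⟩ := Submodule.mkQ_surjective _ x
  exact congrArg (consts k A Empty).mkQ (hochschild_connes k x)

/-- The differential induced by `b` on `Ω̄ / B Ω̄`, for `Ω̄` the reduced forms. -/
noncomputable def hochschildModB :
    (OmegaR k A ⧸ LinearMap.range (connesR k A)) →ₗ[k]
      (OmegaR k A ⧸ LinearMap.range (connesR k A)) :=
  Submodule.mapQ _ _ (hochschildR k A) (by
    rintro _ ⟨x, rfl⟩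
    rw [Submodule.mem_comap, hochschildR_connesR, ← map_neg]
    exact LinearMap.mem_range_self _ _)

/-- The differential induced by `i_t` on the quotient of the reduced commutator quotient of `Ω_t` by
the image of `d`. -/
def contrModD :
    (DRBar k A Unit ⧸ LinearMap.range (dDR k A Unit)) →ₗ[k]
      (DRBar k A Unit ⧸ LinearMap.range (dDR k A Unit)) :=
  Submodule.mapQ _ _ (contrDR k A) (by
    rintro _ ⟨x, rfl⟩
    rw [Submodule.mem_comap, contrDR_dDR, ← map_neg]
    exact LinearMap.mem_range_self _ _)

end ReducedForms

section Spread

variable (k : Type u) [CommRing k] (A : Type v) [Ring A] [Algebra k A]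

theorem t_pow_mem (q : ℕ) : t k A ^ q ∈ consts k A Unit := by
  have h : t k A ∈ Algebra.adjoin k (Set.range (var k A (X := Unit))) :=
    Algebra.subset_adjoin ⟨(), rfl⟩
  exact Subalgebra.pow_mem _ h q

/-- The map `Ω → Ω_t` taking `a₀ d a₁ ⋯ d aₙ` to the sum of the forms
`a₀ t ^ k₀ · d a₁ t ^ k₁ ⋯ d aₙ t ^ kₙ` over all `k₀ + ⋯ + kₙ = q`, and vanishing on the forms of
degree different from `n`. -/
def spread : ℕ → ℕ → (Omega k A →ₗ[k] Forms k A Unit)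
  | 0, q => splitRec k ((LinearMap.mulRight k (t k A ^ q)).comp (ofA k A Unit).toLinearMap) 0
      (by intro ω; simp)
  | n + 1, q => splitRec k 0 (LinearMap.mk₂ k
      (fun ω a => ∑ ij ∈ Finset.HasAntidiagonal.antidiagonal q,
        spread n ij.1 ω * dA k A Unit a * t k A ^ ij.2)
      (by intros; simp only [map_add, add_mul, Finset.sum_add_distrib])
      (by intros; simp only [map_smul, smul_mul_assoc, Finset.smul_sum])
      (by intros; simp only [map_add, mul_add, add_mul, Finset.sum_add_distrib])
      (by intros; simp only [map_smul, smul_mul_assoc, mul_smul_comm, Finset.smul_sum]))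
      (by intro ω; simp [dA_one])

end Spread

section Tsygan

variable (k : Type u) [CommRing k] [Algebra ℚ k] (A : Type v) [Ring A] [Algebra k A]

/-- The component of bidegree `(n, q)` of the Tsygan map: `a₀ d a₁ ⋯ d aₙ` goes to `1 / (q + n)!`
times the class of the sum of the forms `a₀ t ^ k₀ · d a₁ t ^ k₁ ⋯ d aₙ t ^ kₙ` over all
`k₀ + ⋯ + kₙ = q`. -/
def tsyganAux (n q : ℕ) : Omega k A →ₗ[k] DRBar k A Unit :=
  algebraMap ℚ k (1 / (q + n).factorial) • (nat k A Unit ∘ₗ spread k A n q)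

theorem tsyganAux_consts (n q : ℕ) {x : Omega k A} (hx : x ∈ consts k A Empty) :
    tsyganAux k A n q x = 0 := by
  obtain ⟨r, rfl⟩ := mem_consts_empty hx
  have : nat k A Unit (spread k A n q (ofA k A Empty (algebraMap k A r))) = 0 := by
    cases n with
    | zero =>
      rw [spread, splitRec_ofA]
      refine (Submodule.Quotient.mk_eq_zero _).2 (Submodule.mem_sup_left ?_)
      simp only [LinearMap.comp_apply, LinearMap.mulRight_apply, AlgHom.toLinearMap_apply,
        AlgHom.commutes]
      rw [← Algebra.smul_def]
      exact Submodule.smul_mem _ _ (t_pow_mem k A q)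
    | succ n => rw [spread, splitRec_ofA]; simp
  rw [tsyganAux, LinearMap.smul_apply, LinearMap.comp_apply, this, smul_zero]

/-- The component of bidegree `(n, q)` of the Tsygan map, on reduced forms. -/
def tsyganBi (n q : ℕ) : OmegaR k A →ₗ[k] DRBar k A Unit :=
  (consts k A Empty).liftQ (tsyganAux k A n q) (fun _ hx => tsyganAux_consts k A n q hx)

/-- The component `E ^ q` of `t`-degree `q` of the Tsygan map `E`, on reduced forms. -/
noncomputable def tsygan (q : ℕ) : OmegaR k A →ₗ[k] DRBar k A Unit :=
  (consts k A Empty).liftQ (byDegree k A fun n => tsyganAux k A n q) (fun x hx => by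
    have h := tsyganAux_consts k A 0 q hx
    obtain ⟨r, rfl⟩ := mem_consts_empty hx
    have h1 : ofA k A Empty (algebraMap k A r) ∈ forms k A Empty (0 : ℕ) 0 := ofA_mem k _
    rw [LinearMap.mem_ker, byDegree_of_mem _ h1, h])

end Tsygan

section Complexes

/-- The homology `(C ∩ ker D) / D C'` of a differential `D` at the homogeneous component `C`, where
`C'` is the homogeneous component that `D` maps to `C`. -/
def HomologyAt {k : Type*} [CommRing k] {M : Type*} [AddCommGroup M] [Module k M]
    (D : M →ₗ[k] M) (C C' : Submodule k M) : Type _ :=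
  ↥(C ⊓ LinearMap.ker D) ⧸ (C'.map D).submoduleOf (C ⊓ LinearMap.ker D)

instance {k : Type*} [CommRing k] {M : Type*} [AddCommGroup M] [Module k M]
    (D : M →ₗ[k] M) (C C' : Submodule k M) : AddCommGroup (HomologyAt D C C') :=
  inferInstanceAs (AddCommGroup
    (↥(C ⊓ LinearMap.ker D) ⧸ (C'.map D).submoduleOf (C ⊓ LinearMap.ker D)))

instance {k : Type*} [CommRing k] {M : Type*} [AddCommGroup M] [Module k M]
    (D : M →ₗ[k] M) (C C' : Submodule k M) : Module k (HomologyAt D C C') :=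
  inferInstanceAs (Module k
    (↥(C ⊓ LinearMap.ker D) ⧸ (C'.map D).submoduleOf (C ⊓ LinearMap.ker D)))

/-- The homology class of a cycle. -/
def HomologyAt.cls {k : Type*} [CommRing k] {M : Type*} [AddCommGroup M] [Module k M]
    (D : M →ₗ[k] M) (C C' : Submodule k M) (z : M) (hz : z ∈ C ⊓ LinearMap.ker D) :
    HomologyAt D C C' :=
  Submodule.Quotient.mk ⟨z, hz⟩

/-- `φ` is induced by the assignment `g₁ x ↦ g₂ x`: whenever `g₁ x` is a cycle, so is `g₂ x`, and
`φ` takes the class of `g₁ x` to the class of `g₂ x`. -/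
def Induces {k : Type*} [CommRing k] {M N₁ N₂ : Type*} [AddCommGroup N₁] [Module k N₁]
    [AddCommGroup N₂] [Module k N₂] {D₁ : N₁ →ₗ[k] N₁} {C₁ C₁' : Submodule k N₁}
    {D₂ : N₂ →ₗ[k] N₂} {C₂ C₂' : Submodule k N₂} (g₁ : M → N₁) (g₂ : M → N₂)
    (φ : HomologyAt D₁ C₁ C₁' →ₗ[k] HomologyAt D₂ C₂ C₂') : Prop :=
  ∀ (x : M) (h₁ : g₁ x ∈ C₁ ⊓ LinearMap.ker D₁), ∃ h₂ : g₂ x ∈ C₂ ⊓ LinearMap.ker D₂,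
    φ (HomologyAt.cls D₁ C₁ C₁' (g₁ x) h₁) = HomologyAt.cls D₂ C₂ C₂' (g₂ x) h₂

/-- With `∑ fᵣ u ^ (-r)` in `M ⊗ R`, `R = k((u)) / u k[[u]]`, written as the finitely supported
function `r ↦ fᵣ`, this is the operator `δ - u ∂`. -/
noncomputable def totalDiff {k : Type*} [CommRing k] {M : Type*} [AddCommGroup M] [Module k M]
    (δ d : M →ₗ[k] M) : (ℕ →₀ M) →ₗ[k] (ℕ →₀ M) :=
  Finsupp.mapRange.linearMap δ -
    Finsupp.lcomapDomain Nat.succ Nat.succ_injective ∘ₗ Finsupp.mapRange.linearMap d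

theorem totalDiff_apply {k : Type*} [CommRing k] {M : Type*} [AddCommGroup M] [Module k M]
    (δ d : M →ₗ[k] M) (f : ℕ →₀ M) (r : ℕ) :
    totalDiff δ d f r = δ (f r) - d (f (r + 1)) := by
  simp [totalDiff, Finsupp.lcomapDomain]

/-- The finitely supported functions `f` with `f r ∈ S r` for all `r`. -/
def coeffsIn {k : Type*} [CommRing k] {M : Type*} [AddCommGroup M] [Module k M]
    (S : ℕ → Submodule k M) : Submodule k (ℕ →₀ M) where
  carrier := {f | ∀ r, f r ∈ S r}
  add_mem' := fun hf hg r => Submodule.add_mem _ (hf r) (hg r)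
  zero_mem' := fun _ => Submodule.zero_mem _
  smul_mem' := fun c _ hf r => Submodule.smul_mem _ c (hf r)

variable (k : Type u) [CommRing k] (A : Type v) [Ring A] [Algebra k A]

/-- Reduced Karoubi-de Rham homology in degree `n`. -/
abbrev HD (n : ℤ) := HomologyAt (dDR k A Empty) (drForms k A Empty n 0) (drForms k A Empty (n - 1) 0)

/-- The component of homological degree `ℓ` and internal degree `K` of the extended complex: the
coefficient of `u ^ (-r)` has bidegree `(p, q)` with `p + 2 r = ℓ` and `p + q + r = K`. -/
def extForms (ℓ K : ℤ) : Submodule k (ℕ →₀ DRBar k A Unit) :=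
  coeffsIn fun r => drForms k A Unit (ℓ - 2 * r) (K - (ℓ - 2 * r) - r)

/-- The weight `m` part of reduced extended cyclic homology in degree `ℓ`: the homology in degree
`ℓ` of the component of internal degree `ℓ - m`, with differential `i_t - u d`. -/
abbrev EHC (ℓ m : ℤ) := HomologyAt (totalDiff (contrDR k A) (dDR k A Unit))
  (extForms k A ℓ (ℓ - m)) (extForms k A (ℓ + 1) (ℓ - m))

/-- The homology in bidegree `(p, q)` of the quotient of the reduced commutator quotient of `Ω_t` by
the image of `d`, with differential `i_t`. -/
abbrev HModD (p q : ℤ) := HomologyAt (contrModD k A)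
  ((drForms k A Unit p q).map (LinearMap.range (dDR k A Unit)).mkQ)
  ((drForms k A Unit (p + 1) (q - 1)).map (LinearMap.range (dDR k A Unit)).mkQ)

/-- The component of degree `ℓ` of `Ω̄ ⊗ R`: the coefficient of `u ^ (-r)` has degree `ℓ - 2 r`. -/
def cyclicForms (ℓ : ℤ) : Submodule k (ℕ →₀ OmegaR k A) :=
  coeffsIn fun r => omegaForms k A (ℓ - 2 * r)

/-- Reduced cyclic homology in degree `ℓ`: the homology of `(Ω̄ ⊗ R, b - u B)`. -/
abbrev HC (ℓ : ℤ) := HomologyAt (totalDiff (hochschildR k A) (connesR k A))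
  (cyclicForms k A ℓ) (cyclicForms k A (ℓ + 1))

/-- The homology in degree `ℓ` of `(Ω̄ / B Ω̄, b)`. -/
abbrev HModB (ℓ : ℤ) := HomologyAt (hochschildModB k A)
  ((omegaForms k A ℓ).map (LinearMap.range (connesR k A)).mkQ)
  ((omegaForms k A (ℓ + 1)).map (LinearMap.range (connesR k A)).mkQ)

/-- `∑ fᵣ u ^ (-r) ↦ f_m mod t`. -/
def piCoeff (m : ℕ) (f : ℕ →₀ DRBar k A Unit) : DRBar k A Empty := modTDR k A (f m)

/-- `∑ fᵣ u ^ (-r) ↦ f₀ mod im d`. -/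
def piMinus (f : ℕ →₀ DRBar k A Unit) : DRBar k A Unit ⧸ LinearMap.range (dDR k A Unit) :=
  (LinearMap.range (dDR k A Unit)).mkQ (f 0)

/-- `∑ fᵣ u ^ (-r) ↦ f₀ mod im B`. -/
noncomputable def cuntzQuillen (f : ℕ →₀ OmegaR k A) : OmegaR k A ⧸ LinearMap.range (connesR k A) :=
  (LinearMap.range (connesR k A)).mkQ (f 0)

/-- The component of internal degree `K` of the Tsygan map, extended `R`-linearly: the coefficient
`fᵣ` of `u ^ (-r)` is sent to the sum of the components of `E fᵣ` of bidegree `(p, q)` with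
`p + q + r = K`. -/
noncomputable def tsyganWeight [Algebra ℚ k] (K : ℤ) :
    (ℕ →₀ OmegaR k A) →ₗ[k] (ℕ →₀ DRBar k A Unit) :=
  Finsupp.lsum k fun r : ℕ => Finsupp.lsingle r ∘ₗ
    (if (r : ℤ) ≤ K then
      ∑ pq ∈ Finset.HasAntidiagonal.antidiagonal (K - r).toNat, tsyganBi k A pq.1 pq.2
    else 0)

end Complexes

end ExtendedCyclic

open ExtendedCyclic

/-! Part (i) rests on one exactness statement: the reduced commutator quotient of `Ω_t` is exact for
`d` in every positive `t`-degree (`exists_dDR_eq`). The forms themselves are acyclic modulo `k⟨X⟩`,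
by a contracting homotopy `h` built from the retraction `s : A → k`, with `h (d c · τ) = (c - s c)
τ` (`sub_homotopy_mem_consts`). To descend to commutator quotients one uses the cyclic derivative
`∂` in `t`. It turns a class into an honest form (modulo `k[t]`), kills graded commutators, commutes
with `d`, and satisfies Euler's identity `(∂x · t)♮ = q x♮` in `t`-degree `q`. If `x♮` is closed,
then `∂x = d y` modulo `k[t]`, so `q x♮ = d (y t)♮`, and `q > 0` is invertible.

In homological degree `ℓ` and internal degree `ℓ - m`, the coefficient of `u ^ (-r)` has bidegree
`(ℓ - 2r, r - m)`. The term `u d` joins neighbouring coefficients of equal `t`-degree, while `i_t`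
raises the `t`-degree. Hence `d` is exact wherever the `t`-degree is positive, except at the
truncation `r = 0`, where a coefficient need not be `d`-closed. For `m > 0` the coefficients with `r
< m` vanish and `t`-degree zero occurs at `r = m`, leaving the homology of `d` on `DR`. For `m ≤ 0`
only the truncation contributes, leaving the cokernel of `d`. Since the de Rham degree becomes
negative for large `r`, the usual zigzags terminate (`exists_extension`, `exists_totalDiff_eq`).

For the Cuntz–Quillen isomorphism, the relations `κ ^ (n + 1) = 1 - d b` on `n`-forms and `κ ^ n d =
d` on `(n - 1)`-forms make a suitable power of `κ` unipotent of order two in bounded degrees. A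
Bézout identity then splits off the generalized eigenspace of `κ` for the eigenvalue `1`
(`exists_harmonic`). On this harmonic part `B = (n + 1) d`, so `B` inherits exactness from `d`, and
the same zigzags apply. On the complement `B = 0`, and cycles are boundaries because `b d + d b = 1
- κ` and `κ - 1` is invertible there.

The Tsygan map intertwines `b` with `i_t` and `B` with `d`. For `b` one compares spreading the
powers of `t` with right multiplication by elements of `A` (`contr_spread`). For `B` one writes the
spread form as a coefficient of `a₀ G · d a₁ G ⋯ d aₙ G`, where `G = ∑ t ^ i z ^ i`. Summing over
powers of `κ` doubles each factor `G` in turn, and `G ^ 2 = (1 + z d/dz) G` produces the factor `q +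
n + 1` (`nat_spread_connes`), which the factorials absorb. The square then commutes already on
coefficients of `u ^ 0`. -/

namespace ExtendedCyclic

universe u v

/-! ### Gradings described by projections -/

section GradedMaps

variable {k : Type*} [CommRing k] {M N : Type*} [AddCommGroup M] [Module k M]
  [AddCommGroup N] [Module k N] {ι : Type*}

/-- Components of a graded module, given by projections. -/
structure IsGrading (S : ι → Submodule k M) (P : ι → M →ₗ[k] M) : Prop where
  self : ∀ i, ∀ x ∈ S i, P i x = x
  other : ∀ i j, j ≠ i → ∀ x ∈ S j, P i x = 0
  top : ⨆ i, S i = ⊤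

variable {S : ι → Submodule k M} {P : ι → M →ₗ[k] M}

theorem IsGrading.proj_mem (h : IsGrading S P) (i : ι) (x : M) : P i x ∈ S i := by
  have hx : x ∈ ⨆ i, S i := h.top ▸ Submodule.mem_top
  induction hx using Submodule.iSup_induction' with
  | mem j x hx =>
    by_cases hj : j = i
    · subst hj; rwa [h.self _ _ hx]
    · rw [h.other _ _ hj _ hx]; exact Submodule.zero_mem _
  | zero => simp
  | add x y _ _ hx hy => rw [map_add]; exact Submodule.add_mem _ hx hy

theorem IsGrading.map {φ : M →ₗ[k] N} (h : IsGrading S P) (hφ : Function.Surjective φ)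
    {Q : ι → N →ₗ[k] N} (hQ : ∀ i x, Q i (φ x) = φ (P i x)) :
    IsGrading (fun i => (S i).map φ) Q where
  self i x hx := by
    obtain ⟨x, hx, rfl⟩ := hx
    rw [hQ, h.self i x hx]
  other i j hj x hx := by
    obtain ⟨x, hx, rfl⟩ := hx
    rw [hQ, h.other i j hj x hx, map_zero]
  top := by rw [← Submodule.map_iSup, h.top, Submodule.map_top, LinearMap.range_eq_top.2 hφ]

/-- The homogeneous elements in the range of a homogeneous map come from homogeneous elements. -/
theorem IsGrading.mem_map_of_mem_range (h : IsGrading S P) {D : M →ₗ[k] M} {e : ι → ι}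
    (he : Function.Injective e) (hD : ∀ i, ∀ x ∈ S i, D x ∈ S (e i)) {i : ι} {x : M}
    (hx : x ∈ S (e i)) (hr : x ∈ LinearMap.range D) : x ∈ (S i).map D := by
  obtain ⟨y, rfl⟩ := hr
  refine ⟨P i y, h.proj_mem i y, ?_⟩
  -- Replacing `D y` by its own projection turns the goal into `D ∘ P i = P (e i) ∘ D` at `y`. This
  -- is linear in `y`, hence checkable on homogeneous elements; injectivity of `e` ensures that the
  -- other components contribute nothing.
  rw [← h.self _ _ hx]
  clear hx
  have hy : y ∈ ⨆ i, S i := h.top ▸ Submodule.mem_top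
  induction hy using Submodule.iSup_induction' with
  | mem j x hx =>
    by_cases hj : j = i
    · subst hj; rw [h.self _ _ hx, h.self _ _ (hD _ _ hx)]
    · rw [h.other _ _ hj _ hx, h.other _ _ (he.ne hj) _ (hD _ _ hx), map_zero]
  | zero => simp
  | add x y _ _ hx hy => simp only [map_add, hx, hy]

end GradedMaps

/-! ### The bigrading on forms and on their quotients -/

section Projections

theorem deg_sum_nonneg {A : Type v} {X : Type} (w : List (Gen A X)) : 0 ≤ (w.map Gen.deg).sum :=
  List.sum_nonneg fun x hx => by
    obtain ⟨g, -, rfl⟩ := List.mem_map.1 hx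
    cases g <;> simp [Gen.deg]

theorem varDeg_sum_nonneg {A : Type v} {X : Type} (w : List (Gen A X)) : 0 ≤ (w.map Gen.varDeg).sum :=
  List.sum_nonneg fun x hx => by
    obtain ⟨g, -, rfl⟩ := List.mem_map.1 hx
    cases g <;> simp [Gen.varDeg]

variable (k : Type u) [CommRing k] (A : Type v) [Ring A] [Algebra k A] (X : Type)

/-- The algebra homomorphism from the forms to their group algebra over `ℤ × ℤ` that marks each form
with its bidegree. -/
noncomputable def markBidegree : Forms k A X →ₐ[k] AddMonoidAlgebra (Forms k A X) (ℤ × ℤ) :=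
  Forms.lift k
    (AlgHom.ofLinearMap
      { toFun := fun a => AddMonoidAlgebra.single 0 (ofA k A X a)
        map_add' := fun a b => by rw [map_add, AddMonoidAlgebra.single_add]
        map_smul' := fun r a => by rw [map_smul, AddMonoidAlgebra.smul_single]; rfl }
      (by simp [AddMonoidAlgebra.one_def])
      (fun a b => by simp [AddMonoidAlgebra.single_mul_single]))
    { toFun := fun a => AddMonoidAlgebra.single (1, 0) (dA k A X a)
      map_add' := fun a b => by rw [map_add, AddMonoidAlgebra.single_add]
      map_smul' := fun r a => by rw [map_smul, AddMonoidAlgebra.smul_single]; rfl }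
    (fun a b => by
      simp [dA_mul, AddMonoidAlgebra.single_mul_single, AddMonoidAlgebra.single_add])
    (fun x => AddMonoidAlgebra.single (0, 1) (var k A x))

variable {A X} in
theorem markBidegree_word (w : List (Gen A X)) : markBidegree k A X (word k w) =
    AddMonoidAlgebra.single ((w.map Gen.deg).sum, (w.map Gen.varDeg).sum) (word k w) := by
  induction w with
  | nil => simp [word, AddMonoidAlgebra.one_def]; rfl
  | cons g w ih =>
    rw [word_cons, map_mul, ih]
    cases g <;>
      simp [markBidegree, gen_of, gen_d, gen_var, AddMonoidAlgebra.single_mul_single, Gen.deg,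
        Gen.varDeg]

/-- The projection of the forms to the component of bidegree `i`. -/
noncomputable def formsProj (i : ℤ × ℤ) : Forms k A X →ₗ[k] Forms k A X where
  toFun x := (markBidegree k A X x).coeff i
  map_add' := by simp
  map_smul' := by simp

variable {A X} in
theorem formsProj_word (i : ℤ × ℤ) (w : List (Gen A X)) : formsProj k A X i (word k w) =
    if i = ((w.map Gen.deg).sum, (w.map Gen.varDeg).sum) then word k w else 0 := by
  classical
  change (markBidegree k A X _).coeff i = _
  rw [markBidegree_word, AddMonoidAlgebra.coeff_single, Finsupp.single_apply]
  simp only [eq_comm]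

theorem isGrading_forms :
    IsGrading (fun i : ℤ × ℤ => forms k A X i.1 i.2) (formsProj k A X) where
  self i x hx := by
    induction hx using Submodule.span_induction with
    | mem x hx =>
      obtain ⟨w, h1, h2, rfl⟩ := hx
      rw [formsProj_word, h1, h2, if_pos rfl]
    | zero => simp
    | add x y _ _ hx hy => rw [map_add, hx, hy]
    | smul r x _ hx => rw [map_smul, hx]
  other i j hj x hx := by
    induction hx using Submodule.span_induction with
    | mem x hx =>
      obtain ⟨w, h1, h2, rfl⟩ := hx
      rw [formsProj_word, h1, h2, if_neg (Ne.symm hj)]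
    | zero => simp
    | add x y _ _ hx hy => rw [map_add, hx, hy, add_zero]
    | smul r x _ hx => rw [map_smul, hx, smul_zero]
  top := by
    rw [eq_top_iff, ← span_word, Submodule.span_le]
    rintro _ ⟨w, rfl⟩
    exact Submodule.mem_iSup_of_mem (_, _) (word_mem_forms k w)

variable {A X} in
/-- The subspaces spanned by homogeneous elements are stable under the projections. -/
theorem formsProj_mem_of_homogeneous {T : Submodule k (Forms k A X)} {s : Set (Forms k A X)}
    (hT : T = Submodule.span k s) (hs : ∀ x ∈ s, ∃ p q, x ∈ forms k A X p q) (i : ℤ × ℤ)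
    {x : Forms k A X} (hx : x ∈ T) : formsProj k A X i x ∈ T := by
  subst hT
  induction hx using Submodule.span_induction with
  | mem x hx =>
    obtain ⟨p, q, h⟩ := hs x hx
    by_cases hj : (p, q) = i
    · subst hj
      rw [(isGrading_forms k A X).self (p, q) x h]; exact Submodule.subset_span hx
    · rw [(isGrading_forms k A X).other i (p, q) hj x h]; exact Submodule.zero_mem _
  | zero => simp
  | add x y _ _ hx hy => rw [map_add]; exact Submodule.add_mem _ hx hy
  | smul r x _ hx => rw [map_smul]; exact Submodule.smul_mem _ _ hx

/-- Monomials in the variables are words, so `k⟨X⟩` is spanned by homogeneous elements. This is what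
makes it stable under the bidegree projections, and lets them descend to the reduced quotients. -/
theorem consts_eq_span : consts k A X =
    Submodule.span k (Set.range fun w : List X => word k (A := A) (w.map Gen.var)) := by
  have h1 : ∀ w : List X, word k (A := A) (w.map Gen.var) =
      (w.map (var k A)).prod := by
    intro w; simp [word, Function.comp_def, gen_var]
  rw [consts, Algebra.adjoin_eq_span]
  congr 1
  ext x
  simp only [SetLike.mem_coe, Set.mem_range, h1]
  constructor
  · intro hx
    induction hx using Submonoid.closure_induction with
    | mem x hx => obtain ⟨v, rfl⟩ := hx; exact ⟨[v], by simp⟩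
    | one => exact ⟨[], by simp⟩
    | mul x y _ _ hx hy =>
      obtain ⟨w, rfl⟩ := hx
      obtain ⟨w', rfl⟩ := hy
      exact ⟨w ++ w', by simp⟩
  · rintro ⟨w, rfl⟩
    refine Submonoid.list_prod_mem _ fun x hx => ?_
    obtain ⟨v, -, rfl⟩ := List.mem_map.1 hx
    exact Submonoid.subset_closure ⟨v, rfl⟩

variable {A X} in
theorem formsProj_consts (i : ℤ × ℤ) {x : Forms k A X} (hx : x ∈ consts k A X) :
    formsProj k A X i x ∈ consts k A X :=
  formsProj_mem_of_homogeneous k (consts_eq_span k A X)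
    (by rintro _ ⟨w, rfl⟩; exact ⟨_, _, word_mem_forms k _⟩) i hx

variable {A X} in
theorem formsProj_comm (i : ℤ × ℤ) {x : Forms k A X} (hx : x ∈ comm k A X) :
    formsProj k A X i x ∈ comm k A X := by
  refine formsProj_mem_of_homogeneous k rfl ?_ i hx
  rintro _ ⟨p, q, p', q', x, hx, y, hy, rfl⟩
  refine ⟨p + p', q + q', Submodule.sub_mem _ (forms_mul k hx hy) ?_⟩
  rw [Units.smul_def]
  refine Submodule.smul_of_tower_mem _ _ ?_
  rw [add_comm p, add_comm q]
  exact forms_mul k hy hx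

/-- The projection of the reduced commutator quotient to the component of bidegree `i`. -/
noncomputable def drProj (i : ℤ × ℤ) : DRBar k A X →ₗ[k] DRBar k A X :=
  Submodule.mapQ _ _ (formsProj k A X i) (sup_le
    (fun _ hx => Submodule.mem_sup_left (formsProj_consts k i hx))
    (fun _ hx => Submodule.mem_sup_right (formsProj_comm k i hx)))

theorem isGrading_drForms :
    IsGrading (fun i : ℤ × ℤ => drForms k A X i.1 i.2) (drProj k A X) :=
  (isGrading_forms k A X).map (Submodule.mkQ_surjective _) (fun _ _ => rfl)

/-- The projection of the reduced forms to the component of bidegree `i`. -/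
noncomputable def omegaBarProj (i : ℤ × ℤ) : OmegaBar k A X →ₗ[k] OmegaBar k A X :=
  Submodule.mapQ _ _ (formsProj k A X i) (fun _ hx => formsProj_consts k i hx)

theorem isGrading_omegaBar :
    IsGrading (fun i : ℤ × ℤ => (forms k A X i.1 i.2).map (consts k A X).mkQ)
      (omegaBarProj k A X) :=
  (isGrading_forms k A X).map (Submodule.mkQ_surjective _) (fun _ _ => rfl)

variable {A X}

theorem forms_eq_bot {p q : ℤ} (h : p < 0 ∨ q < 0) : forms k A X p q = ⊥ := by
  rw [forms, Submodule.span_eq_bot]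
  rintro _ ⟨w, h1, h2, rfl⟩
  have := deg_sum_nonneg w
  have := varDeg_sum_nonneg w
  omega

theorem forms_empty_eq_bot {p q : ℤ} (h : q ≠ 0) : forms k A Empty p q = ⊥ := by
  rw [forms, Submodule.span_eq_bot]
  rintro _ ⟨w, h1, h2, rfl⟩
  refine absurd ?_ h
  rw [← h2]
  refine List.sum_eq_zero fun x hx => ?_
  obtain ⟨g, -, rfl⟩ := List.mem_map.1 hx
  cases g with
  | var v => exact v.elim
  | _ => simp [Gen.varDeg]

theorem drForms_eq_zero {p q : ℤ} (h : p < 0 ∨ q < 0) {x : DRBar k A X}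
    (hx : x ∈ drForms k A X p q) : x = 0 := by
  rw [drForms, forms_eq_bot k h, Submodule.map_bot] at hx
  exact hx

theorem dOmega_mem {p q : ℤ} {x : Forms k A X} (hx : x ∈ forms k A X p q) :
    dOmega k A X x ∈ forms k A X (p + 1) q := by
  have := oddDer_mem k (dA k A X) 0 (dA_mul k A X) (by intro a b; simp) 1 0 (dA_mem k)
    (fun _ => Submodule.zero_mem _) hx
  rwa [add_zero] at this

theorem contr_mem {p q : ℤ} {x : Forms k A Unit} (hx : x ∈ forms k A Unit p q) :
    contr k A x ∈ forms k A Unit (p - 1) (q + 1) :=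
  oddDer_mem k 0 (adT k A) (by intro a b; simp) (by intro a b; simp [adT_mul]) (-1) 1
    (fun _ => Submodule.zero_mem _) (adT_mem k A) hx

theorem dDR_mem {p q : ℤ} {x : DRBar k A X} (hx : x ∈ drForms k A X p q) :
    dDR k A X x ∈ drForms k A X (p + 1) q := by
  obtain ⟨x, hx, rfl⟩ := hx
  exact ⟨_, dOmega_mem k hx, rfl⟩

theorem contrDR_mem {p q : ℤ} {x : DRBar k A Unit} (hx : x ∈ drForms k A Unit p q) :
    contrDR k A x ∈ drForms k A Unit (p - 1) (q + 1) := by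
  obtain ⟨x, hx, rfl⟩ := hx
  exact ⟨_, contr_mem k hx, rfl⟩

/-- Exactness may be proved with an arbitrary preimage, whose homogeneous component of the right
bidegree then serves as well. -/
theorem drForms_mem_map_of_mem_range {p q : ℤ} {x : DRBar k A X} (hx : x ∈ drForms k A X p q)
    (hr : x ∈ LinearMap.range (dDR k A X)) : x ∈ (drForms k A X (p - 1) q).map (dDR k A X) :=
  (isGrading_drForms k A X).mem_map_of_mem_range (e := fun i => (i.1 + 1, i.2))
    (fun i j h => by simpa [Prod.ext_iff] using h) (fun _ _ hx => dDR_mem k hx)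
    (i := (p - 1, q)) (by simpa using hx) hr

theorem dOmega_ofA (a : A) : dOmega k A X (ofA k A X a) = dA k A X a := oddDer_ofA k _ _ _ _ a

theorem dOmega_dA (a : A) : dOmega k A X (dA k A X a) = 0 := oddDer_dA k _ _ _ _ a

theorem dOmega_var (x : X) : dOmega k A X (var k A x) = 0 := oddDer_var k _ _ _ _ x

theorem dOmega_one : dOmega k A X 1 = 0 := oddDer_one k _ _ _ _

theorem dOmega_mul (x y : Forms k A X) : dOmega k A X (x * y) =
    dOmega k A X x * y + parity k A X x * dOmega k A X y := oddDer_mul k _ _ _ _ x y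

theorem dOmega_consts {x : Forms k A X} (hx : x ∈ consts k A X) : dOmega k A X x = 0 :=
  oddDer_consts k _ _ _ _ hx

theorem dOmega_comp_dOmega (x : Forms k A X) : dOmega k A X (dOmega k A X x) = 0 := by
  induction x using Forms.induction with
  | h0 => simp
  | h1 => simp [dOmega_one]
  | hadd x y hx hy => simp [hx, hy]
  | hsmul r x hx => simp [hx]
  | hof a x hx => simp [dOmega_mul, dOmega_ofA, dOmega_dA, hx]
  | hd a x hx => simp [dOmega_mul, dOmega_dA, hx]
  | hvar v x hx => simp [dOmega_mul, dOmega_var, hx]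

theorem dDR_dDR (x : DRBar k A X) : dDR k A X (dDR k A X x) = 0 := by
  obtain ⟨x, rfl⟩ : ∃ y, nat k A X y = x := Submodule.mkQ_surjective _ x
  rw [dDR_nat, dDR_nat, dOmega_comp_dOmega, map_zero]

end Projections

end ExtendedCyclic

namespace ExtendedCyclic

universe u v

open scoped TensorProduct

/-! ### Acyclicity of the reduced forms under `d` -/

section Homotopy

variable {k : Type u} [CommRing k] {A : Type v} [Ring A] [Algebra k A] (X : Type)
  (s : A →ₗ[k] k)

/-- The value `(d c · τ, (c - s c) τ)` of a contracting homotopy next to the form `d c · τ`. -/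
def homotopyStep : A →ₗ[k] (Forms k A X × Forms k A X) →ₗ[k] (Forms k A X × Forms k A X) :=
  LinearMap.mk₂ k (fun c w => (dA k A X c * w.1, ofA k A X c * w.1 - s c • w.1))
    (by intros; ext <;> simp [add_mul, add_smul] <;> abel)
    (by intros; ext <;> simp [smul_sub, mul_smul])
    (by intros; ext <;> simp [mul_add] <;> abel)
    (by
      intro r c w
      ext
      · simp
      · simp only [Prod.smul_fst, Prod.smul_snd, mul_smul_comm, smul_sub, smul_comm r (s c)])

/-- Left multiplication by `a` on `A ⊗ W`. -/
def homotopyOf : A →ₐ[k] Module.End k (A ⊗[k] (Forms k A X × Forms k A X)) :=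
  AlgHom.ofLinearMap
    { toFun := fun a => (LinearMap.mulLeft k a).rTensor _
      map_add' := fun a b => by ext <;> simp [add_mul, TensorProduct.add_tmul]
      map_smul' := fun r a => by ext <;> simp [TensorProduct.smul_tmul'] }
    (by ext <;> simp)
    (fun a b => by ext <;> simp)

theorem homotopyOf_tmul (a c : A) (w : Forms k A X × Forms k A X) :
    homotopyOf X a (c ⊗ₜ[k] w) = (a * c) ⊗ₜ w := rfl

/-- The action of `d a` on `A ⊗ W`. -/
def homotopyD : A →ₗ[k] Module.End k (A ⊗[k] (Forms k A X × Forms k A X)) where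
  toFun a := TensorProduct.lift (LinearMap.mk₂ k
    -- The form `d a · c τ` is expanded as `d (a c) · τ - a · d c · τ`, so that each summand is
    -- again an element of `A` times a product beginning with a differential.
    (fun c w => (1 : A) ⊗ₜ[k] homotopyStep X s (a * c) w - a ⊗ₜ homotopyStep X s c w)
    (by
      intros
      simp only [mul_add, map_add, LinearMap.add_apply, TensorProduct.tmul_add]; abel)
    (by
      intros
      simp only [mul_smul_comm, map_smul, LinearMap.smul_apply, TensorProduct.tmul_smul, smul_sub])
    (by intros; simp only [map_add, TensorProduct.tmul_add]; abel)
    (by intros; simp only [map_smul, TensorProduct.tmul_smul, smul_sub]))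
  map_add' a b := TensorProduct.ext' fun c w => by
    simp only [TensorProduct.lift.tmul, LinearMap.mk₂_apply, LinearMap.add_apply, add_mul, map_add,
      TensorProduct.tmul_add, TensorProduct.add_tmul]
    abel
  map_smul' r a := TensorProduct.ext' fun c w => by
    simp only [TensorProduct.lift.tmul, LinearMap.mk₂_apply, LinearMap.smul_apply, smul_mul_assoc,
      map_smul, TensorProduct.tmul_smul, smul_sub, RingHom.id_apply, TensorProduct.smul_tmul']

theorem homotopyD_tmul (a c : A) (w : Forms k A X × Forms k A X) :
    homotopyD X s a (c ⊗ₜ[k] w) =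
      1 ⊗ₜ homotopyStep X s (a * c) w - a ⊗ₜ homotopyStep X s c w := rfl

variable {X} in
/-- The action of a variable on `A ⊗ W`. -/
def homotopyVar (x : X) : Module.End k (A ⊗[k] (Forms k A X × Forms k A X)) :=
  TensorProduct.lift (LinearMap.mk₂ k
    -- The homotopy is meant to commute with left multiplication by variables: `h (x c τ) = x h (c
    -- τ) = s c • x h τ`.
    (fun c w => (1 : A) ⊗ₜ[k] (var k A x * (ofA k A X c * w.1), s c • (var k A x * w.2)))
    (by
      intros
      rw [← TensorProduct.tmul_add]
      congr 1
      ext <;> simp [add_mul, mul_add, add_smul])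
    (by
      intros
      rw [← TensorProduct.tmul_smul]
      congr 1
      ext <;> simp [mul_smul])
    (by
      intros
      rw [← TensorProduct.tmul_add]
      congr 1
      ext <;> simp [mul_add])
    (by
      intros
      rw [← TensorProduct.tmul_smul]
      congr 1
      ext
      · simp
      · simp only [Prod.smul_snd, mul_smul_comm, smul_comm (s _)]))

theorem homotopyVar_tmul (x : X) (c : A) (w : Forms k A X × Forms k A X) :
    homotopyVar s x (c ⊗ₜ[k] w) =
      1 ⊗ₜ (var k A x * (ofA k A X c * w.1), s c • (var k A x * w.2)) := rfl

/-- The action of the forms on `A ⊗ W`, where `c ⊗ (τ, η)` stands for the form `c τ` with the value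
`s c • η` of the homotopy, for `τ` a product starting with a differential or a variable. -/
def homotopyAction : Forms k A X →ₐ[k] Module.End k (A ⊗[k] (Forms k A X × Forms k A X)) :=
  Forms.lift k (homotopyOf X) (homotopyD X s)
    (fun a b => TensorProduct.ext' fun c w => by
      simp only [LinearMap.add_apply, Module.End.mul_apply, homotopyD_tmul, homotopyOf_tmul,
        map_sub, mul_one, mul_assoc]
      abel)
    (homotopyVar s)

theorem homotopyAction_ofA (a c : A) (w : Forms k A X × Forms k A X) :
    homotopyAction X s (ofA k A X a) (c ⊗ₜ[k] w) = (a * c) ⊗ₜ w := by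
  rw [homotopyAction, Forms.lift_ofA, homotopyOf_tmul]

theorem homotopyAction_dA (a c : A) (w : Forms k A X × Forms k A X) :
    homotopyAction X s (dA k A X a) (c ⊗ₜ[k] w) =
      1 ⊗ₜ homotopyStep X s (a * c) w - a ⊗ₜ homotopyStep X s c w := by
  rw [homotopyAction, Forms.lift_dA, homotopyD_tmul]

theorem homotopyAction_var (x : X) (c : A) (w : Forms k A X × Forms k A X) :
    homotopyAction X s (var k A x) (c ⊗ₜ[k] w) =
      1 ⊗ₜ (var k A x * (ofA k A X c * w.1), s c • (var k A x * w.2)) := by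
  rw [homotopyAction, Forms.lift_var, homotopyVar_tmul]

/-- A contracting homotopy of the forms modulo `k⟨X⟩`. -/
def homotopy : Forms k A X →ₗ[k] Forms k A X :=
  TensorProduct.lift (LinearMap.mk₂ k (fun c w => s c • w.2)
    (by intros; simp [add_smul]) (by intros; simp [mul_smul])
    (by intros; simp) (by intros; simp only [Prod.smul_snd, smul_comm (s _)])) ∘ₗ
  -- The base vector `1 ⊗ (1, 0)` represents the form `1`, with homotopy value `0`. Well-definedness
  -- of `h` is thereby reduced to having an action of the algebra of forms.
  (homotopyAction X s).toLinearMap.flip (1 ⊗ₜ (1, 0))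

theorem homotopy_of_action {x : Forms k A X} {c : A} {w : Forms k A X × Forms k A X}
    (h : homotopyAction X s x (1 ⊗ₜ (1, 0)) = c ⊗ₜ w) : homotopy X s x = s c • w.2 := by
  change TensorProduct.lift _ (homotopyAction X s x (1 ⊗ₜ (1, 0))) = _
  rw [h]; rfl

/-- The products starting with a differential or a variable. -/
def headed : Submodule k (Forms k A X) where
  carrier := {x | homotopyAction X s x (1 ⊗ₜ (1, 0)) = 1 ⊗ₜ (x, homotopy X s x)}
  add_mem' := by
    intro x y hx hy
    simp only [Set.mem_ofPred_eq] at hx hy ⊢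
    rw [map_add, LinearMap.add_apply, hx, hy, ← TensorProduct.tmul_add, map_add]; rfl
  zero_mem' := by
    change _ = (1 : A) ⊗ₜ[k] ((0 : Forms k A X), homotopy X s 0)
    rw [map_zero, map_zero]; exact (TensorProduct.tmul_zero _ _).symm
  smul_mem' := by
    intro r x hx
    simp only [Set.mem_ofPred_eq] at hx ⊢
    rw [map_smul, LinearMap.smul_apply, hx, ← TensorProduct.tmul_smul, map_smul]; rfl

variable {X} {s}

theorem mem_headed_of_action (hs : s 1 = 1) {x y : Forms k A X}
    (h : homotopyAction X s x (1 ⊗ₜ (1, 0)) = 1 ⊗ₜ (x, y)) : x ∈ headed X s := by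
  change _ = _
  rw [h, homotopy_of_action X s h, hs, one_smul]

theorem one_mem_headed (hs : s 1 = 1) : (1 : Forms k A X) ∈ headed X s :=
  mem_headed_of_action hs (y := 0) (by simp)

theorem homotopy_one : homotopy X s (1 : Forms k A X) = 0 := by
  rw [homotopy_of_action X s (c := 1) (w := (1, 0)) (by simp)]; simp

theorem homotopy_ofA_mul {y : Forms k A X} (hy : y ∈ headed X s) (a : A) :
    homotopy X s (ofA k A X a * y) = s a • homotopy X s y := by
  rw [homotopy_of_action X s (c := a) (w := (y, homotopy X s y))]
  rw [map_mul, Module.End.mul_apply, show _ = _ from hy, homotopyAction_ofA, mul_one]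

theorem action_dA_mul (hs : s 1 = 1) {y : Forms k A X} (hy : y ∈ headed X s) (a : A) :
    homotopyAction X s (dA k A X a * y) (1 ⊗ₜ (1, 0)) =
      1 ⊗ₜ (dA k A X a * y, ofA k A X a * y - s a • y) := by
  rw [map_mul, Module.End.mul_apply, show _ = _ from hy, homotopyAction_dA, mul_one]
  -- The correction term of the Leibniz rule disappears because `d 1 = 0` and `1 - s 1 = 0`; here
  -- the normalisation of `s` enters.
  have : homotopyStep X s 1 (y, homotopy X s y) = 0 := by
    simp [homotopyStep, dA_one, hs]
  rw [this, TensorProduct.tmul_zero, sub_zero]; rfl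

theorem dA_mul_mem_headed (hs : s 1 = 1) {y : Forms k A X} (hy : y ∈ headed X s) (a : A) :
    dA k A X a * y ∈ headed X s := mem_headed_of_action hs (action_dA_mul hs hy a)

theorem homotopy_dA_mul (hs : s 1 = 1) {y : Forms k A X} (hy : y ∈ headed X s) (a : A) :
    homotopy X s (dA k A X a * y) = ofA k A X a * y - s a • y := by
  rw [homotopy_of_action X s (action_dA_mul hs hy a), hs, one_smul]

/-- No relation involves a variable, so it may precede an arbitrary form rather than only a headed
one. The point is that multiplying `c` back into `τ` in the state of `y` recovers `y`, which is the
final induction. -/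
theorem action_var_mul (x : X) (y : Forms k A X) :
    homotopyAction X s (var k A x * y) (1 ⊗ₜ (1, 0)) =
      1 ⊗ₜ (var k A x * y, var k A x * homotopy X s y) := by
  rw [map_mul, Module.End.mul_apply]
  have key : ∀ z : A ⊗[k] (Forms k A X × Forms k A X), homotopyAction X s (var k A x) z =
      1 ⊗ₜ (var k A x * TensorProduct.lift (LinearMap.mk₂ k (fun c w => ofA k A X c * w.1)
          (by intros; simp [add_mul]) (by intros; simp) (by intros; simp [mul_add])
          (by intros; simp)) z,
        var k A x * TensorProduct.lift (LinearMap.mk₂ k (fun c w => s c • w.2)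
          (by intros; simp [add_smul]) (by intros; simp [mul_smul])
          (by intros; simp) (by intros; simp only [Prod.smul_snd, smul_comm (s _)])) z) := by
    intro z
    induction z using TensorProduct.induction_on with
    | zero =>
      simp only [map_zero, mul_zero]
      exact (TensorProduct.tmul_zero _ _).symm
    | add z z' h h' =>
      rw [map_add, h, h', ← TensorProduct.tmul_add, map_add, map_add, mul_add, mul_add]; rfl
    | tmul c w => rw [homotopyAction_var]; simp
  rw [key]
  congr 3
  induction y using Forms.induction with
  | h0 => simp
  | h1 => simp
  | hadd y z h h' => rw [map_add, LinearMap.add_apply, map_add, h, h']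
  | hsmul r y h => rw [map_smul, LinearMap.smul_apply, map_smul, h]
  | hof a y h =>
    rw [map_mul, Module.End.mul_apply]
    conv_rhs => rw [← h]
    generalize homotopyAction X s y (1 ⊗ₜ (1, 0)) = z
    induction z using TensorProduct.induction_on with
    | zero => simp
    | add z z' h h' => simp only [map_add, h, h', mul_add]
    | tmul c w => rw [homotopyAction_ofA]; simp [mul_assoc]
  | hd a y h =>
    rw [map_mul, Module.End.mul_apply]
    conv_rhs => rw [← h]
    generalize homotopyAction X s y (1 ⊗ₜ (1, 0)) = z
    induction z using TensorProduct.induction_on with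
    | zero => simp
    | add z z' h h' => simp only [map_add, h, h', mul_add]
    | tmul c w =>
      rw [homotopyAction_dA]
      simp [homotopyStep, dA_mul, add_mul, mul_assoc]
  | hvar v y h =>
    rw [map_mul, Module.End.mul_apply]
    conv_rhs => rw [← h]
    generalize homotopyAction X s y (1 ⊗ₜ (1, 0)) = z
    induction z using TensorProduct.induction_on with
    | zero => simp
    | add z z' h h' => simp only [map_add, h, h', mul_add]
    | tmul c w => rw [homotopyAction_var]; simp

theorem var_mul_mem_headed (hs : s 1 = 1) (x : X) (y : Forms k A X) : var k A x * y ∈ headed X s :=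
  mem_headed_of_action hs (action_var_mul x y)

theorem homotopy_var_mul (hs : s 1 = 1) (x : X) (y : Forms k A X) :
    homotopy X s (var k A x * y) = var k A x * homotopy X s y := by
  rw [homotopy_of_action X s (action_var_mul x y), hs, one_smul]

/-- Left linearity over `k⟨X⟩`, together with `h 1 = 0`, shows that `h` vanishes on `k⟨X⟩`. This
allows forms that are closed only modulo `k⟨X⟩`. -/
theorem homotopy_consts_mul (hs : s 1 = 1) {x : Forms k A X} (hx : x ∈ consts k A X) (y : Forms k A X) :
    homotopy X s (x * y) = x * homotopy X s y := by
  change x ∈ Algebra.adjoin k _ at hx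
  induction hx using Algebra.adjoin_induction generalizing y with
  | mem x hx => obtain ⟨v, rfl⟩ := hx; exact homotopy_var_mul hs v y
  | algebraMap r => rw [← Algebra.smul_def, map_smul, Algebra.smul_def]
  | add x y _ _ hx hy => rw [add_mul, map_add, hx, hy, add_mul]
  | mul x y _ _ hx hy => rw [mul_assoc, hx, hy, mul_assoc]

/-- The forms are spanned by the products `a τ` where `τ` starts with a differential or a variable,
and on these products the homotopy identity holds modulo `k⟨X⟩`. -/
theorem sub_homotopy_mem_consts (hs : s 1 = 1) (x : Forms k A X) :
    x - dOmega k A X (homotopy X s x) - homotopy X s (dOmega k A X x) ∈ consts k A X := by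
  let R : Forms k A X →ₗ[k] Forms k A X :=
    LinearMap.id - dOmega k A X ∘ₗ homotopy X s - homotopy X s ∘ₗ dOmega k A X
  -- The factors `τ` for which `h` can be evaluated on `a τ` and on both terms of `d (a τ) = d a · τ
  -- + a · d τ`.
  let T : Set (Forms k A X) :=
    {τ | τ ∈ headed X s ∧ dOmega k A X τ ∈ headed X s ∧ R τ ∈ consts k A X}
  -- The contribution `h (d a · τ) = a τ - s a • τ` cancels the term `a τ` of `R (a τ)`, and what
  -- remains is `s a` times `R τ`.
  have hR : ∀ (a : A), ∀ τ ∈ T, R (ofA k A X a * τ) = s a • R τ := by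
    rintro a τ ⟨h1, h2, -⟩
    simp only [R, LinearMap.sub_apply, LinearMap.id_apply, LinearMap.comp_apply]
    rw [homotopy_ofA_mul h1, dOmega_mul, dOmega_ofA, parity_ofA, map_add, homotopy_dA_mul hs h1,
      homotopy_ofA_mul h2, map_smul, smul_sub, smul_sub]
    abel
  have hT1 : (1 : Forms k A X) ∈ T := by
    refine ⟨one_mem_headed hs, by rw [dOmega_one]; exact Submodule.zero_mem _, ?_⟩
    simp only [R, LinearMap.sub_apply, LinearMap.id_apply, LinearMap.comp_apply, dOmega_one,
      homotopy_one, map_zero, sub_zero]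
    exact Subalgebra.one_mem _
  have hTd : ∀ (a : A), ∀ τ ∈ T, dA k A X a * τ ∈ T := by
    rintro a τ ⟨h1, h2, -⟩
    have h3 : dOmega k A X (dA k A X a * τ) = -(dA k A X a * dOmega k A X τ) := by
      rw [dOmega_mul, dOmega_dA, parity_dA]; simp
    refine ⟨dA_mul_mem_headed hs h1 a, ?_, ?_⟩
    · rw [h3]; exact Submodule.neg_mem _ (dA_mul_mem_headed hs h2 a)
    · simp only [R, LinearMap.sub_apply, LinearMap.id_apply, LinearMap.comp_apply]
      rw [h3, map_neg, homotopy_dA_mul hs h1, homotopy_dA_mul hs h2, map_sub, map_smul,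
        dOmega_mul, dOmega_ofA, parity_ofA]
      -- In front of a differential the homotopy identity is exact, so the remainder is zero and not
      -- merely constant.
      convert Submodule.zero_mem (consts k A X) using 1
      abel
  have hTv : ∀ (v : X) (a : A), ∀ τ ∈ T, var k A v * (ofA k A X a * τ) ∈ T := by
    intro v a τ hτ
    have h4 : dOmega k A X (var k A v * (ofA k A X a * τ)) =
        var k A v * dOmega k A X (ofA k A X a * τ) := by
      rw [dOmega_mul, dOmega_var, parity_var]; simp
    refine ⟨var_mul_mem_headed hs _ _, ?_, ?_⟩
    · rw [h4]; exact var_mul_mem_headed hs _ _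
    · have h5 : R (var k A v * (ofA k A X a * τ)) = var k A v * R (ofA k A X a * τ) := by
        simp only [R, LinearMap.sub_apply, LinearMap.id_apply, LinearMap.comp_apply]
        rw [h4, homotopy_var_mul hs, homotopy_var_mul hs, dOmega_mul, dOmega_var, parity_var]
        simp [mul_sub]
      rw [h5, hR a τ hτ]
      exact Subalgebra.mul_mem _ (Algebra.subset_adjoin ⟨v, rfl⟩)
        (Submodule.smul_mem (consts k A X) _ hτ.2.2)
  have hspan : x ∈ Submodule.span k {y | ∃ a, ∃ τ ∈ T, y = ofA k A X a * τ} := by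
    have hx : x ∈ Submodule.span k (Set.range (word k (A := A) (X := X))) := by
      rw [span_word]; trivial
    refine Submodule.span_le.2 ?_ hx
    rintro _ ⟨w, rfl⟩
    induction w with
    | nil => exact Submodule.subset_span ⟨1, 1, hT1, by simp [word]⟩
    | cons g w ih =>
      rw [word_cons]
      simp only [SetLike.mem_coe] at ih ⊢
      generalize word k w = y at ih
      induction ih using Submodule.span_induction with
      | zero => simp
      | add x y _ _ hx hy => rw [mul_add]; exact Submodule.add_mem _ hx hy
      | smul r x _ hx => rw [mul_smul_comm]; exact Submodule.smul_mem _ _ hx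
      | mem y hy =>
        obtain ⟨a, τ, hτ, rfl⟩ := hy
        cases g with
        | of e => exact Submodule.subset_span ⟨e * a, τ, hτ, by
            rw [gen_of, map_mul, mul_assoc]⟩
        | d e =>
          have : gen k (Gen.d e) * (ofA k A X a * τ) =
              ofA k A X 1 * (dA k A X (e * a) * τ) - ofA k A X e * (dA k A X a * τ) := by
            rw [gen_d, dA_mul, map_one]; noncomm_ring
          rw [this]
          exact Submodule.sub_mem _ (Submodule.subset_span ⟨_, _, hTd _ _ hτ, rfl⟩)
            (Submodule.subset_span ⟨_, _, hTd _ _ hτ, rfl⟩)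
        | var v => exact Submodule.subset_span ⟨1, _, hTv v a τ hτ, by rw [gen_var, map_one, one_mul]⟩
  change R x ∈ _
  induction hspan using Submodule.span_induction with
  | zero => simp
  | add x y _ _ hx hy => rw [map_add]; exact Submodule.add_mem _ hx hy
  | smul r x _ hx => rw [map_smul]; exact Submodule.smul_mem _ _ hx
  | mem x hx =>
    obtain ⟨a, τ, hτ, rfl⟩ := hx
    rw [hR a τ hτ]; exact Submodule.smul_mem _ _ hτ.2.2

/-- The reduced forms are acyclic for the de Rham differential. -/
theorem exists_dOmega_sub_mem_consts (hs : s 1 = 1) {x : Forms k A X} (hx : dOmega k A X x ∈ consts k A X) :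
    ∃ y, x - dOmega k A X y ∈ consts k A X := by
  refine ⟨homotopy X s x, ?_⟩
  -- As `d x` is constant, `h (d x) = d x · h 1 = 0`, so the homotopy identity leaves `x - d (h x)`
  -- constant.
  have h := homotopy_consts_mul hs hx 1
  rw [mul_one, homotopy_one, mul_zero] at h
  simpa [h] using sub_homotopy_mem_consts hs x

end Homotopy

end ExtendedCyclic

namespace ExtendedCyclic

universe u v

/-! ### The cyclic derivative in `t` and exactness in positive `t`-degree -/

section CyclicDerivative

variable (k : Type u) [CommRing k] (A : Type v) [Ring A] [Algebra k A]

/-- Multiplication by an element of `A` on pairs of a form and its derivative. -/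
def cycDerOf : A →ₐ[k] Module.End k (Forms k A Unit × Module.End k (Forms k A Unit)) :=
  AlgHom.ofLinearMap
    { toFun := fun a => LinearMap.prodMap (LinearMap.mulLeft k (ofA k A Unit a))
        (LinearMap.lcomp k _ (LinearMap.mulRight k (ofA k A Unit a)))
      map_add' := fun a b => LinearMap.ext fun F => by
        ext <;> simp [add_mul, mul_add]
      map_smul' := fun r a => LinearMap.ext fun F => by
        ext <;> simp }
    (LinearMap.ext fun F => by ext <;> simp)
    (fun a b => LinearMap.ext fun F => by ext <;> simp [mul_assoc])

theorem cycDerOf_apply (a : A) (F : Forms k A Unit × Module.End k (Forms k A Unit)) :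
    cycDerOf k A a F = (ofA k A Unit a * F.1, F.2 ∘ₗ LinearMap.mulRight k (ofA k A Unit a)) := rfl

/-- Multiplication by a differential on pairs of a form and its derivative. -/
def cycDerD : A →ₗ[k] Module.End k (Forms k A Unit × Module.End k (Forms k A Unit)) where
  toFun a := LinearMap.prodMap (LinearMap.mulLeft k (dA k A Unit a))
    -- For `x = d a · y` the value at `z` is computed from that of `y` at `z · d a`, of degree `|y|
    -- + |z| + 1`. The operator `-parity` is thus the Koszul sign for carrying `d a` past `y z`.
    (-(LinearMap.llcomp k _ _ _ (parity k A Unit).toLinearMap ∘ₗ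
      LinearMap.lcomp k _ (LinearMap.mulRight k (dA k A Unit a))))
  map_add' := fun a b => LinearMap.ext fun F => by
    ext
    · simp [add_mul]
    · simp [mul_add, add_comm]
  map_smul' := fun r a => LinearMap.ext fun F => by
    ext <;> simp

theorem cycDerD_apply (a : A) (F : Forms k A Unit × Module.End k (Forms k A Unit)) :
    cycDerD k A a F = (dA k A Unit a * F.1,
      -((parity k A Unit).toLinearMap ∘ₗ F.2 ∘ₗ LinearMap.mulRight k (dA k A Unit a))) := rfl

/-- Multiplication by `t` on pairs of a form and its derivative. -/
def cycDerT : Module.End k (Forms k A Unit × Module.End k (Forms k A Unit)) :=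
  LinearMap.prodMap (LinearMap.mulLeft k (t k A)) (LinearMap.lcomp k _ (LinearMap.mulRight k (t k A)))
    -- The leading `t` of `t y` is a new occurrence and contributes `z ↦ y z`. This is why the form
    -- is carried along with its derivative.
    + LinearMap.inr k _ _ ∘ₗ LinearMap.mul k (Forms k A Unit) ∘ₗ LinearMap.fst k _ _

theorem cycDerT_apply (F : Forms k A Unit × Module.End k (Forms k A Unit)) :
    cycDerT k A F = (t k A * F.1,
      F.2 ∘ₗ LinearMap.mulRight k (t k A) + LinearMap.mulLeft k F.1) := by
  ext <;> simp [cycDerT]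

/-- The action of forms on pairs of a form and its derivative. -/
def cycDerAction : Forms k A Unit →ₐ[k]
    Module.End k (Forms k A Unit × Module.End k (Forms k A Unit)) :=
  Forms.lift k (cycDerOf k A) (cycDerD k A)
    (fun a b => LinearMap.ext fun F => by
      ext
      · simp [cycDerOf_apply, cycDerD_apply, dA_mul, add_mul, mul_assoc]
      · simp [cycDerOf_apply, cycDerD_apply, dA_mul, mul_add, mul_assoc, add_comm])
    (fun _ => cycDerT k A)

/-- The cyclic derivative with respect to `t`: `x` is sent to the map taking `z` to the sum, over the
occurrences `x = x' t x''` of `t`, of the forms `± x'' z x'`. -/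
def cycDer : Forms k A Unit →ₗ[k] Module.End k (Forms k A Unit) :=
  LinearMap.snd k _ _ ∘ₗ (cycDerAction k A).toLinearMap.flip (1, 0)

variable {A}

theorem cycDerAction_fst (x : Forms k A Unit) : (cycDerAction k A x (1, 0)).1 = x := by
  induction x using Forms.induction with
  | h0 => simp
  | h1 => simp
  | hadd x y hx hy => simp [hx, hy]
  | hsmul r x hx => simp [hx]
  | hof a x hx => simp [cycDerAction, cycDerOf_apply] at hx ⊢; rw [hx]
  | hd a x hx => simp [cycDerAction, cycDerD_apply] at hx ⊢; rw [hx]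
  | hvar v x hx => simp [cycDerAction, cycDerT_apply] at hx ⊢; rw [hx]; rfl

theorem cycDer_one : cycDer k A 1 = 0 := by simp [cycDer]

theorem cycDer_ofA_mul (a : A) (y z : Forms k A Unit) :
    cycDer k A (ofA k A Unit a * y) z = cycDer k A y (z * ofA k A Unit a) := by
  simp [cycDer, cycDerAction, cycDerOf_apply]

theorem cycDer_dA_mul (a : A) (y z : Forms k A Unit) :
    cycDer k A (dA k A Unit a * y) z =
      -parity k A Unit (cycDer k A y (z * dA k A Unit a)) := by
  simp [cycDer, cycDerAction, cycDerD_apply]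

theorem cycDer_t_mul (y z : Forms k A Unit) :
    cycDer k A (t k A * y) z = y * z + cycDer k A y (z * t k A) := by
  have h := cycDerAction_fst k y
  simp only [cycDerAction] at h
  simp [cycDer, cycDerAction, t, cycDerT_apply, h, add_comm]

theorem t_mem : t k A ∈ forms k A Unit 0 1 := var_mem k ()

theorem parity_t : parity k A Unit (t k A) = t k A := parity_var k ()

theorem dOmega_t : dOmega k A Unit (t k A) = 0 := dOmega_var k ()

theorem parity_cycDer (x z : Forms k A Unit) : parity k A Unit (cycDer k A x z) =
    cycDer k A (parity k A Unit x) (parity k A Unit z) := by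
  induction x using Forms.induction generalizing z with
  | h0 => simp
  | h1 => simp [cycDer_one]
  | hadd x y hx hy => simp [hx, hy]
  | hsmul r x hx => simp [hx]
  | hof a x hx => rw [cycDer_ofA_mul, hx]; simp [cycDer_ofA_mul]
  | hd a x hx => rw [cycDer_dA_mul, map_neg, hx]; simp [cycDer_dA_mul]
  | hvar v x hx =>
    change parity k A Unit (cycDer k A (t k A * x) z) =
      cycDer k A (parity k A Unit (t k A * x)) _
    rw [map_mul (parity k A Unit), parity_t, cycDer_t_mul, cycDer_t_mul, map_add, hx]
    simp [parity_t]

/-- Because `d t = 0`, applying `d` to a term `± x'' z x'` differentiates only factors of `x` or of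
`z`, never creating or destroying an occurrence of `t`. At `z = 1` the cyclic derivative therefore
commutes with `d`. -/
theorem dOmega_cycDer (x z : Forms k A Unit) : dOmega k A Unit (cycDer k A x z) =
    cycDer k A (dOmega k A Unit x) z + cycDer k A (parity k A Unit x) (dOmega k A Unit z) := by
  induction x using Forms.induction generalizing z with
  | h0 => simp
  | h1 => simp [cycDer_one, dOmega_one]
  | hadd x y hx hy => simp only [map_add, LinearMap.add_apply, hx, hy]; abel
  | hsmul r x hx => simp only [map_smul, LinearMap.smul_apply, hx, smul_add]
  | hof a x hx =>
    rw [cycDer_ofA_mul, hx]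
    simp only [dOmega_mul, dOmega_ofA, map_mul, parity_ofA, map_add, LinearMap.add_apply,
      cycDer_ofA_mul, cycDer_dA_mul, parity_cycDer, parity_dA, mul_neg, map_neg]
    abel
  | hd a x hx =>
    rw [cycDer_dA_mul, map_neg, ← parity_dOmega, hx]
    simp only [dOmega_mul, dOmega_dA, zero_mul, zero_add, mul_zero, add_zero, parity_dA, neg_mul,
      map_neg, LinearMap.neg_apply, cycDer_dA_mul, map_add, parity_cycDer, parity_parity,
      map_mul (parity k A Unit), neg_neg]
  | hvar v x hx =>
    change dOmega k A Unit (cycDer k A (t k A * x) z) =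
      cycDer k A (dOmega k A Unit (t k A * x)) z + cycDer k A (parity k A Unit (t k A * x)) _
    rw [cycDer_t_mul, map_add, hx]
    simp only [dOmega_mul, dOmega_t, map_mul, parity_t, zero_mul, zero_add, mul_zero, add_zero,
      cycDer_t_mul]
    abel

/-- The Leibniz rule for the cyclic derivative. -/
theorem cycDer_word_mul (w : List (Gen A Unit)) (y z : Forms k A Unit) :
    cycDer k A (word k w * y) z = cycDer k A (word k w) (y * z) +
      (w.map Gen.deg).sum.negOnePow •
        ((parity k A Unit).toLinearMap ^ (w.map Gen.deg).sum.toNat) (cycDer k A y (z * word k w)) := by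
  -- The operator `(-1) ^ |w| parity ^ |w|` is the Koszul sign for moving `w` past `y z`, in a form
  -- that does not require `y` and `z` to be homogeneous.
  induction w generalizing z with
  | nil => simp [word, cycDer_one]
  | cons g w ih =>
    rw [word_cons, mul_assoc]
    have hw := deg_sum_nonneg w
    cases g with
    | of a =>
      simp only [gen_of, cycDer_ofA_mul, ih, mul_assoc, List.map_cons, List.sum_cons, Gen.deg,
        zero_add]
    | d a =>
      simp only [gen_d, cycDer_dA_mul, ih, mul_assoc, List.map_cons, List.sum_cons, Gen.deg]
      rw [add_comm 1, Int.negOnePow_succ, Int.toNat_add hw zero_le_one, Int.toNat_one, pow_succ',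
        Module.End.mul_apply, map_add, neg_add]
      simp [Units.smul_def]
    | var v =>
      change cycDer k A (t k A * (word k w * y)) z = cycDer k A (t k A * word k w) (y * z) +
        (_ • (_ : Module.End k (Forms k A Unit)) (cycDer k A y (z * (t k A * word k w))))
      simp only [cycDer_t_mul, ih, mul_assoc, List.map_cons, List.sum_cons, Gen.deg, zero_add]
      abel

theorem parity_pow_apply {X : Type} {x : Forms k A X} {p : ℤ}
    (hx : parity k A X x = p.negOnePow • x) (n : ℕ) :
    ((parity k A X).toLinearMap ^ n) x = (p * n).negOnePow • x := by
  induction n with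
  | zero => simp
  | succ n ih =>
    rw [pow_succ', Module.End.mul_apply, ih, Units.smul_def, map_zsmul]
    rw [AlgHom.toLinearMap_apply, hx, Units.smul_def, Units.smul_def, smul_smul,
      ← Units.val_mul, ← Int.negOnePow_add]
    push_cast
    rw [mul_add, mul_one]

/-- The cyclic derivative vanishes on graded commutators. -/
theorem cycDer_comm {x : Forms k A Unit} (hx : x ∈ comm k A Unit) : cycDer k A x 1 = 0 := by
  -- The right side is symmetric in `w` and `w'` up to the sign of the graded commutator, so the two
  -- terms of a commutator have equal derivatives at `1`.
  have key : ∀ w w' : List (Gen A Unit), cycDer k A (word k w * word k w') 1 =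
      cycDer k A (word k w) (word k w') +
        ((w.map Gen.deg).sum * (w'.map Gen.deg).sum).negOnePow •
          cycDer k A (word k w') (word k w) := by
    intro w w'
    rw [cycDer_word_mul, mul_one, one_mul]
    have h : parity k A Unit (cycDer k A (word k w') (word k w)) =
        ((w.map Gen.deg).sum + (w'.map Gen.deg).sum).negOnePow •
          cycDer k A (word k w') (word k w) := by
      rw [parity_cycDer, parity_word, parity_word, Int.negOnePow_add]
      simp only [Units.smul_def, map_zsmul, LinearMap.smul_apply, Units.val_mul, smul_smul]
    rw [parity_pow_apply k h, smul_smul, ← Int.negOnePow_add]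
    congr 2
    -- The signs agree because `|w| + (|w| + |w'|) |w|` and `|w| |w'|` differ by the even number
    -- `|w| (|w| + 1)`.
    rw [Int.toNat_of_nonneg (deg_sum_nonneg w), Int.negOnePow_eq_iff]
    convert Int.even_mul_succ_self (w.map Gen.deg).sum using 1
    ring
  induction hx using Submodule.span_induction with
  | zero => simp
  | add x y _ _ hx hy => rw [map_add, LinearMap.add_apply, hx, hy, add_zero]
  | smul r x _ hx => rw [map_smul, LinearMap.smul_apply, hx, smul_zero]
  | mem z hz =>
    obtain ⟨p, q, p', q', x, hx, y, hy, rfl⟩ := hz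
    induction hx using Submodule.span_induction with
    | zero => simp
    | add x x' _ _ h h' =>
      rw [add_mul, mul_add, smul_add, add_sub_add_comm, map_add, LinearMap.add_apply, h, h',
        add_zero]
    | smul r x _ h =>
      rw [smul_mul_assoc, mul_smul_comm, smul_comm _ r, ← smul_sub, map_smul,
        LinearMap.smul_apply, h, smul_zero]
    | mem x hx =>
      obtain ⟨w, rfl, -, rfl⟩ := hx
      induction hy using Submodule.span_induction with
      | zero => simp
      | add x x' _ _ h h' =>
        rw [add_mul, mul_add, smul_add, add_sub_add_comm, map_add, LinearMap.add_apply, h, h',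
          add_zero]
      | smul r x _ h =>
        rw [smul_mul_assoc, mul_smul_comm, smul_comm _ r, ← smul_sub, map_smul,
          LinearMap.smul_apply, h, smul_zero]
      | mem y hy =>
        obtain ⟨w', rfl, -, rfl⟩ := hy
        have h1 : (((w.map Gen.deg).sum * (w'.map Gen.deg).sum).negOnePow : ℤ) *
            ((w.map Gen.deg).sum * (w'.map Gen.deg).sum).negOnePow = 1 := by
          rw [← Units.val_mul, ← Int.negOnePow_add, Int.negOnePow_even _ ⟨_, rfl⟩]; rfl
        simp only [Units.smul_def, map_sub, map_zsmul, LinearMap.sub_apply, LinearMap.smul_apply,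
          key, mul_comm (w'.map Gen.deg).sum, smul_add, smul_smul, h1, one_smul]
        abel

/-- The rule for `t y` replaces the argument `z` by `z t`, so the induction has to carry all
arguments in `k[t]` and not just `1`. -/
theorem cycDer_consts_mem {x y z : Forms k A Unit} (hx : x ∈ consts k A Unit)
    (hy : y ∈ consts k A Unit) (hD : ∀ z ∈ consts k A Unit, cycDer k A y z ∈ consts k A Unit)
    (hz : z ∈ consts k A Unit) : cycDer k A (x * y) z ∈ consts k A Unit := by
  change x ∈ Algebra.adjoin k _ at hx
  induction hx using Algebra.adjoin_induction generalizing y z with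
  | mem x hx =>
    obtain ⟨v, rfl⟩ := hx
    change cycDer k A (t k A * y) z ∈ _
    rw [cycDer_t_mul]
    exact Submodule.add_mem _ (Subalgebra.mul_mem _ hy hz)
      (hD _ (Subalgebra.mul_mem _ hz (Algebra.subset_adjoin ⟨v, rfl⟩)))
  | algebraMap r =>
    rw [← Algebra.smul_def, map_smul]; exact Submodule.smul_mem (consts k A Unit) _ (hD z hz)
  | add x x' _ _ h h' =>
    rw [add_mul, map_add]; exact Submodule.add_mem _ (h hy hD hz) (h' hy hD hz)
  | mul x x' hx hx' h h' =>
    rw [mul_assoc]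
    exact h (Subalgebra.mul_mem _ hx' hy) (fun z hz => h' hy hD hz) hz

theorem cycDer_consts {x : Forms k A Unit} (hx : x ∈ consts k A Unit) :
    cycDer k A x 1 ∈ consts k A Unit := by
  have := cycDer_consts_mem k hx (Subalgebra.one_mem _)
    (fun z _ => by rw [cycDer_one]; exact Submodule.zero_mem _) (Subalgebra.one_mem _)
  rwa [mul_one] at this

section Cyclicity

variable {k} {X : Type}

theorem nat_mul_comm {p q p' q' : ℤ} {x y : Forms k A X} (hx : x ∈ forms k A X p q)
    (hy : y ∈ forms k A X p' q') :
    nat k A X (x * y) = (p * p').negOnePow • nat k A X (y * x) := by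
  have h : nat k A X (x * y - (p * p').negOnePow • (y * x)) = 0 :=
    (Submodule.Quotient.mk_eq_zero _).2
      (Submodule.mem_sup_right (Submodule.subset_span ⟨p, q, p', q', x, hx, y, hy, rfl⟩))
  rwa [map_sub, Units.smul_def, map_zsmul, sub_eq_zero, ← Units.smul_def] at h

theorem nat_even_mul {q : ℤ} {x : Forms k A X} (hx : x ∈ forms k A X 0 q) (y : Forms k A X) :
    nat k A X (x * y) = nat k A X (y * x) := by
  have hy : y ∈ ⨆ i : ℤ × ℤ, forms k A X i.1 i.2 :=
    (isGrading_forms k A X).top ▸ Submodule.mem_top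
  induction hy using Submodule.iSup_induction' with
  | mem j y hy => rw [nat_mul_comm hx hy]; simp
  | zero => simp
  | add y y' _ _ h h' => simp only [mul_add, add_mul, map_add, h, h']

theorem nat_odd_mul {q : ℤ} {x : Forms k A X} (hx : x ∈ forms k A X 1 q) (y : Forms k A X) :
    nat k A X (x * y) = nat k A X (parity k A X y * x) := by
  have hy : y ∈ ⨆ i : ℤ × ℤ, forms k A X i.1 i.2 :=
    (isGrading_forms k A X).top ▸ Submodule.mem_top
  induction hy using Submodule.iSup_induction' with
  | mem j y hy =>
    rw [nat_mul_comm hx hy, parity_of_mem k hy, one_mul, Units.smul_def, Units.smul_def,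
      smul_mul_assoc, map_zsmul]
  | zero => simp
  | add y y' _ _ h h' => simp only [mul_add, add_mul, map_add, h, h']

end Cyclicity

/-- The Euler identity for the cyclic derivative. -/
theorem nat_cycDer_word (w : List (Gen A Unit)) (z : Forms k A Unit) :
    nat k A Unit (cycDer k A (word k w) z * t k A) =
      (w.map Gen.varDeg).sum • nat k A Unit (word k w * z) := by
  induction w generalizing z with
  | nil => simp [word, cycDer_one]
  | cons g w ih =>
    rw [word_cons]
    cases g with
    | of a =>
      simp only [gen_of, cycDer_ofA_mul, ih, List.map_cons, List.sum_cons, Gen.varDeg, zero_add]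
      rw [mul_assoc, nat_even_mul (ofA_mem k a), mul_assoc]
    | d a =>
      have h : -(parity k A Unit (cycDer k A (word k w) (z * dA k A Unit a))) =
          (w.map Gen.deg).sum.negOnePow •
            cycDer k A (word k w) (parity k A Unit z * dA k A Unit a) := by
        rw [parity_cycDer, parity_word, map_mul, parity_dA]
        simp only [Units.smul_def, map_zsmul, LinearMap.smul_apply, mul_neg, map_neg,
          neg_neg]
      simp only [gen_d, cycDer_dA_mul, h, List.map_cons, List.sum_cons, Gen.varDeg, zero_add]
      rw [mul_assoc, nat_odd_mul (dA_mem k a), map_mul (parity k A Unit), parity_word, Units.smul_def,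
        Units.smul_def, smul_mul_assoc, map_zsmul, ih, smul_mul_assoc, smul_mul_assoc, map_zsmul,
        smul_comm, mul_assoc]
    | var v =>
      change nat k A Unit (cycDer k A (t k A * word k w) z * t k A) =
        _ • nat k A Unit (t k A * word k w * z)
      simp only [cycDer_t_mul, List.map_cons, List.sum_cons, Gen.varDeg, add_mul, map_add, ih,
        add_smul, one_smul]
      -- The new occurrence contributes `w z t`, which is `t w z` up to a commutator.
      rw [mul_assoc (t k A), nat_even_mul (t_mem k), mul_assoc (word k w)]

theorem nat_cycDer {p q : ℤ} {x : Forms k A Unit} (hx : x ∈ forms k A Unit p q) :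
    nat k A Unit (cycDer k A x 1 * t k A) = q • nat k A Unit x := by
  induction hx using Submodule.span_induction with
  | zero => simp
  | add x y _ _ hx hy => simp only [map_add, LinearMap.add_apply, add_mul, hx, hy, smul_add]
  | smul r x _ hx =>
    rw [map_smul, LinearMap.smul_apply, smul_mul_assoc, map_smul, hx, map_smul, smul_comm]
  | mem x hx =>
    obtain ⟨w, -, rfl, rfl⟩ := hx
    rw [nat_cycDer_word, mul_one]

theorem consts_le_ker_nat {X : Type} {x : Forms k A X} (hx : x ∈ consts k A X) :
    nat k A X x = 0 :=
  (Submodule.Quotient.mk_eq_zero _).2 (Submodule.mem_sup_left hx)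

/-- If `d x` is a constant plus commutators, then `d (∂x) = ∂(d x)` is constant, since `∂` kills
commutators and preserves `k[t]`. Acyclicity of the forms gives `∂x = d y` modulo `k[t]`.
Multiplying by `t` and using Euler's identity, `d (y t)♮ = (∂x · t)♮ = q x♮`. -/
theorem exists_zsmul_eq_dDR {s : A →ₗ[k] k} (hs : s 1 = 1) {p q : ℤ} {x : DRBar k A Unit}
    (hx : x ∈ drForms k A Unit p q) (hd : dDR k A Unit x = 0) :
    ∃ y, dDR k A Unit y = q • x := by
  obtain ⟨x, hx, rfl⟩ := hx
  have h : dOmega k A Unit x ∈ consts k A Unit ⊔ comm k A Unit :=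
    (Submodule.Quotient.mk_eq_zero _).1 hd
  obtain ⟨c, hc, e, he, hce⟩ := Submodule.mem_sup.1 h
  have h1 : dOmega k A Unit (cycDer k A x 1) ∈ consts k A Unit := by
    rw [dOmega_cycDer, dOmega_one, map_zero, add_zero, ← hce, map_add, LinearMap.add_apply,
      cycDer_comm k he, add_zero]
    exact cycDer_consts k hc
  obtain ⟨y, hy⟩ := exists_dOmega_sub_mem_consts hs h1
  refine ⟨nat k A Unit (y * t k A), ?_⟩
  change _ = q • nat k A Unit x
  rw [← nat_cycDer k hx, dDR_nat, dOmega_mul, dOmega_t, mul_zero, add_zero, eq_comm, ← sub_eq_zero,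
    ← map_sub, ← sub_mul]
  exact consts_le_ker_nat k (Subalgebra.mul_mem _ hy (Algebra.subset_adjoin ⟨(), rfl⟩))

/-- The reduced commutator quotient of `Ω_t` is acyclic for `d` in positive degrees in `t`. -/
theorem exists_dDR_eq [Algebra ℚ k] {s : A →ₗ[k] k} (hs : s 1 = 1) {p q : ℤ} (hq : 0 < q)
    {x : DRBar k A Unit} (hx : x ∈ drForms k A Unit p q) (hd : dDR k A Unit x = 0) :
    ∃ y ∈ drForms k A Unit (p - 1) q, dDR k A Unit y = x := by
  obtain ⟨y, hy⟩ := exists_zsmul_eq_dDR k hs hx hd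
  refine drForms_mem_map_of_mem_range k hx ⟨algebraMap ℚ k (1 / q) • y, ?_⟩
  rw [map_smul, hy, ← Int.cast_smul_eq_zsmul k, smul_smul]
  have : algebraMap ℚ k (1 / q) * (q : k) = 1 := by
    rw [← map_intCast (algebraMap ℚ k), ← map_mul, one_div,
      inv_mul_cancel₀ (by exact_mod_cast hq.ne'), map_one]
  rw [this, one_smul]

end CyclicDerivative

end ExtendedCyclic

namespace ExtendedCyclic

universe u v

/-! ### The part of `t`-degree zero, identified with the forms on `A` -/

section ZeroDegree

variable (k : Type u) [CommRing k] (A : Type v) [Ring A] [Algebra k A]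

/-- The inclusion `Ω → Ω_t`. -/
def inclT : Forms k A Empty →ₐ[k] Forms k A Unit :=
  Forms.lift k (ofA k A Unit) (dA k A Unit) (dA_mul k A Unit) Empty.elim

variable {A}

@[simp] theorem inclT_ofA (a : A) : inclT k A (ofA k A Empty a) = ofA k A Unit a := by
  simp [inclT]

@[simp] theorem inclT_dA (a : A) : inclT k A (dA k A Empty a) = dA k A Unit a := by
  simp [inclT]

@[simp] theorem modT_ofA (a : A) : modT k A (ofA k A Unit a) = ofA k A Empty a := by
  simp [modT]

@[simp] theorem modT_dA (a : A) : modT k A (dA k A Unit a) = dA k A Empty a := by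
  simp [modT]

@[simp] theorem modT_var (v : Unit) : modT k A (var k A v) = 0 := by
  simp [modT]

theorem inclT_mem {p q : ℤ} {x : Omega k A} (hx : x ∈ forms k A Empty p q) :
    inclT k A x ∈ forms k A Unit p q := by
  induction hx using Submodule.span_induction with
  | zero => simp
  | add x y _ _ hx hy => rw [map_add]; exact Submodule.add_mem _ hx hy
  | smul r x _ hx => rw [map_smul]; exact Submodule.smul_mem _ _ hx
  | mem x hx =>
    obtain ⟨w, rfl, rfl, rfl⟩ := hx
    induction w with
    | nil => simpa [word] using one_mem_forms k
    | cons g w ih =>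
      rw [word_cons, map_mul, List.map_cons, List.sum_cons, List.map_cons, List.sum_cons]
      refine forms_mul k ?_ ih
      cases g with
      | of a => simpa [gen_of, Gen.deg, Gen.varDeg] using ofA_mem k a
      | d a => simpa [gen_d, Gen.deg, Gen.varDeg] using dA_mem k a
      | var x => exact x.elim

theorem modT_inclT (x : Omega k A) : modT k A (inclT k A x) = x := by
  induction x using Forms.induction with
  | h0 => simp
  | h1 => simp
  | hadd x y hx hy => simp [hx, hy]
  | hsmul r x hx => simp [hx]
  | hof a x hx => simp [hx]
  | hd a x hx => simp [hx]
  | hvar v x hx => exact v.elim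

theorem inclT_modT {p : ℤ} {x : Forms k A Unit} (hx : x ∈ forms k A Unit p 0) :
    inclT k A (modT k A x) = x := by
  induction hx using Submodule.span_induction with
  | zero => simp
  | add x y _ _ hx hy => simp [hx, hy]
  | smul r x _ hx => simp [hx]
  | mem x hx =>
    obtain ⟨w, -, h0, rfl⟩ := hx
    induction w with
    | nil => simp [word]
    | cons g w ih =>
      rw [List.map_cons, List.sum_cons] at h0
      have hw := varDeg_sum_nonneg w
      cases g with
      | of a => simp [word_cons, gen_of, ih (by simpa [Gen.varDeg] using h0)]
      | d a => simp [word_cons, gen_d, ih (by simpa [Gen.varDeg] using h0)]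
      | var v => simp only [Gen.varDeg] at h0; omega

variable (A) in
/-- The inclusion of the reduced commutator quotient of `Ω` into that of `Ω_t`. -/
def inclTDR : DRBar k A Empty →ₗ[k] DRBar k A Unit :=
  Submodule.mapQ _ _ (inclT k A).toLinearMap (sup_le
    (fun x hx => Submodule.mem_sup_left (by
      obtain ⟨r, rfl⟩ := mem_consts_empty hx
      rw [AlgHom.toLinearMap_apply, inclT_ofA, AlgHom.commutes]
      exact Subalgebra.algebraMap_mem _ r))
    (fun x hx => Submodule.mem_sup_right (by
      rw [AlgHom.toLinearMap_apply]
      induction hx using Submodule.span_induction with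
      | zero => simp
      | add x y _ _ hx hy => rw [map_add]; exact Submodule.add_mem _ hx hy
      | smul r x _ hx => rw [map_smul]; exact Submodule.smul_mem _ _ hx
      | mem z hz =>
        obtain ⟨p, q, p', q', x, hx, y, hy, rfl⟩ := hz
        exact Submodule.subset_span ⟨p, q, p', q', _, inclT_mem k hx, _, inclT_mem k hy, by
          simp [Units.smul_def]⟩)))

theorem inclT_dOmega (x : Omega k A) :
    inclT k A (dOmega k A Empty x) = dOmega k A Unit (inclT k A x) := by
  induction x using Forms.induction with
  | h0 => simp
  | h1 => simp [dOmega_one]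
  | hadd x y hx hy => simp [hx, hy]
  | hsmul r x hx => simp [hx]
  | hof a x hx => simp [dOmega_mul, dOmega_ofA, hx]
  | hd a x hx => simp [dOmega_mul, dOmega_dA, hx]
  | hvar v x hx => exact v.elim

theorem modT_dOmega (x : Forms k A Unit) :
    modT k A (dOmega k A Unit x) = dOmega k A Empty (modT k A x) := by
  induction x using Forms.induction with
  | h0 => simp
  | h1 => simp [dOmega_one]
  | hadd x y hx hy => simp [hx, hy]
  | hsmul r x hx => simp [hx]
  | hof a x hx => simp [dOmega_mul, dOmega_ofA, hx]
  | hd a x hx => simp [dOmega_mul, dOmega_dA, hx]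
  | hvar v x hx => simp [dOmega_mul, dOmega_var]

theorem inclTDR_mem {p q : ℤ} {x : DRBar k A Empty} (hx : x ∈ drForms k A Empty p q) :
    inclTDR k A x ∈ drForms k A Unit p q := by
  obtain ⟨x, hx, rfl⟩ := hx
  exact ⟨_, inclT_mem k hx, rfl⟩

theorem modTDR_mem {p q : ℤ} {x : DRBar k A Unit} (hx : x ∈ drForms k A Unit p q) :
    modTDR k A x ∈ drForms k A Empty p q := by
  obtain ⟨x, hx, rfl⟩ := hx
  exact ⟨_, modT_mem k A hx, rfl⟩

theorem modTDR_inclTDR (x : DRBar k A Empty) : modTDR k A (inclTDR k A x) = x := by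
  obtain ⟨x, rfl⟩ := Submodule.mkQ_surjective _ x
  exact congrArg (nat k A Empty) (modT_inclT k x)

theorem inclTDR_modTDR {p : ℤ} {x : DRBar k A Unit} (hx : x ∈ drForms k A Unit p 0) :
    inclTDR k A (modTDR k A x) = x := by
  obtain ⟨x, hx, rfl⟩ := hx
  exact congrArg (nat k A Unit) (inclT_modT k hx)

theorem inclTDR_dDR (x : DRBar k A Empty) :
    inclTDR k A (dDR k A Empty x) = dDR k A Unit (inclTDR k A x) := by
  obtain ⟨x, rfl⟩ := Submodule.mkQ_surjective _ x
  exact congrArg (nat k A Unit) (inclT_dOmega k x)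

theorem modTDR_dDR (x : DRBar k A Unit) :
    modTDR k A (dDR k A Unit x) = dDR k A Empty (modTDR k A x) := by
  obtain ⟨x, rfl⟩ := Submodule.mkQ_surjective _ x
  exact congrArg (nat k A Empty) (modT_dOmega k x)

theorem contr_contr (x : Forms k A Unit) : contr k A (contr k A x) = 0 := by
  have hc : ∀ x y, contr k A (x * y) =
      contr k A x * y + parity k A Unit x * contr k A y := oddDer_mul k _ _ _ _
  have hc1 : ∀ a, contr k A (ofA k A Unit a) = 0 := oddDer_ofA k _ _ _ _
  have hc2 : ∀ a, contr k A (dA k A Unit a) = adT k A a := oddDer_dA k _ _ _ _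
  have hc3 : ∀ v, contr k A (var k A v) = 0 := oddDer_var k _ _ _ _
  have hc4 : contr k A (t k A) = 0 := hc3 ()
  have hp : ∀ a, parity k A Unit (adT k A a) = adT k A a := by
    intro a; simp [adT_apply, parity_t]
  have hc5 : ∀ a, contr k A (adT k A a) = 0 := by
    intro a; simp [adT_apply, hc, hc1, hc4]
  induction x using Forms.induction with
  | h0 => simp
  | h1 => simp [contr, oddDer_one]
  | hadd x y hx hy => simp [hx, hy]
  | hsmul r x hx => simp [hx]
  | hof a x hx => simp [hc, hc1, hx]
  | hd a x hx => simp [hc, hc2, hc5, hp, hx]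
  | hvar v x hx => simp [hc, hc3, hx]

theorem contrDR_contrDR (x : DRBar k A Unit) : contrDR k A (contrDR k A x) = 0 := by
  obtain ⟨x, rfl⟩ : ∃ y, nat k A Unit y = x := Submodule.mkQ_surjective _ x
  rw [contrDR_nat, contrDR_nat, contr_contr, map_zero]

end ZeroDegree

end ExtendedCyclic

namespace ExtendedCyclic

universe u v

/-! ### Maps on homology induced by linear maps -/

section Homology

variable {k : Type*} [CommRing k] {M N : Type*} [AddCommGroup M] [Module k M]
  [AddCommGroup N] [Module k N] {D₁ : M →ₗ[k] M} {C₁ C₁' : Submodule k M}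
  {D₂ : N →ₗ[k] N} {C₂ C₂' : Submodule k N}

theorem HomologyAt.cls_eq_iff {z z' : M} (hz : z ∈ C₁ ⊓ LinearMap.ker D₁)
    (hz' : z' ∈ C₁ ⊓ LinearMap.ker D₁) :
    HomologyAt.cls D₁ C₁ C₁' z hz = HomologyAt.cls D₁ C₁ C₁' z' hz' ↔ z - z' ∈ C₁'.map D₁ :=
  Submodule.Quotient.eq _

theorem HomologyAt.exists_cls (c : HomologyAt D₁ C₁ C₁') :
    ∃ z hz, HomologyAt.cls D₁ C₁ C₁' z hz = c := by
  obtain ⟨⟨z, hz⟩, rfl⟩ := Submodule.mkQ_surjective _ c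
  exact ⟨z, hz, rfl⟩

/-- The map on homology induced by a linear map. -/
def HomologyAt.map (φ : M →ₗ[k] N)
    (hz : ∀ x ∈ C₁ ⊓ LinearMap.ker D₁, φ x ∈ C₂ ⊓ LinearMap.ker D₂)
    (hb : ∀ x ∈ C₁', φ (D₁ x) ∈ C₂'.map D₂) :
    HomologyAt D₁ C₁ C₁' →ₗ[k] HomologyAt D₂ C₂ C₂' :=
  Submodule.mapQ _ _ (φ.restrict hz) (by
    rintro ⟨x, hx⟩ ⟨y, hy, hxy⟩
    change φ x ∈ C₂'.map D₂
    rw [show x = D₁ y from hxy.symm]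
    exact hb y hy)

theorem HomologyAt.map_cls (φ : M →ₗ[k] N)
    (hz : ∀ x ∈ C₁ ⊓ LinearMap.ker D₁, φ x ∈ C₂ ⊓ LinearMap.ker D₂)
    (hb : ∀ x ∈ C₁', φ (D₁ x) ∈ C₂'.map D₂) (x : M) (hx : x ∈ C₁ ⊓ LinearMap.ker D₁) :
    HomologyAt.map φ hz hb (HomologyAt.cls D₁ C₁ C₁' x hx) =
      HomologyAt.cls D₂ C₂ C₂' (φ x) (hz x hx) := rfl

/-- A linear map inducing an isomorphism on homology. -/
theorem HomologyAt.exists_equiv (φ : M →ₗ[k] N)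
    (hz : ∀ x ∈ C₁ ⊓ LinearMap.ker D₁, φ x ∈ C₂ ⊓ LinearMap.ker D₂)
    (hb : ∀ x ∈ C₁', φ (D₁ x) ∈ C₂'.map D₂)
    (hinj : ∀ x ∈ C₁ ⊓ LinearMap.ker D₁, φ x ∈ C₂'.map D₂ → x ∈ C₁'.map D₁)
    (hsurj : ∀ y ∈ C₂ ⊓ LinearMap.ker D₂, ∃ x ∈ C₁ ⊓ LinearMap.ker D₁, φ x - y ∈ C₂'.map D₂) :
    ∃ e : HomologyAt D₁ C₁ C₁' ≃ₗ[k] HomologyAt D₂ C₂ C₂', Induces id φ e.toLinearMap := by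
  refine ⟨LinearEquiv.ofBijective (HomologyAt.map φ hz hb) ⟨?_, ?_⟩, fun x hx => ⟨hz x hx, rfl⟩⟩
  · rw [← LinearMap.ker_eq_bot, LinearMap.ker_eq_bot']
    intro c hc
    obtain ⟨x, hx, rfl⟩ := HomologyAt.exists_cls c
    rw [HomologyAt.map_cls] at hc
    have h0 : HomologyAt.cls D₂ C₂ C₂' 0 (Submodule.zero_mem _) = 0 :=
      Submodule.Quotient.mk_zero _
    have h0' : HomologyAt.cls D₁ C₁ C₁' 0 (Submodule.zero_mem _) = 0 :=
      Submodule.Quotient.mk_zero _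
    rw [← h0, HomologyAt.cls_eq_iff, sub_zero] at hc
    rw [← h0', HomologyAt.cls_eq_iff, sub_zero]
    exact hinj x hx hc
  · intro c
    obtain ⟨y, hy, rfl⟩ := HomologyAt.exists_cls c
    obtain ⟨x, hx, hxy⟩ := hsurj y hy
    refine ⟨HomologyAt.cls D₁ C₁ C₁' x hx, ?_⟩
    rw [HomologyAt.map_cls, HomologyAt.cls_eq_iff]
    exact hxy

end Homology

/-! ### Zigzag arguments for the differential `δ - u d` -/

section Zigzag

variable {k : Type*} [CommRing k] {M : Type*} [AddCommGroup M] [Module k M] {δ d : M →ₗ[k] M}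

theorem totalDiff_single_zero (x : M) :
    totalDiff δ d (Finsupp.single 0 x) = Finsupp.single 0 (δ x) := by
  ext r
  rw [totalDiff_apply]
  cases r <;> simp

theorem totalDiff_single_succ (r : ℕ) (x : M) : totalDiff δ d (Finsupp.single (r + 1) x) =
    Finsupp.single (r + 1) (δ x) - Finsupp.single r (d x) := by
  classical
  ext s
  rw [totalDiff_apply]
  simp only [Finsupp.single_apply, Finsupp.coe_sub, Pi.sub_apply, add_left_inj]
  split_ifs <;> simp

theorem totalDiff_totalDiff (hδ : ∀ x, δ (δ x) = 0) (hd : ∀ x, d (d x) = 0)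
    (h : ∀ x, δ (d x) = -d (δ x)) (f : ℕ →₀ M) : totalDiff δ d (totalDiff δ d f) = 0 := by
  ext r
  simp [totalDiff_apply, hδ, hd, h]

variable {W X Y : ℕ → Submodule k M} {r₀ N : ℕ}

theorem single_mem_coeffsIn {r : ℕ} {x : M} (hx : x ∈ X r) :
    Finsupp.single r x ∈ coeffsIn X := by
  classical
  intro s
  rw [Finsupp.single_apply]
  split_ifs with h
  · exact h ▸ hx
  · exact Submodule.zero_mem _

/-- Extension of a coefficient to a cycle when the rows of the next lower degree are exact. -/
theorem exists_extension (hδ : ∀ x, δ (δ x) = 0) (h : ∀ x, δ (d x) = -d (δ x))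
    (hXY : ∀ r, r₀ ≤ r → ∀ x ∈ X r, δ x ∈ Y r)
    (hY : ∀ r, r₀ ≤ r → ∀ y ∈ Y r, d y = 0 → ∃ x ∈ X (r + 1), d x = y)
    (hN : ∀ r, N ≤ r → ∀ x ∈ X r, x = 0)
    {r : ℕ} (hr : r₀ ≤ r) {x : M} (hx : x ∈ X r) (hdx : d (δ x) = 0) :
    ∃ f ∈ coeffsIn X, (∀ s < r, f s = 0) ∧ f r = x ∧ ∀ s, r ≤ s → δ (f s) = d (f (s + 1)) := by
  classical
  induction hn : N - r generalizing r x with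
  | zero =>
    refine ⟨0, Submodule.zero_mem _, fun _ _ => rfl, ?_, fun _ _ => by simp⟩
    exact (hN r (by omega) x hx).symm
  | succ n ih =>
    -- The next coefficient solves `d x' = δ x`. It meets no new obstruction, as `d δ x' = -δ d x' =
    -- -δ δ x = 0`; the process stops at `N`, beyond which all coefficients vanish.
    obtain ⟨x', hx', hxx⟩ := hY r hr _ (hXY r hr x hx) hdx
    obtain ⟨f, hf, h0, h1, h2⟩ := ih (r := r + 1) (by omega) hx'
      (by rw [← neg_eq_zero, ← h, hxx, hδ]) (by omega)
    refine ⟨Finsupp.single r x + f, Submodule.add_mem _ (single_mem_coeffsIn hx) hf, ?_, ?_, ?_⟩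
    · intro s hs
      simp [h0 s (by omega), hs.ne']
    · simp [h0 r (by omega)]
    · intro s hs
      rcases hs.eq_or_lt with rfl | hs
      · simp [h0 r (by omega), h1, hxx]
      · simp [h2 s hs, hs.ne, (show r ≠ s + 1 by omega)]

/-- Cycles with vanishing initial coefficients are boundaries when the rows are exact. -/
theorem exists_totalDiff_eq (hδ : ∀ x, δ (δ x) = 0) (hd : ∀ x, d (d x) = 0)
    (h : ∀ x, δ (d x) = -d (δ x))
    (hWX : ∀ r, r₀ < r → ∀ x ∈ W (r + 1), δ x ∈ X (r + 1))
    (hX : ∀ r, r₀ < r → ∀ x ∈ X r, d x = 0 → ∃ y ∈ W (r + 1), d y = x)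
    (hN : ∀ r, N ≤ r → ∀ x ∈ X r, x = 0)
    {r : ℕ} (hr : r₀ < r) {f : ℕ →₀ M} (hf : f ∈ coeffsIn X) (hf0 : ∀ s < r, f s = 0)
    (hDf : totalDiff δ d f = 0) : ∃ g ∈ coeffsIn W, totalDiff δ d g = f := by
  classical
  induction hn : N - r generalizing r f with
  | zero =>
    refine ⟨0, Submodule.zero_mem _, ?_⟩
    ext s
    rw [map_zero, Finsupp.zero_apply, eq_comm]
    by_cases hs : s < r
    · exact hf0 s hs
    · exact hN s (by omega) _ (hf s)
  | succ n ih =>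
    obtain ⟨r, rfl⟩ : ∃ r', r = r' + 1 := ⟨r - 1, by omega⟩
    -- The component of the cycle equation just below the lowest coefficient reads `δ (f r) = d (f
    -- (r + 1))`, and its left side vanishes.
    have h1 : d (f (r + 1)) = 0 := by
      have := totalDiff_apply δ d f r
      rw [hDf, hf0 r (by omega)] at this
      simpa using this
    obtain ⟨y, hy, hyf⟩ := hX (r + 1) hr _ (hf (r + 1)) h1
    -- Adding the boundary of `y u ^ (-(r + 2))` removes the lowest coefficient at the cost of `δ y`
    -- one place higher, so the induction applies to a cycle beginning later.
    obtain ⟨g, hg, hgf⟩ := ih (r := r + 2) (by omega)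
      (f := f + totalDiff δ d (Finsupp.single (r + 2) y))
      (by
        rw [totalDiff_single_succ, hyf]
        exact Submodule.add_mem _ hf (Submodule.sub_mem _
          (single_mem_coeffsIn (hWX (r + 1) hr y hy)) (single_mem_coeffsIn (hf (r + 1)))))
      (by
        intro s hs
        rw [totalDiff_single_succ, hyf]
        rcases Nat.lt_succ_iff_lt_or_eq.1 hs with hs | rfl
        · simp [hf0 s hs, (show r + 2 ≠ s by omega),
            (show r + 1 ≠ s by omega)]
        · simp)
      (by rw [map_add, hDf, totalDiff_totalDiff hδ hd h, add_zero])
      (by omega)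
    refine ⟨g - Finsupp.single (r + 2) y, Submodule.sub_mem _ hg (single_mem_coeffsIn hy), ?_⟩
    rw [map_sub, hgf, add_sub_cancel_right]

/-- Variant of `exists_totalDiff_eq` where the first nonvanishing coefficient is known to lie in the
image of the second differential. -/
theorem exists_totalDiff_eq_of_first (hδ : ∀ x, δ (δ x) = 0) (hd : ∀ x, d (d x) = 0)
    (h : ∀ x, δ (d x) = -d (δ x))
    (hWX : ∀ r, r₀ ≤ r → ∀ x ∈ W (r + 1), δ x ∈ X (r + 1))
    (hX : ∀ r, r₀ < r → ∀ x ∈ X r, d x = 0 → ∃ y ∈ W (r + 1), d y = x)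
    (hN : ∀ r, N ≤ r → ∀ x ∈ X r, x = 0)
    {f : ℕ →₀ M} (hf : f ∈ coeffsIn X) (hf0 : ∀ s < r₀, f s = 0)
    (hDf : totalDiff δ d f = 0) {y : M} (hy : y ∈ W (r₀ + 1)) (hyf : d y = f r₀) :
    ∃ g ∈ coeffsIn W, totalDiff δ d g = f := by
  -- At `r₀` exactness is not assumed; the given `y` takes its place in removing the coefficient,
  -- and from `r₀ + 1` on the rows are exact.
  obtain ⟨g, hg, hgf⟩ := exists_totalDiff_eq (r₀ := r₀) (r := r₀ + 1) (W := W) (X := X)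
    (f := f + totalDiff δ d (Finsupp.single (r₀ + 1) y)) hδ hd h
    (fun r hr => hWX r hr.le) hX hN r₀.lt_succ_self
    (by
      rw [totalDiff_single_succ, hyf]
      exact Submodule.add_mem _ hf (Submodule.sub_mem _
        (single_mem_coeffsIn (hWX r₀ le_rfl y hy)) (single_mem_coeffsIn (hf r₀))))
    (by
      intro s hs
      rw [totalDiff_single_succ, hyf]
      rcases Nat.lt_succ_iff_lt_or_eq.1 hs with hs | rfl
      · simp [hf0 s hs, (show r₀ + 1 ≠ s by omega), (show r₀ ≠ s by omega)]
      · simp)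
    (by rw [map_add, hDf, totalDiff_totalDiff hδ hd h, add_zero])
  refine ⟨g - Finsupp.single (r₀ + 1) y, Submodule.sub_mem _ hg (single_mem_coeffsIn hy), ?_⟩
  rw [map_sub, hgf, add_sub_cancel_right]

/-- A criterion for the projection `∑ fᵣ u ^ (-r) ↦ f₀ mod im d` to induce an isomorphism. -/
theorem exists_equiv_modRange
    {δ' : (M ⧸ LinearMap.range d) →ₗ[k] (M ⧸ LinearMap.range d)}
    (hδ' : ∀ x, δ' ((LinearMap.range d).mkQ x) = (LinearMap.range d).mkQ (δ x))
    (hinj : ∀ f ∈ coeffsIn X, totalDiff δ d f = 0 → ∀ g ∈ W 0, f 0 - δ g ∈ LinearMap.range d →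
      ∃ h ∈ coeffsIn W, totalDiff δ d h = f)
    (hsurj : ∀ x ∈ X 0, δ x ∈ LinearMap.range d →
      ∃ f ∈ coeffsIn X, totalDiff δ d f = 0 ∧ ∃ g ∈ W 0, f 0 - x - δ g ∈ LinearMap.range d) :
    ∃ e : HomologyAt (totalDiff δ d) (coeffsIn X) (coeffsIn W) ≃ₗ[k]
        HomologyAt δ' ((X 0).map (LinearMap.range d).mkQ) ((W 0).map (LinearMap.range d).mkQ),
      Induces id (fun f : ℕ →₀ M => (LinearMap.range d).mkQ (f 0)) e.toLinearMap := by
  have hmk : ∀ x y, (LinearMap.range d).mkQ x = (LinearMap.range d).mkQ y ↔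
      x - y ∈ LinearMap.range d := fun x y => Submodule.Quotient.eq _
  have hmk0 : ∀ x, (LinearMap.range d).mkQ x = 0 ↔ x ∈ LinearMap.range d :=
    fun x => Submodule.Quotient.mk_eq_zero _
  refine HomologyAt.exists_equiv ((LinearMap.range d).mkQ ∘ₗ Finsupp.lapply 0) ?_ ?_ ?_ ?_
  · rintro f ⟨hf, hDf⟩
    refine ⟨⟨f 0, hf 0, rfl⟩, ?_⟩
    change δ' ((LinearMap.range d).mkQ (f 0)) = 0
    rw [hδ', hmk0]
    have := totalDiff_apply δ d f 0
    rw [LinearMap.mem_ker.1 hDf, Finsupp.zero_apply, eq_comm, sub_eq_zero] at this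
    exact ⟨_, this.symm⟩
  · intro f hf
    refine ⟨_, ⟨f 0, hf 0, rfl⟩, ?_⟩
    rw [hδ', LinearMap.comp_apply, Finsupp.lapply_apply, hmk, totalDiff_apply]
    -- The initial coefficient of the boundary of `f` is `δ (f 0) - d (f 1)`, hence `δ (f 0)` modulo
    -- the image of `d`.
    exact ⟨f 1, by abel⟩
  · rintro f ⟨hf, hDf⟩ ⟨_, ⟨g, hg, rfl⟩, hgf⟩
    rw [hδ', LinearMap.comp_apply, Finsupp.lapply_apply, eq_comm, hmk] at hgf
    obtain ⟨h, hh, hhf⟩ := hinj f hf hDf g hg hgf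
    exact ⟨h, hh, hhf⟩
  · rintro _ ⟨⟨x, hx, rfl⟩, hδx⟩
    change δ' ((LinearMap.range d).mkQ x) = 0 at hδx
    rw [hδ', hmk0] at hδx
    obtain ⟨f, hf, hDf, g, hg, hfg⟩ := hsurj x hx hδx
    refine ⟨f, ⟨hf, hDf⟩, _, ⟨g, hg, rfl⟩, ?_⟩
    rw [hδ', LinearMap.comp_apply, Finsupp.lapply_apply, ← map_sub, eq_comm, hmk]
    exact hfg

/-- If all rows are exact except at the initial term, the projection
`∑ fᵣ u ^ (-r) ↦ f₀ mod im d` is injective on homology. -/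
theorem exists_totalDiff_eq_of_initial (hδ : ∀ x, δ (δ x) = 0) (hd : ∀ x, d (d x) = 0)
    (h : ∀ x, δ (d x) = -d (δ x)) (hWX : ∀ r, ∀ x ∈ W r, δ x ∈ X r)
    (hX : ∀ r, 0 < r → ∀ x ∈ X r, d x = 0 → ∃ y ∈ W (r + 1), d y = x)
    (hN : ∀ r, N ≤ r → ∀ x ∈ X r, x = 0)
    {f : ℕ →₀ M} (hf : f ∈ coeffsIn X) (hDf : totalDiff δ d f = 0) {g y : M} (hg : g ∈ W 0)
    (hy : y ∈ W 1) (hgy : f 0 - δ g = d y) : ∃ g ∈ coeffsIn W, totalDiff δ d g = f := by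
  -- Subtracting the boundary of `g u ^ 0` makes the initial coefficient exactly `d y`; nothing else
  -- changes, since `u` annihilates `u ^ 0`.
  obtain ⟨h', hh', hhf⟩ := exists_totalDiff_eq_of_first (r₀ := 0) (W := W) (X := X)
    (f := f - totalDiff δ d (Finsupp.single 0 g)) hδ hd h (fun r _ => hWX (r + 1)) hX hN
    (by
      rw [totalDiff_single_zero]
      exact Submodule.sub_mem _ hf (single_mem_coeffsIn (hWX 0 g hg)))
    (fun s hs => absurd hs s.not_lt_zero)
    (by rw [map_sub, hDf, totalDiff_totalDiff hδ hd h, sub_zero]) hy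
    (by rw [totalDiff_single_zero, ← hgy]; simp)
  refine ⟨h' + Finsupp.single 0 g, Submodule.add_mem _ hh' (single_mem_coeffsIn hg), ?_⟩
  rw [map_add, hhf, sub_add_cancel]

/-- If the rows of the next lower degree are exact, the projection
`∑ fᵣ u ^ (-r) ↦ f₀ mod im d` is surjective on homology. -/
theorem exists_cycle_of_initial (hδ : ∀ x, δ (δ x) = 0) (hd : ∀ x, d (d x) = 0)
    (h : ∀ x, δ (d x) = -d (δ x)) (hXY : ∀ r, ∀ x ∈ X r, δ x ∈ Y r)
    (hY : ∀ r, ∀ y ∈ Y r, d y = 0 → ∃ x ∈ X (r + 1), d x = y)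
    (hN : ∀ r, N ≤ r → ∀ x ∈ X r, x = 0) {x : M} (hx : x ∈ X 0)
    (hdx : δ x ∈ LinearMap.range d) : ∃ f ∈ coeffsIn X, totalDiff δ d f = 0 ∧ f 0 = x := by
  obtain ⟨y, hy⟩ := hdx
  obtain ⟨f, hf, -, h0, h1⟩ := exists_extension (r₀ := 0) (r := 0) hδ h (fun r _ => hXY r)
    (fun r _ => hY r) hN le_rfl hx (by rw [← hy, hd])
  refine ⟨f, hf, ?_, h0⟩
  ext r
  rw [totalDiff_apply, h1 r (Nat.zero_le _), sub_self, Finsupp.zero_apply]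

end Zigzag

end ExtendedCyclic

namespace ExtendedCyclic

universe u v

/-! ### The isomorphisms `π_m` and `π_-` -/

section Projection

variable {k : Type u} [CommRing k] {A : Type v} [Ring A] [Algebra k A]

/-- The coefficients of `u ^ (-r)` of homological degree `ℓ` and internal degree `K`. -/
abbrev extCoeff (k : Type u) [CommRing k] (A : Type v) [Ring A] [Algebra k A] (ℓ K : ℤ) (r : ℕ) :
    Submodule k (DRBar k A Unit) := drForms k A Unit (ℓ - 2 * r) (K - (ℓ - 2 * r) - r)

theorem contrDR_mem_extCoeff {ℓ ℓ' K : ℤ} (hℓ : ℓ = ℓ' + 1) {r : ℕ} {x : DRBar k A Unit}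
    (hx : x ∈ extCoeff k A ℓ K r) : contrDR k A x ∈ extCoeff k A ℓ' K r := by
  convert contrDR_mem k hx using 2 <;> rw [hℓ] <;> ring

/-- The bidegree is `(ℓ - 2r, K - ℓ + r)`: its first entry is negative for large `r`, its second for
`r < ℓ - K`. -/
theorem extCoeff_eq_zero {ℓ K : ℤ} {r : ℕ} (h : ℓ.toNat + 1 ≤ r ∨ r < ℓ - K) {x : DRBar k A Unit}
    (hx : x ∈ extCoeff k A ℓ K r) : x = 0 :=
  drForms_eq_zero k (by omega) hx

theorem mem_extCoeff_of_drForms {ℓ K : ℤ} {r : ℕ} {p q : ℤ} (hp : p = ℓ - 2 * r)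
    (hq : q = K - ℓ + r) {x : DRBar k A Unit} (hx : x ∈ drForms k A Unit p q) :
    x ∈ extCoeff k A ℓ K r := by
  convert hx using 2
  · exact hp.symm
  · rw [hq]; ring

theorem mem_drForms_of_extCoeff {ℓ K : ℤ} {r : ℕ} {p q : ℤ} (hp : p = ℓ - 2 * r)
    (hq : q = K - ℓ + r) {x : DRBar k A Unit} (hx : x ∈ extCoeff k A ℓ K r) :
    x ∈ drForms k A Unit p q := by
  convert hx using 2
  rw [hq]; ring

variable [Algebra ℚ k] {s : A →ₗ[k] k}

/-- Raising both `ℓ` and `r` by one keeps the `t`-degree `K - ℓ + r` and lowers the de Rham degree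
by one. Wherever this `t`-degree is positive, exactness of `d` applies. -/
theorem exists_extCoeff_dDR_eq (hs : s 1 = 1) {ℓ ℓ' K : ℤ} (hℓ : ℓ' = ℓ + 1) {r : ℕ}
    (hr : ℓ - K < r) {x : DRBar k A Unit} (hx : x ∈ extCoeff k A ℓ K r)
    (hd : dDR k A Unit x = 0) : ∃ y ∈ extCoeff k A ℓ' K (r + 1), dDR k A Unit y = x := by
  obtain ⟨y, hy, hyx⟩ := exists_dDR_eq k hs (by omega) hx hd
  refine ⟨y, mem_extCoeff_of_drForms ?_ ?_ hy, hyx⟩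
  · push_cast; rw [hℓ]; ring
  · push_cast; rw [hℓ]; ring

/-- The coefficient at `r` has `t`-degree `r - m`: nothing lives below `m`, the coefficient at `m`
lies in the copy of the forms on `A`, and all later ones are in the exact range. So a closed class
at `r = m` extends to a cycle, and a cycle is a boundary as soon as its coefficient at `m` is
`d`-exact. -/
theorem exists_piCoeff_equiv (hs : s 1 = 1) (ℓ m : ℤ) (hm : 0 < m) :
    ∃ πm : EHC k A ℓ m ≃ₗ[k] HD k A (ℓ - 2 * m),
      Induces id (piCoeff k A m.toNat) πm.toLinearMap := by
  -- Since `m > 0` there is a position just below the relevant coefficient. The cycle equation there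
  -- says that this coefficient is `d`-closed.
  obtain ⟨m, rfl⟩ : ∃ n : ℕ, m = n + 1 := ⟨(m - 1).toNat, by omega⟩
  have hm' : ((m : ℤ) + 1).toNat = m + 1 := by omega
  have hzero : ∀ f ∈ extForms k A ℓ (ℓ - (m + 1)), ∀ r ≤ m, f r = 0 := fun f hf r hr =>
    extCoeff_eq_zero (Or.inr (by omega)) (hf r)
  have hzero' : ∀ f ∈ extForms k A (ℓ + 1) (ℓ - (m + 1)), ∀ r ≤ m + 1, f r = 0 := fun f hf r hr =>
    extCoeff_eq_zero (Or.inr (by omega)) (hf r)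
  have hmem : ∀ f ∈ extForms k A ℓ (ℓ - (m + 1)),
      f (m + 1) ∈ drForms k A Unit (ℓ - 2 * (m + 1)) 0 := fun f hf =>
    mem_drForms_of_extCoeff (by push_cast; ring) (by push_cast; ring) (hf (m + 1))
  have hmem' : ∀ f ∈ extForms k A (ℓ + 1) (ℓ - (m + 1)),
      f (m + 2) ∈ drForms k A Unit (ℓ - 2 * (m + 1) - 1) 0 := fun f hf =>
    mem_drForms_of_extCoeff (by push_cast; ring) (by push_cast; ring) (hf (m + 2))
  rw [hm']
  refine HomologyAt.exists_equiv (modTDR k A ∘ₗ Finsupp.lapply (m + 1)) ?_ ?_ ?_ ?_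
  · rintro f ⟨hf, hDf⟩
    refine ⟨modTDR_mem k (hmem f hf), ?_⟩
    change dDR k A Empty (modTDR k A (f (m + 1))) = 0
    have := totalDiff_apply (contrDR k A) (dDR k A Unit) f m
    rw [LinearMap.mem_ker.1 hDf, hzero f hf m le_rfl, map_zero, zero_sub, Finsupp.zero_apply,
      zero_eq_neg] at this
    rw [← modTDR_dDR, this, map_zero]
  · intro f hf
    refine ⟨-modTDR k A (f (m + 2)), Submodule.neg_mem _ (modTDR_mem k (hmem' f hf)), ?_⟩
    rw [LinearMap.comp_apply, Finsupp.lapply_apply, totalDiff_apply, hzero' f hf _ le_rfl, map_neg,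
      ← modTDR_dDR]
    simp
  · rintro f ⟨hf, hDf⟩ ⟨y, hy, hyf⟩
    have hdf : dDR k A Unit (inclTDR k A y) = f (m + 1) := by
      rw [← inclTDR_dDR, hyf]; exact inclTDR_modTDR k (hmem f hf)
    obtain ⟨g, hg, hgf⟩ := exists_totalDiff_eq_of_first (r₀ := m + 1) (N := ℓ.toNat + 1)
      (W := extCoeff k A (ℓ + 1) (ℓ - (m + 1))) (X := extCoeff k A ℓ (ℓ - (m + 1)))
      (contrDR_contrDR k) (dDR_dDR k) (contrDR_dDR k A)
      (fun r _ x hx => contrDR_mem_extCoeff rfl hx)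
      (fun r hr x hx hdx => exists_extCoeff_dDR_eq hs rfl (by omega) hx hdx)
      (fun r hr x hx => extCoeff_eq_zero (Or.inl hr) hx) hf
      (fun r hr => hzero f hf r (by omega)) hDf
      (mem_extCoeff_of_drForms (by push_cast; ring) (by push_cast; ring) (inclTDR_mem k hy)) hdf
    exact ⟨g, hg, hgf⟩
  · rintro y ⟨hy, hdy⟩
    obtain ⟨f, hf, h0, h1, h2⟩ := exists_extension (r₀ := m + 1) (r := m + 1) (N := ℓ.toNat + 1)
      (X := extCoeff k A ℓ (ℓ - (m + 1))) (Y := extCoeff k A (ℓ - 1) (ℓ - (m + 1)))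
      (x := inclTDR k A y) (contrDR_contrDR k) (contrDR_dDR k A)
      (fun r _ x hx => contrDR_mem_extCoeff (by ring) hx)
      (fun r hr x hx hdx => exists_extCoeff_dDR_eq hs (by ring) (by omega) hx hdx)
      (fun r hr x hx => extCoeff_eq_zero (Or.inl hr) hx) le_rfl
      (mem_extCoeff_of_drForms (by push_cast; ring) (by push_cast; ring) (inclTDR_mem k hy))
      (by rw [← neg_eq_zero, ← contrDR_dDR, ← inclTDR_dDR, LinearMap.mem_ker.1 hdy, map_zero,
        map_zero])
    refine ⟨f, ⟨hf, ?_⟩, ?_⟩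
    · change totalDiff (contrDR k A) (dDR k A Unit) f = 0
      ext r
      rw [totalDiff_apply, Finsupp.zero_apply]
      rcases lt_trichotomy r m with hr | rfl | hr
      · rw [h0 r (by omega), h0 (r + 1) (by omega), map_zero, map_zero, sub_zero]
      · rw [h0 r (by omega), h1, ← inclTDR_dDR, LinearMap.mem_ker.1 hdy, map_zero, map_zero,
          sub_zero]
      · rw [h2 r hr, sub_self]
    · rw [LinearMap.comp_apply, Finsupp.lapply_apply, h1, modTDR_inclTDR, sub_self]
      exact Submodule.zero_mem _

/-- The coefficient at `r` has `t`-degree `r - m`, positive for `r > 0`, so injectivity meets exact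
rows after the initial one. For surjectivity one needs exactness in homological degree `ℓ - 1`,
where the `t`-degree is `r - m + 1`, positive even for `r = m = 0`. -/
theorem exists_piMinus_equiv (hs : s 1 = 1) (ℓ m : ℤ) (hm : m ≤ 0) :
    ∃ πminus : EHC k A ℓ m ≃ₗ[k] HModD k A ℓ (-m), Induces id (piMinus k A) πminus.toLinearMap := by
  have key := exists_equiv_modRange (δ := contrDR k A) (d := dDR k A Unit)
    (W := extCoeff k A (ℓ + 1) (ℓ - m)) (X := extCoeff k A ℓ (ℓ - m)) (δ' := contrModD k A)
    (fun x => rfl) ?_ ?_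
  · have e1 : extCoeff k A ℓ (ℓ - m) 0 = drForms k A Unit ℓ (-m) := by
      unfold extCoeff; congr 1 <;> simp
    have e2 : extCoeff k A (ℓ + 1) (ℓ - m) 0 = drForms k A Unit (ℓ + 1) (-m - 1) := by
      unfold extCoeff; congr 1
      · simp
      · push_cast; ring
    rw [e1, e2] at key
    exact key
  · intro f hf hDf g hg hr
    obtain ⟨y, hy, hyf⟩ := drForms_mem_map_of_mem_range k (p := ℓ) (q := -m)
      (Submodule.sub_mem _ (mem_drForms_of_extCoeff (by simp) (by push_cast; ring) (hf 0))
        (mem_drForms_of_extCoeff (by simp) (by push_cast; ring)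
          (contrDR_mem_extCoeff (ℓ' := ℓ) rfl hg))) hr
    exact exists_totalDiff_eq_of_initial (N := ℓ.toNat + 1)
      (W := extCoeff k A (ℓ + 1) (ℓ - m)) (X := extCoeff k A ℓ (ℓ - m)) (contrDR_contrDR k) (dDR_dDR k)
      (contrDR_dDR k A) (fun r x hx => contrDR_mem_extCoeff rfl hx)
      (fun r hr x hx hdx => exists_extCoeff_dDR_eq hs rfl (by omega) hx hdx)
      (fun r hr x hx => extCoeff_eq_zero (Or.inl hr) hx) hf hDf hg
      (mem_extCoeff_of_drForms (by push_cast; ring) (by push_cast; ring) hy) hyf.symm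
  · intro x hx hr
    obtain ⟨f, hf, hDf, h0⟩ := exists_cycle_of_initial (N := ℓ.toNat + 1)
      (X := extCoeff k A ℓ (ℓ - m)) (Y := extCoeff k A (ℓ - 1) (ℓ - m))
      (contrDR_contrDR k) (dDR_dDR k)
      (contrDR_dDR k A) (fun r x hx => contrDR_mem_extCoeff (by ring) hx)
      (fun r x hx hdx => exists_extCoeff_dDR_eq hs (by ring) (by omega) hx hdx)
      (fun r hr x hx => extCoeff_eq_zero (Or.inl hr) hx) hx hr
    exact ⟨f, hf, hDf, 0, Submodule.zero_mem _, by
      rw [h0, sub_self, map_zero, sub_zero]; exact Submodule.zero_mem _⟩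

end Projection

end ExtendedCyclic

namespace ExtendedCyclic

universe u v

/-! ### The operators `b`, `d`, `κ` and `B` on reduced forms -/

section Karoubi

variable (k : Type u) [CommRing k] (A : Type v) [Ring A] [Algebra k A]

variable {A} in
theorem karoubi_mem {p : ℤ} {x : Omega k A} (hx : x ∈ forms k A Empty p 0) :
    karoubi k A x ∈ forms k A Empty p 0 := by
  replace hx := mem_normal k hx
  induction hx using Submodule.span_induction with
  | zero => simp
  | add x y _ _ hx hy => rw [map_add]; exact Submodule.add_mem _ hx hy
  | smul r x _ hx => rw [map_smul]; exact Submodule.smul_mem _ _ hx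
  | mem x hx =>
    obtain ⟨a, l, rfl, rfl⟩ := hx
    rcases l.eq_nil_or_concat' with rfl | ⟨l, b, rfl⟩
    · simpa [dword, karoubi_ofA] using ofA_mem k a
    · rw [dword_concat, ← mul_assoc, karoubi_mul_dA, parity_of_mem k (normal_mem k a l),
        Units.smul_def, mul_smul_comm]
      refine Submodule.smul_of_tower_mem _ _ ?_
      have := forms_mul k (dA_mem k b) (normal_mem k a l)
      rwa [add_comm, add_zero, ← Nat.cast_one, ← Nat.cast_add, ← List.length_singleton (a := b),
        ← List.length_append] at this

variable {A} in
theorem hochschild_eq_zero {x : Omega k A} (hx : x ∈ forms k A Empty 0 0) :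
    hochschild k A x = 0 := by
  replace hx := mem_normal k hx
  induction hx using Submodule.span_induction with
  | zero => simp
  | add x y _ _ hx hy => rw [map_add, hx, hy, add_zero]
  | smul r x _ hx => rw [map_smul, hx, smul_zero]
  | mem x hx =>
    obtain ⟨a, l, hl, rfl⟩ := hx
    obtain rfl : l = [] := List.length_eq_zero_iff.1 (by exact_mod_cast hl)
    simp [dword, hochschild_ofA]

-- Multiplying `b d + d b = 1 - κ` by `d` on either side leaves `d b d`, because `d d = 0`; hence `d
-- - κ d = d - d κ`.
variable {A} in
theorem dOmega_karoubi (x : Omega k A) :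
    dOmega k A Empty (karoubi k A x) = karoubi k A (dOmega k A Empty x) := by
  have h1 := hochschild_dOmega k (dOmega k A Empty x)
  have h2 := congrArg (dOmega k A Empty) (hochschild_dOmega k x)
  rw [dOmega_dOmega, map_zero, zero_add] at h1
  rw [map_add, dOmega_dOmega, add_zero, map_sub, h1] at h2
  exact (sub_right_injective h2).symm

variable {A} in
theorem karoubi_pow_eq {n : ℕ} {x : Omega k A} (hx : x ∈ forms k A Empty n 0) :
    (karoubi k A ^ (n + 1)) x = x - dOmega k A Empty (hochschild k A x) := by
  replace hx := mem_normal k hx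
  induction hx using Submodule.span_induction with
  | zero => simp
  | add x y _ _ hx hy => simp only [map_add, hx, hy]; abel
  | smul r x _ hx => simp only [map_smul, hx, smul_sub]
  | mem x hx =>
    obtain ⟨a, l, hl, rfl⟩ := hx
    obtain rfl : l.length = n := by exact_mod_cast hl
    exact karoubi_pow_normal k a l

/-- The Karoubi operator on reduced forms. -/
def karoubiR : Module.End k (OmegaR k A) :=
  Submodule.mapQ _ _ (karoubi k A) (fun x hx => by
    obtain ⟨r, rfl⟩ := mem_consts_empty hx
    rw [Submodule.mem_comap, karoubi_ofA]; exact hx)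

/-- The de Rham differential on reduced forms. -/
def dOmegaR : Module.End k (OmegaR k A) :=
  Submodule.mapQ _ _ (dOmega k A Empty) (fun x hx => by
    rw [Submodule.mem_comap, dOmega_consts k hx]; exact Submodule.zero_mem _)

variable {A}

theorem karoubiR_mk (x : Omega k A) : karoubiR k A ((consts k A Empty).mkQ x) =
    (consts k A Empty).mkQ (karoubi k A x) := rfl

theorem dOmegaR_mk (x : Omega k A) : dOmegaR k A ((consts k A Empty).mkQ x) =
    (consts k A Empty).mkQ (dOmega k A Empty x) := rfl

theorem hochschildR_mk (x : Omega k A) : hochschildR k A ((consts k A Empty).mkQ x) =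
    (consts k A Empty).mkQ (hochschild k A x) := rfl

theorem connesR_mk (x : Omega k A) : connesR k A ((consts k A Empty).mkQ x) =
    (consts k A Empty).mkQ (connes k A x) := rfl

theorem karoubiR_pow_mk (j : ℕ) (x : Omega k A) :
    (karoubiR k A ^ j) ((consts k A Empty).mkQ x) =
      (consts k A Empty).mkQ ((karoubi k A ^ j) x) := by
  induction j with
  | zero => rfl
  | succ j ih => rw [pow_succ', Module.End.mul_apply, ih, karoubiR_mk, pow_succ',
      Module.End.mul_apply]

theorem omegaForms_induction {p : ℤ} {P : OmegaR k A → Prop}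
    (h : ∀ n : ℕ, p = n → ∀ x ∈ forms k A Empty n 0, P ((consts k A Empty).mkQ x)) (h0 : P 0)
    {x : OmegaR k A} (hx : x ∈ omegaForms k A p) : P x := by
  obtain ⟨x, hx, rfl⟩ := hx
  rcases lt_or_ge p 0 with hp | hp
  · have hx' : x ∈ forms k A Empty p 0 := hx
    rw [forms_eq_bot k (Or.inl hp), Submodule.mem_bot] at hx'
    rw [hx', map_zero]; exact h0
  · obtain ⟨n, rfl⟩ := Int.eq_ofNat_of_zero_le hp
    exact h n rfl x hx

theorem omegaForms_eq_zero {p : ℤ} (hp : p < 0) {x : OmegaR k A} (hx : x ∈ omegaForms k A p) :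
    x = 0 :=
  omegaForms_induction k (P := fun x => x = 0) (fun n hn _ _ => by omega) rfl hx

theorem karoubiR_mem {p : ℤ} {x : OmegaR k A} (hx : x ∈ omegaForms k A p) :
    karoubiR k A x ∈ omegaForms k A p := by
  obtain ⟨x, hx, rfl⟩ := hx
  exact ⟨_, karoubi_mem k hx, rfl⟩

theorem dOmegaR_mem {p : ℤ} {x : OmegaR k A} (hx : x ∈ omegaForms k A p) :
    dOmegaR k A x ∈ omegaForms k A (p + 1) := by
  obtain ⟨x, hx, rfl⟩ := hx
  exact ⟨_, dOmega_mem k hx, rfl⟩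

theorem hochschildR_mem {p : ℤ} {x : OmegaR k A} (hx : x ∈ omegaForms k A p) :
    hochschildR k A x ∈ omegaForms k A (p - 1) := by
  refine omegaForms_induction k (P := fun x => hochschildR k A x ∈ omegaForms k A (p - 1))
    (fun n hn y hy => ?_) ?_ hx
  · subst hn
    cases n with
    | zero =>
      rw [hochschildR_mk, hochschild_eq_zero k hy, map_zero]; exact Submodule.zero_mem _
    | succ n =>
      rw [Nat.cast_succ, add_sub_cancel_right]
      exact ⟨_, hochschild_mem k (n := n) (by exact_mod_cast hy), rfl⟩
  · rw [map_zero]; exact Submodule.zero_mem _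

theorem connesR_of_mem {n : ℕ} {x : OmegaR k A} (hx : x ∈ omegaForms k A n) :
    connesR k A x = ∑ j ∈ Finset.range (n + 1), (karoubiR k A ^ j) (dOmegaR k A x) := by
  obtain ⟨x, hx, rfl⟩ := hx
  rw [connesR_mk, connes_of_mem k hx, map_sum]
  simp only [dOmegaR_mk, karoubiR_pow_mk]

theorem karoubiR_pow_dOmegaR {n : ℕ} {x : OmegaR k A} (hx : x ∈ omegaForms k A n) :
    (karoubiR k A ^ (n + 1)) (dOmegaR k A x) = dOmegaR k A x := by
  obtain ⟨x, hx, rfl⟩ := hx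
  rw [dOmegaR_mk, karoubiR_pow_mk, karoubi_pow_dOmega k hx]

theorem karoubiR_pow_eq {n : ℕ} {x : OmegaR k A} (hx : x ∈ omegaForms k A n) :
    (karoubiR k A ^ (n + 1)) x = x - dOmegaR k A (hochschildR k A x) := by
  obtain ⟨x, hx, rfl⟩ := hx
  rw [karoubiR_pow_mk, karoubi_pow_eq k hx, map_sub]; rfl

theorem dOmegaR_dOmegaR (x : OmegaR k A) : dOmegaR k A (dOmegaR k A x) = 0 := by
  obtain ⟨x, rfl⟩ := Submodule.mkQ_surjective _ x
  rw [dOmegaR_mk, dOmegaR_mk, dOmega_dOmega, map_zero]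

theorem hochschildR_hochschildR (x : OmegaR k A) : hochschildR k A (hochschildR k A x) = 0 := by
  obtain ⟨x, rfl⟩ := Submodule.mkQ_surjective _ x
  rw [hochschildR_mk, hochschildR_mk, hochschild_hochschild, map_zero]

theorem hochschildR_dOmegaR (x : OmegaR k A) :
    hochschildR k A (dOmegaR k A x) + dOmegaR k A (hochschildR k A x) = x - karoubiR k A x := by
  obtain ⟨x, rfl⟩ := Submodule.mkQ_surjective _ x
  exact congrArg (consts k A Empty).mkQ (hochschild_dOmega k x)

theorem commute_hochschildR : Commute (hochschildR k A : Module.End k (OmegaR k A))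
    (karoubiR k A) := LinearMap.ext fun x => by
  obtain ⟨x, rfl⟩ := Submodule.mkQ_surjective _ x
  exact congrArg (consts k A Empty).mkQ (karoubi_hochschild k x).symm

theorem commute_dOmegaR : Commute (dOmegaR k A) (karoubiR k A) := LinearMap.ext fun x => by
  obtain ⟨x, rfl⟩ := Submodule.mkQ_surjective _ x
  exact congrArg (consts k A Empty).mkQ (dOmega_karoubi k x)

/-- A property of reduced forms that is additive can be checked on homogeneous forms. -/
theorem OmegaR.induction {P : OmegaR k A → Prop} (h0 : P 0) (hadd : ∀ x y, P x → P y → P (x + y))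
    (h : ∀ n : ℕ, ∀ x ∈ omegaForms k A n, P x) (x : OmegaR k A) : P x := by
  have hx : x ∈ ⨆ i : ℤ × ℤ, (forms k A Empty i.1 i.2).map (consts k A Empty).mkQ :=
    (isGrading_omegaBar k A Empty).top ▸ Submodule.mem_top
  induction hx using Submodule.iSup_induction' with
  | mem i x hx =>
    obtain ⟨p, q⟩ := i
    by_cases hq : q = 0
    · subst hq
      exact omegaForms_induction k (fun n _ x hx => h n _ ⟨x, hx, rfl⟩) h0 hx
    · simp only [forms_empty_eq_bot k hq, Submodule.map_bot, Submodule.mem_bot] at hx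
      rw [hx]; exact h0
  | zero => exact h0
  | add x y _ _ hx hy => exact hadd x y hx hy

theorem commute_connesR : Commute (connesR k A : Module.End k (OmegaR k A)) (karoubiR k A) :=
  LinearMap.ext fun x => by
    induction x using OmegaR.induction with
    | h0 => simp
    | hadd x y hx hy => rw [map_add, hx, hy, map_add]
    | h n x hx =>
      rw [Module.End.mul_apply, Module.End.mul_apply, connesR_of_mem k hx,
        connesR_of_mem k (karoubiR_mem k hx), map_sum]
      refine Finset.sum_congr rfl fun j _ => ?_
      rw [← Module.End.mul_apply (dOmegaR k A), commute_dOmegaR, Module.End.mul_apply,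
        ← Module.End.mul_apply, ← pow_succ, pow_succ', Module.End.mul_apply]

/-- The difference `B κ - B` telescopes to `(κ ^ (n + 1) - 1) d`, which is zero on `n`-forms. So `B`
kills the image of `κ - 1`. -/
theorem connesR_karoubiR (x : OmegaR k A) : connesR k A (karoubiR k A x) = connesR k A x := by
  induction x using OmegaR.induction with
  | h0 => simp
  | hadd x y hx hy => rw [map_add, map_add, hx, hy, map_add]
  | h n x hx =>
    rw [connesR_of_mem k hx, connesR_of_mem k (karoubiR_mem k hx),
      ← Module.End.mul_apply (dOmegaR k A), commute_dOmegaR, Module.End.mul_apply,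
      ← sub_eq_zero, ← Finset.sum_sub_distrib]
    have hj : ∀ (j : ℕ) (z : OmegaR k A),
        (karoubiR k A ^ j) (karoubiR k A z) = (karoubiR k A ^ (j + 1)) z := fun j z => by
      rw [pow_succ, Module.End.mul_apply]
    simp only [hj]
    rw [Finset.sum_range_sub fun j => (karoubiR k A ^ j) (dOmegaR k A x),
      karoubiR_pow_dOmegaR k hx]
    simp

theorem connesR_mem {p : ℤ} {x : OmegaR k A} (hx : x ∈ omegaForms k A p) :
    connesR k A x ∈ omegaForms k A (p + 1) := by
  rcases lt_or_ge p 0 with hp | hp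
  · rw [omegaForms_eq_zero k hp hx, map_zero]; exact Submodule.zero_mem _
  · obtain ⟨n, rfl⟩ := Int.eq_ofNat_of_zero_le hp
    rw [connesR_of_mem k hx]
    refine Submodule.sum_mem _ fun j hj => ?_
    clear hj
    induction j with
    | zero => exact dOmegaR_mem k hx
    | succ j ih => rw [pow_succ', Module.End.mul_apply]; exact karoubiR_mem k ih

theorem dOmegaR_karoubiR_pow (j : ℕ) (x : OmegaR k A) :
    dOmegaR k A ((karoubiR k A ^ j) x) = (karoubiR k A ^ j) (dOmegaR k A x) := by
  rw [← Module.End.mul_apply, (commute_dOmegaR k).pow_right j, Module.End.mul_apply]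

/-- Every term contains `d κ ^ i d = κ ^ i d d = 0`. -/
theorem connesR_connesR (x : OmegaR k A) : connesR k A (connesR k A x) = 0 := by
  induction x using OmegaR.induction with
  | h0 => simp
  | hadd x y hx hy => rw [map_add, map_add, hx, hy, add_zero]
  | h n x hx =>
    have h1 : connesR k A x ∈ omegaForms k A (n + 1 : ℕ) := by exact_mod_cast connesR_mem k hx
    rw [connesR_of_mem k h1]
    refine Finset.sum_eq_zero fun j _ => ?_
    rw [connesR_of_mem k hx, map_sum, Finset.sum_eq_zero, map_zero]
    intro i _
    rw [dOmegaR_karoubiR_pow, dOmegaR_dOmegaR, map_zero]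

theorem omegaForms_mem_map_of_mem_range {D : Module.End k (OmegaR k A)}
    (hD : ∀ p : ℤ, ∀ x ∈ omegaForms k A p, D x ∈ omegaForms k A (p + 1)) {p : ℤ} {x : OmegaR k A}
    (hx : x ∈ omegaForms k A p) (hr : x ∈ LinearMap.range D) :
    x ∈ (omegaForms k A (p - 1)).map D :=
  (isGrading_omegaBar k A Empty).mem_map_of_mem_range (e := fun i => (i.1 + 1, i.2))
    (fun i j h => by simpa [Prod.ext_iff] using h) (fun i x hx => by
      obtain ⟨p, q⟩ := i
      by_cases hq : q = 0
      · subst hq; exact hD p x hx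
      · simp only [forms_empty_eq_bot k hq, Submodule.map_bot, Submodule.mem_bot] at hx ⊢
        rw [hx, map_zero])
    (i := (p - 1, 0)) (by simpa [omegaForms] using hx) hr

/-- The reduced forms are acyclic for `d`. -/
theorem exists_dOmegaR_eq {s : A →ₗ[k] k} (hs : s 1 = 1) {p : ℤ} {x : OmegaR k A}
    (hx : x ∈ omegaForms k A p) (hd : dOmegaR k A x = 0) :
    ∃ y ∈ omegaForms k A (p - 1), dOmegaR k A y = x := by
  refine omegaForms_mem_map_of_mem_range k (fun _ _ => dOmegaR_mem k) hx ?_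
  clear hx
  obtain ⟨x, rfl⟩ := Submodule.mkQ_surjective _ x
  obtain ⟨y, hy⟩ := exists_dOmega_sub_mem_consts hs ((Submodule.Quotient.mk_eq_zero _).1 hd)
  exact ⟨(consts k A Empty).mkQ y, ((Submodule.Quotient.eq _).2 hy).symm⟩

end Karoubi

/-! ### The harmonic decomposition under the Karoubi operator -/

section Harmonic

open Polynomial

/-- At `X = 1` the geometric sum takes the value `N`, which is invertible over `ℚ`, so it is a unit
modulo `X - 1`. Coprimality passes to the squares. -/
theorem isCoprime_sub_one_sq_geom {k : Type u} [CommRing k] [Algebra ℚ k] {N : ℕ} (hN : 0 < N) :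
    IsCoprime ((X - 1 : k[X]) ^ 2) ((∑ i ∈ Finset.range N, X ^ i) ^ 2) := by
  refine IsCoprime.pow ?_
  obtain ⟨g, hg⟩ := X_sub_C_dvd_sub_C_eval (p := ∑ i ∈ Finset.range N, (X : k[X]) ^ i) (a := 1)
  have h1 : (∑ i ∈ Finset.range N, (X : k[X]) ^ i).eval 1 = (N : k) := by
    simp [eval_finsetSum]
  have h2 : algebraMap ℚ k (1 / N) * (N : k) = 1 := by
    rw [← map_natCast (algebraMap ℚ k), ← map_mul, one_div,
      inv_mul_cancel₀ (by exact_mod_cast hN.ne'), map_one]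
  rw [h1, C_1] at hg
  refine ⟨-C (algebraMap ℚ k (1 / N)) * g, C (algebraMap ℚ k (1 / N)), ?_⟩
  rw [eq_add_of_sub_eq hg, mul_add, ← C_mul, h2, C_1]
  ring

variable (k : Type u) [CommRing k] (A : Type v) [Ring A] [Algebra k A]

variable {A} in
theorem karoubiR_pow_mul_of_fixed {a : ℕ} {y : OmegaR k A} (hy : (karoubiR k A ^ a) y = y) (b : ℕ) :
    (karoubiR k A ^ (a * b)) y = y := by
  rw [pow_mul]
  induction b with
  | zero => simp
  | succ b ih => rw [pow_succ, Module.End.mul_apply, hy, ih]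

variable {A} in
/-- On forms of bounded degree, a power of the Karoubi operator is unipotent of order two. -/
theorem karoubiR_pow_sub_one_sq {N n : ℕ} (h1 : n + 1 ∣ N) (h2 : n = 0 ∨ n ∣ N) {x : OmegaR k A}
    (hx : x ∈ omegaForms k A n) :
    (karoubiR k A ^ N - 1 : Module.End k (OmegaR k A))
      ((karoubiR k A ^ N - 1 : Module.End k (OmegaR k A)) x) = 0 := by
  set y := dOmegaR k A (hochschildR k A x) with hy
  -- Here `y = d (b x)` with `b x` of degree one less than `x`, and `κ ^ n` fixes `d` of an `(n -
  -- 1)`-form; as `n` divides `N`, so does `κ ^ N`. In degree zero `b x = 0`.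
  have hyN : (karoubiR k A ^ N - 1 : Module.End k (OmegaR k A)) y = 0 := by
    rw [LinearMap.sub_apply, Module.End.one_apply, sub_eq_zero]
    cases n with
    | zero =>
      have h0 : hochschildR k A x = 0 :=
        omegaForms_eq_zero k (by norm_num) (hochschildR_mem k hx)
      rw [hy, h0, map_zero, map_zero]
    | succ n =>
      obtain ⟨c, rfl⟩ := h2.resolve_left (Nat.succ_ne_zero n)
      refine karoubiR_pow_mul_of_fixed k ?_ c
      have := hochschildR_mem k hx
      rw [Nat.cast_succ, add_sub_cancel_right] at this
      exact karoubiR_pow_dOmegaR k this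
  obtain ⟨c, rfl⟩ := h1
  -- As `n + 1` divides `N`, the operator `κ ^ N - 1` is a multiple of `κ ^ (n + 1) - 1`, which
  -- sends `x` to `-y`. A second application therefore gives zero.
  have h3 : (karoubiR k A ^ ((n + 1) * c) - 1 : Module.End k (OmegaR k A)) =
      (∑ i ∈ Finset.range c, (karoubiR k A ^ (n + 1)) ^ i) * (karoubiR k A ^ (n + 1) - 1) := by
    rw [geom_sum_mul, pow_mul]
  have h4 : Commute (karoubiR k A ^ ((n + 1) * c) - 1 : Module.End k (OmegaR k A))
      (∑ i ∈ Finset.range c, (karoubiR k A ^ (n + 1)) ^ i) := by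
    refine Commute.sum_right _ _ _ fun i _ => ?_
    exact (((Commute.refl _).pow_pow _ _).pow_right i).sub_left (Commute.one_left _)
  have h5 : (karoubiR k A ^ (n + 1) - 1 : Module.End k (OmegaR k A)) x = -y := by
    rw [LinearMap.sub_apply, Module.End.one_apply, karoubiR_pow_eq k hx]; abel
  have h6 : (karoubiR k A ^ ((n + 1) * c) - 1 : Module.End k (OmegaR k A)) x =
      (∑ i ∈ Finset.range c, (karoubiR k A ^ (n + 1)) ^ i : Module.End k (OmegaR k A)) (-y) := by
    rw [h3, Module.End.mul_apply, h5]
  rw [h6, ← Module.End.mul_apply, h4.eq, Module.End.mul_apply, map_neg, hyN, neg_zero, map_zero]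

/-- The harmonic decomposition: in degrees at most `L` the operator `P` projects to the generalized
eigenspace of the Karoubi operator for the eigenvalue `1`. -/
theorem exists_harmonic [Algebra ℚ k] (L : ℕ) : ∃ P U : Module.End k (OmegaR k A),
    (∀ T : Module.End k (OmegaR k A), Commute T (karoubiR k A) → Commute T P ∧ Commute T U) ∧
    (∀ p : ℤ, ∀ x ∈ omegaForms k A p, P x ∈ omegaForms k A p ∧ U x ∈ omegaForms k A p) ∧
    (P + U * (karoubiR k A - 1) ^ 2 = 1) ∧
    ∀ p : ℤ, p ≤ L → ∀ x ∈ omegaForms k A p, ((karoubiR k A - 1) ^ 2 * P : Module.End k (OmegaR k A)) x = 0 := by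
  -- The exponent `(L + 1)!` is divisible by `n + 1`, and by `n` unless `n = 0`, for all `n ≤ L`.
  obtain ⟨u, v, huv⟩ := isCoprime_sub_one_sq_geom (k := k) (L + 1).factorial_pos
  have hcomm : ∀ (f : k[X]) (T : Module.End k (OmegaR k A)), Commute T (karoubiR k A) →
      Commute T (aeval (karoubiR k A) f) := by
    intro f T hT
    induction f using Polynomial.induction_on' with
    | add f g hf hg => rw [map_add]; exact hf.add_right hg
    | monomial n a =>
      rw [aeval_monomial]; exact Commute.mul_right (Algebra.commutes a T).symm (hT.pow_right n)
  have hmem : ∀ (f : k[X]) (p : ℤ), ∀ x ∈ omegaForms k A p,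
      aeval (karoubiR k A) f x ∈ omegaForms k A p := by
    intro f p x hx
    induction f using Polynomial.induction_on' with
    | add f g hf hg => rw [map_add]; exact Submodule.add_mem _ hf hg
    | monomial n a =>
      rw [aeval_monomial, Module.End.mul_apply, Module.algebraMap_end_apply]
      refine Submodule.smul_mem _ _ ?_
      induction n with
      | zero => exact hx
      | succ n ih => rw [pow_succ', Module.End.mul_apply]; exact karoubiR_mem k ih
  -- The two summands of the Bézout identity, evaluated at `κ`, are `P` and `U (κ - 1) ^ 2`. Being
  -- polynomials in `κ`, the operators `P` and `U` commute with whatever commutes with `κ`.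
  refine ⟨aeval (karoubiR k A) (v * (∑ i ∈ Finset.range (L + 1).factorial, X ^ i) ^ 2),
    aeval (karoubiR k A) u, fun T hT => ⟨hcomm _ T hT, hcomm _ T hT⟩,
    fun p x hx => ⟨hmem _ p x hx, hmem _ p x hx⟩, ?_, ?_⟩
  · have := congrArg (aeval (karoubiR k A)) huv
    rw [add_comm, map_add, map_one, map_mul _ u] at this
    simpa using this
  · intro p hp x hx
    rcases lt_or_ge p 0 with hp0 | hp0
    · rw [omegaForms_eq_zero k hp0 hx, map_zero]
    obtain ⟨n, rfl⟩ := Int.eq_ofNat_of_zero_le hp0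
    have hn : n ≤ L := by exact_mod_cast hp
    have h1 := karoubiR_pow_sub_one_sq k (N := (L + 1).factorial)
      (Nat.dvd_factorial n.succ_pos (by omega))
      ((Nat.eq_zero_or_pos n).imp_right fun h => Nat.dvd_factorial h (by omega)) hx
    have h2 : (karoubiR k A - 1) ^ 2 *
        aeval (karoubiR k A) (v * (∑ i ∈ Finset.range (L + 1).factorial, X ^ i) ^ 2) =
        aeval (karoubiR k A) v * ((karoubiR k A ^ (L + 1).factorial - 1) *
          (karoubiR k A ^ (L + 1).factorial - 1)) := by
      -- Multiplication by `(X - 1) ^ 2` completes the squared geometric sum to `(X ^ N - 1) ^ 2`,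
      -- which annihilates low degrees.
      have h3 : ((X : k[X]) - 1) ^ 2 * (v * (∑ i ∈ Finset.range (L + 1).factorial, X ^ i) ^ 2) =
          v * ((X ^ (L + 1).factorial - 1) * (X ^ (L + 1).factorial - 1)) := by
        rw [← geom_sum_mul]; ring
      have := congrArg (aeval (karoubiR k A)) h3
      simpa using this
    rw [h2, Module.End.mul_apply, Module.End.mul_apply, h1, map_zero]

end Harmonic

/-! ### The Cuntz–Quillen isomorphism -/

section CuntzQuillen

variable {k : Type u} [CommRing k] {A : Type v} [Ring A] [Algebra k A]

theorem connesR_comp_sub_one :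
    (connesR k A : Module.End k (OmegaR k A)) * (karoubiR k A - 1) = 0 :=
  LinearMap.ext fun x => by
    rw [Module.End.mul_apply, LinearMap.sub_apply, map_sub, connesR_karoubiR,
      Module.End.one_apply, sub_self, LinearMap.zero_apply]

/-- On harmonic forms of degree `n`, the Connes differential is `(n + 1) d`. -/
theorem connesR_of_harmonic [Algebra ℚ k] {n : ℕ} {x : OmegaR k A} (hx : x ∈ omegaForms k A n)
    (hh : ((karoubiR k A - 1) ^ 2 : Module.End k (OmegaR k A)) x = 0) :
    connesR k A x = ((n : k) + 1) • dOmegaR k A x := by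
  set z := dOmegaR k A x with hz
  have h1 : (karoubiR k A - 1 : Module.End k (OmegaR k A))
      ((karoubiR k A - 1 : Module.End k (OmegaR k A)) z) = 0 := by
    have hc : Commute (dOmegaR k A) ((karoubiR k A - 1) ^ 2) :=
      ((commute_dOmegaR k).sub_right (Commute.one_right _)).pow_right 2
    rw [← Module.End.mul_apply, ← sq, hz, ← Module.End.mul_apply, ← hc.eq, Module.End.mul_apply, hh,
      map_zero]
  -- Since `(κ - 1) ^ 2 z = 0`, the binomial expansion of `κ ^ j z` stops after the linear term.
  have h2 : ∀ j : ℕ, (karoubiR k A ^ j) z = z + (j : k) •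
      (karoubiR k A - 1 : Module.End k (OmegaR k A)) z := by
    intro j
    induction j with
    | zero => simp
    | succ j ih =>
      have h3 : ∀ w, karoubiR k A w = w + (karoubiR k A - 1 : Module.End k (OmegaR k A)) w := by
        intro w; simp
      rw [pow_succ', Module.End.mul_apply, ih, h3, map_add, map_smul, h1, smul_zero, add_zero,
        Nat.cast_succ, add_smul, one_smul, add_assoc]
  -- Comparison with `κ ^ (n + 1) z = z` gives `(n + 1) (κ - 1) z = 0`; so `κ` fixes `d x`, and the
  -- sum defining `B x` has `n + 1` equal terms.
  have h3 : (karoubiR k A - 1 : Module.End k (OmegaR k A)) z = 0 := by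
    have h4 := h2 (n + 1)
    rw [karoubiR_pow_dOmegaR k hx, left_eq_add] at h4
    have h5 : algebraMap ℚ k (1 / (n + 1 : ℕ)) * ((n + 1 : ℕ) : k) = 1 := by
      rw [← map_natCast (algebraMap ℚ k), ← map_mul, one_div,
        inv_mul_cancel₀ (by exact_mod_cast n.succ_ne_zero), map_one]
    rw [← one_smul k ((karoubiR k A - 1 : Module.End k (OmegaR k A)) z), ← h5, mul_smul, h4,
      smul_zero]
  rw [connesR_of_mem k hx]
  simp only [← hz, h2, h3, smul_zero, add_zero]
  rw [Finset.sum_const, Finset.card_range, ← Nat.cast_smul_eq_nsmul k, Nat.cast_succ]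

/-- The complex splits under `P`. On the harmonic part `B` is an invertible multiple of `d` in each
degree, hence exact, and the zigzags for the projection to the initial coefficient apply. The
complement carries `B = 0`, and the operator `V` solves `b V = 1` on its cycles, so it contributes
no homology on either side. -/
theorem exists_cuntzQuillen_equiv [Algebra ℚ k] {s : A →ₗ[k] k} (hs : s 1 = 1) (ℓ : ℤ) :
    ∃ cq : HC k A ℓ ≃ₗ[k] HModB k A ℓ, Induces id (cuntzQuillen k A) cq.toLinearMap := by
  -- The bound `ℓ + 1` covers both the cycles of degree `ℓ` and the chains that bound them.
  obtain ⟨P, U, hcomm, hmem, hPU, hharm⟩ := exists_harmonic k A (ℓ + 1).toNat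
  obtain ⟨hPb, hUb⟩ := hcomm _ (commute_hochschildR k (A := A))
  obtain ⟨hPB, hUB⟩ := hcomm _ (commute_connesR k (A := A))
  obtain ⟨hPd, hUd⟩ := hcomm _ (commute_dOmegaR k (A := A))
  obtain ⟨-, hUκ⟩ := hcomm _ (Commute.refl (karoubiR k A))
  replace hUκ : Commute (karoubiR k A - 1) U := hUκ.sub_left (Commute.one_left _)
  have hsplit : ∀ x, x = P x + U (((karoubiR k A - 1) ^ 2 : Module.End k (OmegaR k A)) x) :=
    fun x => (LinearMap.congr_fun hPU x).symm
  have hb : ∀ x, hochschildR k A (P x) = P (hochschildR k A x) := LinearMap.congr_fun hPb.eq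
  have hB : ∀ x, connesR k A (P x) = P (connesR k A x) := LinearMap.congr_fun hPB.eq
  -- the complement of the harmonic part is annihilated by the Connes differential
  have hBz : ∀ x, connesR k A ((karoubiR k A - 1 : Module.End k (OmegaR k A)) x) = 0 :=
    LinearMap.congr_fun connesR_comp_sub_one
  have hBc : ∀ x, connesR k A (x - P x) = 0 := by
    intro x
    rw [sub_eq_of_eq_add' (hsplit x), ← Module.End.mul_apply U, sq, ← mul_assoc, ← hUκ.eq,
      mul_assoc, Module.End.mul_apply, hBz]
  -- and acyclic for the Hochschild differential
  let V : Module.End k (OmegaR k A) := -((karoubiR k A - 1) * U * dOmegaR k A)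
  have hVB : ∀ x, connesR k A (V x) = 0 := by
    intro x
    change connesR k A (-(karoubiR k A - 1 : Module.End k (OmegaR k A)) (U (dOmegaR k A x))) = 0
    rw [map_neg, hBz, neg_zero]
  have hVmem : ∀ p : ℤ, ∀ x ∈ omegaForms k A p, V x ∈ omegaForms k A (p + 1) := by
    intro p x hx
    have := (hmem _ _ (dOmegaR_mem k hx)).2
    exact Submodule.neg_mem _ (Submodule.sub_mem _ (karoubiR_mem k this) this)
  -- On `y = x - P x` one has `P y = 0`, so `y = U (κ - 1) ^ 2 y`. Moreover `b y = 0`, because `b x`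
  -- is in the image of `B` and `B` kills the complement. Then `(κ - 1) y = -b d y`, and commuting
  -- `b` to the front gives `y = b V y`.
  have hVb : ∀ p : ℤ, p ≤ ℓ → ∀ x ∈ omegaForms k A p,
      hochschildR k A x ∈ LinearMap.range (connesR k A) →
      hochschildR k A (V (x - P x)) = x - P x := by
    rintro p hp x hx ⟨x', hbx⟩
    set y := x - P x with hy
    have hby : hochschildR k A y = 0 := by rw [hy, map_sub, hb, ← hbx, ← hB, ← map_sub, hBc]
    have hPy : P y = 0 := by
      have hc : Commute P ((karoubiR k A - 1) ^ 2) :=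
        (((hcomm _ (Commute.refl _)).1.sub_left (Commute.one_left _)).pow_left 2).symm
      have hcU : Commute P U := by
        refine ((hcomm P ?_).2)
        exact (hcomm _ (Commute.refl _)).1.symm
      rw [hy, sub_eq_of_eq_add' (hsplit x), ← Module.End.mul_apply P, hcU.eq, Module.End.mul_apply,
        ← Module.End.mul_apply P, hc.eq, hharm p (by omega) x hx, map_zero]
    have hκy : (karoubiR k A - 1 : Module.End k (OmegaR k A)) y =
        -hochschildR k A (dOmegaR k A y) := by
      have := hochschildR_dOmegaR k y
      rw [hby, map_zero, add_zero] at this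
      rw [this, LinearMap.sub_apply, Module.End.one_apply, neg_sub]
    have hcb : Commute (hochschildR k A : Module.End k (OmegaR k A)) ((karoubiR k A - 1) * U) :=
      ((commute_hochschildR k).sub_right (Commute.one_right _)).mul_right hUb
    have h1 := hsplit y
    rw [hPy, zero_add, sq, ← Module.End.mul_apply U, ← mul_assoc, Module.End.mul_apply, hκy,
      ← hUκ.eq, map_neg, ← Module.End.mul_apply, ← hcb.eq, Module.End.mul_apply] at h1
    conv_rhs => rw [h1]
    rw [← map_neg]
    rfl
  let W : ℕ → Submodule k (OmegaR k A) := fun r => omegaForms k A (ℓ + 1 - 2 * r)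
  let X : ℕ → Submodule k (OmegaR k A) := fun r => omegaForms k A (ℓ - 2 * r)
  let H : Submodule k (OmegaR k A) :=
    LinearMap.ker ((karoubiR k A - 1) ^ 2 : Module.End k (OmegaR k A))
  have hHb : ∀ x ∈ H, hochschildR k A x ∈ H := by
    intro x hx
    have hc : Commute (hochschildR k A : Module.End k (OmegaR k A)) ((karoubiR k A - 1) ^ 2) :=
      ((commute_hochschildR k).sub_right (Commute.one_right _)).pow_right 2
    change ((karoubiR k A - 1) ^ 2 : Module.End k (OmegaR k A)) _ = 0
    rw [← Module.End.mul_apply, ← hc.eq, Module.End.mul_apply, LinearMap.mem_ker.1 hx, map_zero]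
  have hHP : ∀ x ∈ H, P x = x := by
    intro x hx
    have := hsplit x
    rw [LinearMap.mem_ker.1 hx, map_zero, add_zero] at this
    exact this.symm
  have hPH : ∀ p : ℤ, p ≤ ℓ + 1 → ∀ x ∈ omegaForms k A p, P x ∈ omegaForms k A p ⊓ H :=
    fun p hp x hx => ⟨(hmem p x hx).1, hharm p (by omega) x hx⟩
  -- A `d`-primitive exists by acyclicity of the reduced forms. Its projection by `P` is still a
  -- primitive of the harmonic form `x`, and division by the degree factor makes it a `B`-primitive.
  have hexact : ∀ p : ℤ, p ≤ ℓ → ∀ x ∈ omegaForms k A p ⊓ H, connesR k A x = 0 →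
      ∃ y ∈ omegaForms k A (p - 1) ⊓ H, connesR k A y = x := by
    rintro p hp x ⟨hx, hxH⟩ hBx
    rcases lt_or_ge p 0 with hp0 | hp0
    · exact ⟨0, Submodule.zero_mem _, by rw [omegaForms_eq_zero k hp0 hx, map_zero]⟩
    obtain ⟨n, rfl⟩ := Int.eq_ofNat_of_zero_le hp0
    have hinv : ∀ j : ℕ, algebraMap ℚ k (1 / (j + 1 : ℕ)) * ((j : k) + 1) = 1 := by
      intro j
      rw [← Nat.cast_succ, ← map_natCast (algebraMap ℚ k), ← map_mul, one_div,
        inv_mul_cancel₀ (by exact_mod_cast j.succ_ne_zero), map_one]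
    have hdx : dOmegaR k A x = 0 := by
      rw [connesR_of_harmonic hx hxH] at hBx
      rw [← one_smul k (dOmegaR k A x), ← hinv n, mul_smul, hBx, smul_zero]
    obtain ⟨y, hy, hyx⟩ := exists_dOmegaR_eq k hs hx hdx
    cases n with
    | zero =>
      refine ⟨0, Submodule.zero_mem _, ?_⟩
      rw [← hyx, omegaForms_eq_zero k (by norm_num) hy, map_zero, map_zero]
    | succ n =>
      have hPy := hPH _ (by omega) y hy
      rw [Nat.cast_succ, add_sub_cancel_right] at hPy
      refine ⟨algebraMap ℚ k (1 / (n + 1 : ℕ)) • P y, ?_, ?_⟩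
      · rw [Nat.cast_succ, add_sub_cancel_right]; exact Submodule.smul_mem _ _ hPy
      · rw [map_smul, connesR_of_harmonic hPy.1 hPy.2, smul_smul, hinv, one_smul,
          ← Module.End.mul_apply, hPd.eq, Module.End.mul_apply, hyx, hHP x hxH]
  have hvan : ∀ r : ℕ, ℓ.toNat + 1 ≤ r → ∀ x ∈ X r ⊓ H, x = 0 := fun r hr x hx =>
    omegaForms_eq_zero k (by omega) hx.1
  have hanti := hochschildR_connesR k A
  have key := exists_equiv_modRange (δ := hochschildR k A) (d := connesR k A) (W := W) (X := X)
    (δ' := hochschildModB k A) (fun x => rfl) ?_ ?_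
  · have e1 : X 0 = omegaForms k A ℓ := by simp [X]
    have e2 : W 0 = omegaForms k A (ℓ + 1) := by simp [W]
    rw [e1, e2] at key
    exact key
  · intro f hf hDf g hg hr
    have hcyc : ∀ r, hochschildR k A (f r) = connesR k A (f (r + 1)) := by
      intro r
      have := totalDiff_apply (hochschildR k A) (connesR k A) f r
      rwa [hDf, Finsupp.zero_apply, eq_comm, sub_eq_zero] at this
    obtain ⟨y, hy, hyf⟩ := omegaForms_mem_map_of_mem_range k (fun _ _ => connesR_mem k) (p := ℓ)
      (Submodule.sub_mem _ (by simpa [X] using hf 0)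
        (by have := hochschildR_mem k hg; simpa [W] using this)) hr
    have hPy : P y ∈ W 1 ⊓ H := by
      have := hPH _ (by omega) y hy
      have e : ℓ + 1 - 2 * ((1 : ℕ) : ℤ) = ℓ - 1 := by push_cast; ring
      simpa only [W, e] using this
    have hdeg : ∀ r : ℕ, ℓ - 2 * (r : ℤ) ≤ ℓ := fun r => by omega
    obtain ⟨h₁, hh₁, hDh₁⟩ := exists_totalDiff_eq_of_initial (N := ℓ.toNat + 1)
      (δ := hochschildR k A) (d := connesR k A)
      (W := fun r => W r ⊓ H) (X := fun r => X r ⊓ H) (f := Finsupp.mapRange.linearMap P f)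
      (g := P g) (y := P y)
      (hochschildR_hochschildR k) (connesR_connesR k) hanti
      (fun r x hx => ⟨by
        have := hochschildR_mem k hx.1
        have e : ℓ + 1 - 2 * (r : ℤ) - 1 = ℓ - 2 * r := by ring
        rwa [e] at this, hHb x hx.2⟩)
      (fun r hr x hx hdx => by
        obtain ⟨y, hy, hyx⟩ := hexact _ (hdeg r) x hx hdx
        refine ⟨y, ?_, hyx⟩
        have e : ℓ + 1 - 2 * ((r + 1 : ℕ) : ℤ) = ℓ - 2 * r - 1 := by push_cast; ring
        simpa only [W, e] using hy)
      hvan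
      (fun r => by
        rw [Finsupp.mapRange.linearMap_apply, Finsupp.mapRange_apply]
        exact hPH _ ((hdeg r).trans (by omega)) _ (hf r))
      (by
        ext r
        rw [totalDiff_apply, Finsupp.mapRange.linearMap_apply, Finsupp.mapRange_apply,
          Finsupp.mapRange_apply, hb, hB, hcyc, sub_self, Finsupp.zero_apply])
      (hPH _ (by simp) g hg) hPy
      (by rw [Finsupp.mapRange.linearMap_apply, Finsupp.mapRange_apply, hb, hB, hyf, map_sub])
    -- The harmonic part of `f` bounds `h₁`'s image under the total differential, and `f - P f` is
    -- the boundary of `V (f - P f)`, coefficient by coefficient, since `B V = 0`.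
    refine ⟨h₁ + Finsupp.mapRange.linearMap V (f - Finsupp.mapRange.linearMap P f),
      Submodule.add_mem _ (fun r => (hh₁ r).1) (fun r => ?_), ?_⟩
    · have hfr : f r - P (f r) ∈ omegaForms k A (ℓ - 2 * r) :=
        Submodule.sub_mem _ (hf r) (hmem _ _ (hf r)).1
      have := hVmem _ _ hfr
      have e : ℓ + 1 - 2 * (r : ℤ) = ℓ - 2 * r + 1 := by ring
      simp only [W, e, Finsupp.mapRange.linearMap_apply, Finsupp.mapRange_apply, Finsupp.sub_apply]
      exact this
    · rw [map_add, hDh₁]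
      ext r
      rw [Finsupp.add_apply, totalDiff_apply]
      simp only [Finsupp.mapRange.linearMap_apply, Finsupp.mapRange_apply, Finsupp.sub_apply]
      rw [hVb _ (hdeg r) _ (hf r) ⟨_, (hcyc r).symm⟩, hVB, sub_zero, add_sub_cancel]
  · intro x hx hr
    have hx' : x ∈ omegaForms k A ℓ := by simpa [X] using hx
    obtain ⟨y, hy⟩ := hr
    obtain ⟨f, hf, hDf, h0⟩ := exists_cycle_of_initial (N := ℓ.toNat + 1)
      (δ := hochschildR k A) (d := connesR k A)
      (X := fun r => X r ⊓ H) (Y := fun r => omegaForms k A (ℓ - 1 - 2 * r) ⊓ H) (x := P x)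
      (hochschildR_hochschildR k) (connesR_connesR k) hanti
      (fun r x hx => ⟨by
        have := hochschildR_mem k hx.1
        have e : ℓ - 2 * (r : ℤ) - 1 = ℓ - 1 - 2 * r := by ring
        rwa [e] at this, hHb x hx.2⟩)
      (fun r x hx hdx => by
        obtain ⟨y, hy, hyx⟩ := hexact _ (by omega) x hx hdx
        refine ⟨y, ?_, hyx⟩
        have e : ℓ - 2 * ((r + 1 : ℕ) : ℤ) = ℓ - 1 - 2 * r - 1 := by push_cast; ring
        simpa only [X, e] using hy)
      hvan (hPH _ (by simp) x hx) ⟨P y, by rw [hb, hB, hy]⟩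
    -- The cycle `f` extends only `P x`. The discrepancy `P x - x` is `b` of `-V (x - P x)`, hence
    -- trivial in homology modulo the image of `B`.
    refine ⟨f, fun r => (hf r).1, hDf, -V (x - P x), ?_, 0, ?_⟩
    · refine Submodule.neg_mem _ ?_
      have := hVmem _ _ (Submodule.sub_mem _ hx' (hmem _ _ hx').1)
      simpa [W] using this
    · rw [h0, map_neg, hVb ℓ le_rfl x hx' ⟨y, hy⟩, map_zero]
      abel

end CuntzQuillen

end ExtendedCyclic

namespace ExtendedCyclic

universe u v

/-! ### Spreading powers of `t`: compatibility of `b` with `i_t` -/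

section SpreadContraction

variable (k : Type u) [CommRing k] {A : Type v} [Ring A] [Algebra k A]

theorem spread_zero_ofA (q : ℕ) (a : A) :
    spread k A 0 q (ofA k A Empty a) = ofA k A Unit a * t k A ^ q := by
  rw [spread, splitRec_ofA]; rfl

theorem spread_zero_mul_dA (q : ℕ) (ω : Omega k A) (a : A) :
    spread k A 0 q (ω * dA k A Empty a) = 0 := by
  rw [spread, splitRec_mul_dA]; rfl

theorem spread_succ_ofA (n q : ℕ) (a : A) : spread k A (n + 1) q (ofA k A Empty a) = 0 := by
  rw [spread, splitRec_ofA]; rfl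

theorem spread_succ_mul_dA (n q : ℕ) (ω : Omega k A) (a : A) :
    spread k A (n + 1) q (ω * dA k A Empty a) =
      ∑ ij ∈ Finset.HasAntidiagonal.antidiagonal q,
        spread k A n ij.1 ω * dA k A Unit a * t k A ^ ij.2 := by
  rw [spread, splitRec_mul_dA]; rfl

theorem spread_succ_zero_mul_dA (n : ℕ) (ω : Omega k A) (a : A) :
    spread k A (n + 1) 0 (ω * dA k A Empty a) = spread k A n 0 ω * dA k A Unit a := by
  rw [spread_succ_mul_dA]; simp

/-- The terms are separated according to whether the last power of `t` is trivial. This recursion in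
`q` drives the telescoping below. -/
theorem spread_succ_succ_mul_dA (n q : ℕ) (ω : Omega k A) (a : A) :
    spread k A (n + 1) (q + 1) (ω * dA k A Empty a) = spread k A n (q + 1) ω * dA k A Unit a +
      spread k A (n + 1) q (ω * dA k A Empty a) * t k A := by
  rw [spread_succ_mul_dA, spread_succ_mul_dA, Finset.Nat.sum_antidiagonal_succ', Finset.sum_mul]
  simp only [pow_zero, mul_one, pow_succ, mul_assoc]

theorem t_pow_mem_forms (q : ℕ) : t k A ^ q ∈ forms k A Unit 0 q := by
  induction q with
  | zero => simpa using one_mem_forms k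
  | succ q ih => rw [pow_succ]; simpa using forms_mul k ih (t_mem k)

theorem spread_mem (n q : ℕ) (ω : Omega k A) : spread k A n q ω ∈ forms k A Unit n q := by
  suffices h : (forms k A Unit n q).mkQ ∘ₗ spread k A n q = 0 from
    (Submodule.Quotient.mk_eq_zero _).1 (LinearMap.congr_fun h ω)
  induction n generalizing q with
  | zero =>
    refine Omega.hom_ext' k (fun a => ?_) fun ω a => ?_
    · rw [LinearMap.comp_apply, spread_zero_ofA]
      refine (Submodule.Quotient.mk_eq_zero _).2 ?_
      simpa using forms_mul k (ofA_mem k a) (t_pow_mem_forms k q)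
    · rw [LinearMap.comp_apply, spread_zero_mul_dA, map_zero, LinearMap.zero_apply]
  | succ n ih =>
    refine Omega.hom_ext' k (fun a => ?_) fun ω a => ?_
    · rw [LinearMap.comp_apply, spread_succ_ofA, map_zero, LinearMap.zero_apply]
    · rw [LinearMap.comp_apply, spread_succ_mul_dA]
      refine (Submodule.Quotient.mk_eq_zero _).2 (Submodule.sum_mem _ fun ij hij => ?_)
      have h1 : spread k A n ij.1 ω ∈ forms k A Unit n ij.1 :=
        (Submodule.Quotient.mk_eq_zero _).1 (LinearMap.congr_fun (ih ij.1) ω)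
      have h2 := forms_mul k (forms_mul k h1 (dA_mem k a)) (t_pow_mem_forms k ij.2)
      convert h2 using 2
      · push_cast; ring
      · rw [← Finset.HasAntidiagonal.mem_antidiagonal.1 hij]; push_cast; ring

theorem parity_spread (n q : ℕ) (ω : Omega k A) :
    parity k A Unit (spread k A n q ω) = (-1 : ℤ) ^ n • spread k A n q ω := by
  rw [parity_of_mem k (spread_mem k n q ω), Units.smul_def]
  simp [Int.negOnePow_def]

theorem spread_ofA_mul (n q : ℕ) (a : A) (ω : Omega k A) :
    spread k A n q (ofA k A Empty a * ω) = ofA k A Unit a * spread k A n q ω := by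
  suffices h : spread k A n q ∘ₗ LinearMap.mulLeft k (ofA k A Empty a) =
      LinearMap.mulLeft k (ofA k A Unit a) ∘ₗ spread k A n q from LinearMap.congr_fun h ω
  induction n generalizing q with
  | zero =>
    refine Omega.hom_ext' k (fun b => ?_) fun ω b => ?_
    · simp only [LinearMap.comp_apply, LinearMap.mulLeft_apply, ← map_mul, spread_zero_ofA,
        ← mul_assoc]
    · simp only [LinearMap.comp_apply, LinearMap.mulLeft_apply, ← mul_assoc, spread_zero_mul_dA,
        mul_zero]
  | succ n ih =>
    refine Omega.hom_ext' k (fun b => ?_) fun ω b => ?_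
    · simp only [LinearMap.comp_apply, LinearMap.mulLeft_apply, ← map_mul, spread_succ_ofA,
        mul_zero]
    · have h : ∀ q, spread k A n q (ofA k A Empty a * ω) = ofA k A Unit a * spread k A n q ω :=
        fun q => LinearMap.congr_fun (ih q) ω
      simp only [LinearMap.comp_apply, LinearMap.mulLeft_apply]
      rw [← mul_assoc, spread_succ_mul_dA, spread_succ_mul_dA, Finset.mul_sum]
      simp only [h, mul_assoc]

theorem spread_parity (n q : ℕ) (ω : Omega k A) :
    spread k A n q (parity k A Empty ω) = (-1 : ℤ) ^ n • spread k A n q ω := by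
  suffices h : spread k A n q ∘ₗ (parity k A Empty).toLinearMap = (-1 : ℤ) ^ n • spread k A n q from
    LinearMap.congr_fun h ω
  induction n generalizing q with
  | zero =>
    refine Omega.hom_ext' k (fun b => ?_) fun ω b => ?_
    · simp
    · simp [spread_zero_mul_dA]
  | succ n ih =>
    refine Omega.hom_ext' k (fun b => ?_) fun ω b => ?_
    · simp [spread_succ_ofA]
    · have h : ∀ q, spread k A n q (parity k A Empty ω) = (-1 : ℤ) ^ n • spread k A n q ω :=
        fun q => LinearMap.congr_fun (ih q) ω
      rw [LinearMap.comp_apply, AlgHom.toLinearMap_apply, map_mul, parity_dA, mul_neg, map_neg,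
        LinearMap.smul_apply, spread_succ_mul_dA, spread_succ_mul_dA, pow_succ, mul_neg_one,
        neg_smul, Finset.smul_sum]
      simp only [h, smul_mul_assoc]

theorem contr_mul (x y : Forms k A Unit) : contr k A (x * y) =
    contr k A x * y + parity k A Unit x * contr k A y := oddDer_mul k _ _ _ _ x y

theorem contr_ofA (a : A) : contr k A (ofA k A Unit a) = 0 := oddDer_ofA k _ _ _ _ a

theorem contr_dA (a : A) : contr k A (dA k A Unit a) =
    ofA k A Unit a * t k A - t k A * ofA k A Unit a := oddDer_dA k _ _ _ _ a

theorem contr_consts {x : Forms k A Unit} (hx : x ∈ consts k A Unit) : contr k A x = 0 :=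
  oddDer_consts k _ _ _ _ hx

theorem contr_spread_zero (q : ℕ) (ω : Omega k A) : contr k A (spread k A 0 q ω) = 0 := by
  suffices h : contr k A ∘ₗ spread k A 0 q = 0 from LinearMap.congr_fun h ω
  refine Omega.hom_ext' k (fun b => ?_) fun ω b => ?_
  · rw [LinearMap.comp_apply, spread_zero_ofA, contr_mul, contr_ofA,
      contr_consts k (t_pow_mem k A q)]
    simp
  · rw [LinearMap.comp_apply, spread_zero_mul_dA, map_zero, LinearMap.zero_apply]

theorem mul_dA_mul_ofA (ω : Omega k A) (b a : A) :
    ω * dA k A Empty b * ofA k A Empty a =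
      ω * dA k A Empty (b * a) - ω * ofA k A Empty b * dA k A Empty a := by
  rw [dA_mul]; noncomm_ring

/-- With no `t` to distribute, spreading is the degree `n` part of the inclusion of `Ω` in `Ω_t`,
which is multiplicative. -/
theorem spread_degree_zero_mul_ofA (n : ℕ) (ω : Omega k A) (a : A) :
    spread k A n 0 (ω * ofA k A Empty a) = spread k A n 0 ω * ofA k A Unit a := by
  suffices h : ∀ a, spread k A n 0 ∘ₗ LinearMap.mulRight k (ofA k A Empty a) =
      LinearMap.mulRight k (ofA k A Unit a) ∘ₗ spread k A n 0 from LinearMap.congr_fun (h a) ω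
  clear a ω
  induction n with
  | zero =>
    refine fun a => Omega.hom_ext' k (fun b => ?_) fun ω b => ?_
    · simp only [LinearMap.comp_apply, LinearMap.mulRight_apply, ← map_mul, spread_zero_ofA,
        pow_zero, mul_one]
    · simp only [LinearMap.comp_apply, LinearMap.mulRight_apply, mul_dA_mul_ofA, map_sub,
        spread_zero_mul_dA, zero_mul, sub_zero]
  | succ n ih =>
    refine fun a => Omega.hom_ext' k (fun b => ?_) fun ω b => ?_
    · simp only [LinearMap.comp_apply, LinearMap.mulRight_apply, ← map_mul, spread_succ_ofA,
        zero_mul]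
    · have h : spread k A n 0 (ω * ofA k A Empty b) = spread k A n 0 ω * ofA k A Unit b :=
        LinearMap.congr_fun (ih b) ω
      simp only [LinearMap.comp_apply, LinearMap.mulRight_apply, mul_dA_mul_ofA, map_sub,
        spread_succ_zero_mul_dA, h]
      rw [dA_mul]
      noncomm_ring

/-- The contraction of the spread of a form, given the behaviour of spreads one degree lower under
right multiplication by elements of `A`. -/
theorem contr_spread_of_defect {n : ℕ} {ω : Omega k A} {a : A}
    (hdef : ∀ q, spread k A n (q + 1) (ω * ofA k A Empty a) -
        spread k A n q (ω * ofA k A Empty a) * t k A =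
      spread k A n (q + 1) ω * ofA k A Unit a - spread k A n q ω * t k A * ofA k A Unit a +
        (-1 : ℤ) ^ n • (contr k A (spread k A n q ω) * dA k A Unit a)) (q : ℕ) :
    contr k A (spread k A (n + 1) q (ω * dA k A Empty a)) = (-1 : ℤ) ^ n •
      (spread k A n (q + 1) (ω * ofA k A Empty a) - spread k A n (q + 1) ω * ofA k A Unit a) := by
  have hsq : ((-1 : ℤ) ^ n) * (-1) ^ n = 1 := by rw [← mul_pow]; simp
  -- With `Δ q` the failure of right linearity in `t`-degree `q`, the hypothesis expresses the
  -- contraction of `spread ω · d a` as `Δ (q + 1) - Δ q · t`, up to sign. The recursion in `q` then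
  -- telescopes, starting from `Δ 0 = 0`.
  have hstep : ∀ q, contr k A (spread k A n q ω * dA k A Unit a) = (-1 : ℤ) ^ n •
      ((spread k A n (q + 1) (ω * ofA k A Empty a) - spread k A n (q + 1) ω * ofA k A Unit a) -
        (spread k A n q (ω * ofA k A Empty a) - spread k A n q ω * ofA k A Unit a) * t k A) := by
    intro q
    have h1 : (spread k A n (q + 1) (ω * ofA k A Empty a) -
        spread k A n (q + 1) ω * ofA k A Unit a) -
        (spread k A n q (ω * ofA k A Empty a) - spread k A n q ω * ofA k A Unit a) * t k A =
        spread k A n q ω * (ofA k A Unit a * t k A - t k A * ofA k A Unit a) +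
        (-1 : ℤ) ^ n • (contr k A (spread k A n q ω) * dA k A Unit a) := by
      have h := eq_add_of_sub_eq (hdef q)
      rw [h]
      simp only [sub_mul, mul_sub, mul_assoc]
      abel
    rw [h1, contr_mul, parity_spread, contr_dA, smul_add, smul_smul, hsq, one_smul, smul_mul_assoc,
      add_comm]
  induction q with
  | zero =>
    rw [spread_succ_zero_mul_dA, hstep, spread_degree_zero_mul_ofA, sub_self, zero_mul, sub_zero]
  | succ q ih =>
    have ht : contr k A (t k A) = 0 := contr_consts k (by simpa using t_pow_mem k A 1)
    rw [spread_succ_succ_mul_dA, map_add, hstep, contr_mul, ht, mul_zero, add_zero, ih,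
      smul_mul_assoc, ← smul_add, sub_add_cancel]

/-- The difference of the spread in degree `q + 1` and `t` times that in degree `q` retains the
terms with trivial last power of `t`. In these, `ω · d b · a = ω · d (b a) - ω b · d a` moves `a`
into a differential, and the resulting error for `ω b` is a contraction. The induction alternates:
the defect in degree `n` gives the contraction formula in degree `n + 1`, which in turn gives the
defect there. -/
theorem spread_mul_ofA_defect (n q : ℕ) (ω : Omega k A) (a : A) :
    spread k A n (q + 1) (ω * ofA k A Empty a) - spread k A n q (ω * ofA k A Empty a) * t k A =
      spread k A n (q + 1) ω * ofA k A Unit a - spread k A n q ω * t k A * ofA k A Unit a +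
        (-1 : ℤ) ^ n • (contr k A (spread k A n q ω) * dA k A Unit a) := by
  induction n generalizing q ω a with
  | zero =>
    simp only [contr_spread_zero, zero_mul, smul_zero, add_zero]
    let f (q : ℕ) : Omega k A →ₗ[k] Forms k A Unit :=
      spread k A 0 (q + 1) - LinearMap.mulRight k (t k A) ∘ₗ spread k A 0 q
    have hf : ∀ ω, f q ω = 0 := by
      intro ω
      suffices h : f q = 0 by rw [h, LinearMap.zero_apply]
      refine Omega.hom_ext' k (fun b => ?_) fun ω b => ?_
      · simp [f, spread_zero_ofA, pow_succ, mul_assoc]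
      · simp [f, spread_zero_mul_dA]
    have h1 := hf (ω * ofA k A Empty a)
    have h2 := hf ω
    simp only [f, LinearMap.sub_apply, LinearMap.comp_apply, LinearMap.mulRight_apply] at h1 h2
    rw [h1, ← sub_mul, h2, zero_mul]
  | succ n ih =>
    let f : Omega k A →ₗ[k] Forms k A Unit :=
      (spread k A (n + 1) (q + 1) - LinearMap.mulRight k (t k A) ∘ₗ spread k A (n + 1) q) ∘ₗ
        LinearMap.mulRight k (ofA k A Empty a)
    let g : Omega k A →ₗ[k] Forms k A Unit :=
      LinearMap.mulRight k (ofA k A Unit a) ∘ₗ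
        (spread k A (n + 1) (q + 1) - LinearMap.mulRight k (t k A) ∘ₗ spread k A (n + 1) q) +
      (-1 : ℤ) ^ (n + 1) • LinearMap.mulRight k (dA k A Unit a) ∘ₗ contr k A ∘ₗ spread k A (n + 1) q
    suffices h : f = g by
      have := LinearMap.congr_fun h ω
      simpa [f, g, sub_mul] using this
    refine Omega.hom_ext' k (fun b => ?_) fun ω b => ?_
    · simp [f, g, spread_succ_ofA, ← map_mul]
    · have hsq : ((-1 : ℤ) ^ n) * (-1) ^ n = 1 := by rw [← mul_pow]; simp
      have h1 : f (ω * dA k A Empty b) = spread k A n (q + 1) ω * dA k A Unit (b * a) -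
          spread k A n (q + 1) (ω * ofA k A Empty b) * dA k A Unit a := by
        simp only [f, LinearMap.comp_apply, LinearMap.sub_apply, LinearMap.mulRight_apply,
          mul_dA_mul_ofA, map_sub, spread_succ_succ_mul_dA, add_sub_cancel_right]
      have h2 : g (ω * dA k A Empty b) = spread k A n (q + 1) ω * dA k A Unit b * ofA k A Unit a -
          (spread k A n (q + 1) (ω * ofA k A Empty b) -
            spread k A n (q + 1) ω * ofA k A Unit b) * dA k A Unit a := by
        simp only [g, LinearMap.comp_apply, LinearMap.sub_apply, LinearMap.add_apply,
          LinearMap.smul_apply, LinearMap.mulRight_apply,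
          contr_spread_of_defect k (fun q => ih q ω b), spread_succ_succ_mul_dA,
          add_sub_cancel_right]
        rw [smul_mul_assoc, smul_smul, pow_succ, mul_neg_one, neg_mul, hsq, neg_one_smul,
          ← sub_eq_add_neg]
      rw [h1, h2, dA_mul]
      noncomm_ring

/-- The contraction of a spread form measures the failure of spreading to be right linear. -/
theorem contr_spread (n q : ℕ) (ω : Omega k A) (a : A) :
    contr k A (spread k A (n + 1) q (ω * dA k A Empty a)) = (-1 : ℤ) ^ n •
      (spread k A n (q + 1) (ω * ofA k A Empty a) - spread k A n (q + 1) ω * ofA k A Unit a) :=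
  contr_spread_of_defect k (fun q => spread_mul_ofA_defect k n q ω a) q

/-- Spreading intertwines the Hochschild differential and the contraction. -/
theorem contrDR_nat_spread (n q : ℕ) (x : Omega k A) :
    contrDR k A (nat k A Unit (spread k A (n + 1) q x)) =
      nat k A Unit (spread k A n (q + 1) (hochschild k A x)) := by
  suffices h : contrDR k A ∘ₗ nat k A Unit ∘ₗ spread k A (n + 1) q =
      nat k A Unit ∘ₗ spread k A n (q + 1) ∘ₗ hochschild k A from LinearMap.congr_fun h x
  refine Omega.hom_ext' k (fun b => ?_) fun ω a => ?_
  · simp [spread_succ_ofA, hochschild_ofA]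
  · simp only [LinearMap.comp_apply]
    -- Modulo commutators the trailing `a` may be moved to the front, where spreading is left
    -- linear. The two terms thus become those of `b`.
    rw [contrDR_nat, contr_spread, hochschild_mul_dA, map_sub, spread_ofA_mul,
      show parity k A Empty ω * ofA k A Empty a = parity k A Empty (ω * ofA k A Empty a) by simp,
      spread_parity, spread_parity, mul_smul_comm, ← smul_sub, map_zsmul, map_zsmul, map_sub,
      map_sub, nat_even_mul (ofA_mem k a)]

/-- In `t`-degree zero spreading is linear on both sides, so `b (ω · d a)` is sent to a commutator
with `a`. -/
theorem nat_spread_zero_hochschild (n : ℕ) (x : Omega k A) :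
    nat k A Unit (spread k A n 0 (hochschild k A x)) = 0 := by
  suffices h : nat k A Unit ∘ₗ spread k A n 0 ∘ₗ hochschild k A = 0 from LinearMap.congr_fun h x
  refine Omega.hom_ext' k (fun b => ?_) fun ω a => ?_
  · simp [hochschild_ofA]
  · simp only [LinearMap.comp_apply]
    rw [hochschild_mul_dA, map_sub, spread_ofA_mul, spread_degree_zero_mul_ofA, map_sub,
      nat_even_mul (ofA_mem k a), sub_self, LinearMap.zero_apply]

end SpreadContraction

end ExtendedCyclic

namespace ExtendedCyclic

universe u v

/-! ### Generating series: compatibility of `B` with `d` -/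

section GeneratingSeries

variable (k : Type u) [CommRing k] {A : Type v} [Ring A] [Algebra k A]

variable (A) in
/-- The generating series `∑ t ^ n z ^ n` of the powers of `t`. -/
def geomSeries : PowerSeries (Forms k A Unit) := PowerSeries.mk fun n => t k A ^ n

/-- The product of the series `d a · ∑ t ^ n z ^ n` over the entries `a` of a list. -/
noncomputable def dSeries (l : List A) : PowerSeries (Forms k A Unit) :=
  (l.map fun a => PowerSeries.C (dA k A Unit a) * geomSeries k A).prod

theorem coeff_geomSeries (n : ℕ) : PowerSeries.coeff n (geomSeries k A) = t k A ^ n :=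
  PowerSeries.coeff_mk _ _

theorem dSeries_nil : dSeries k ([] : List A) = 1 := rfl

theorem dSeries_cons (a : A) (l : List A) : dSeries k (a :: l) =
    PowerSeries.C (dA k A Unit a) * geomSeries k A * dSeries k l := by
  simp [dSeries]

theorem dSeries_append (l l' : List A) :
    dSeries k (l ++ l') = dSeries k l * dSeries k l' := by
  simp [dSeries]

theorem dword_append (l l' : List A) : dword k (l ++ l') = dword k l * dword k l' := by
  simp [dword]

/-- The Euler operator `z · d / dz`. -/
noncomputable def eulerOp {S : Type*} [Semiring S] (f : PowerSeries S) : PowerSeries S :=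
  PowerSeries.mk fun n => n • PowerSeries.coeff n f

theorem coeff_eulerOp {S : Type*} [Semiring S] (n : ℕ) (f : PowerSeries S) :
    PowerSeries.coeff n (eulerOp f) = n • PowerSeries.coeff n f := PowerSeries.coeff_mk _ _

theorem eulerOp_mul {S : Type*} [Semiring S] (f g : PowerSeries S) :
    eulerOp (f * g) = eulerOp f * g + f * eulerOp g := by
  ext n
  rw [map_add, coeff_eulerOp, PowerSeries.coeff_mul, PowerSeries.coeff_mul, PowerSeries.coeff_mul,
    Finset.smul_sum, ← Finset.sum_add_distrib]
  refine Finset.sum_congr rfl fun ij hij => ?_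
  rw [coeff_eulerOp, coeff_eulerOp, ← Finset.HasAntidiagonal.mem_antidiagonal.1 hij, add_smul,
    smul_mul_assoc, mul_smul_comm]

theorem eulerOp_C {S : Type*} [Semiring S] (c : S) : eulerOp (PowerSeries.C c) = 0 := by
  ext n
  rw [coeff_eulerOp, PowerSeries.coeff_C]
  rcases n with _ | n <;> simp

/-- In the square each of the `n + 1` ways of splitting `n` gives the same coefficient `t ^ n`. -/
theorem eulerOp_geomSeries :
    eulerOp (geomSeries k A) + geomSeries k A = geomSeries k A * geomSeries k A := by
  ext n
  rw [map_add, coeff_eulerOp, PowerSeries.coeff_mul, Finset.sum_congr rfl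
    (g := fun _ => t k A ^ n) fun ij hij => ?_, Finset.sum_const, Finset.Nat.card_antidiagonal,
    coeff_geomSeries, succ_nsmul]
  rw [coeff_geomSeries, coeff_geomSeries, ← pow_add, Finset.HasAntidiagonal.mem_antidiagonal.1 hij]

/-- Doubling one of the factors `∑ t ^ n z ^ n`, in all possible ways. -/
theorem sum_dSeries_mul_geomSeries (l : List A) :
    ∑ j ∈ Finset.range l.length,
      dSeries k (l.take (j + 1)) * (geomSeries k A * dSeries k (l.drop (j + 1))) =
    eulerOp (dSeries k l) + l.length • dSeries k l := by
  induction l with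
  | nil =>
    have h : eulerOp (1 : PowerSeries (Forms k A Unit)) = 0 := by
      simpa using eulerOp_C (1 : Forms k A Unit)
    simp [dSeries_nil, h]
  | cons a l ih =>
    rw [List.length_cons, Finset.sum_range_succ']
    simp only [List.take_succ_cons, List.drop_succ_cons, dSeries_cons, mul_assoc, List.take_zero,
      List.drop_zero, dSeries_nil, one_mul, ← Finset.mul_sum]
    -- Doubling the first factor amounts to applying the Euler operator to it and adding one copy;
    -- the remaining positions are covered by induction, and the Leibniz rule collects everything.
    rw [← mul_assoc (geomSeries k A) (geomSeries k A), ← eulerOp_geomSeries, ih, eulerOp_mul,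
      eulerOp_C, eulerOp_mul]
    simp only [zero_mul, zero_add, mul_add, add_mul, add_smul, one_smul, mul_smul_comm]
    abel

theorem coeff_geomSeries_mem (n : ℕ) :
    PowerSeries.coeff n (geomSeries k A) ∈ forms k A Unit 0 n := by
  rw [coeff_geomSeries]; exact t_pow_mem_forms k n

theorem coeff_mul_mem {p p' : ℤ} {F G : PowerSeries (Forms k A Unit)}
    (hF : ∀ n : ℕ, PowerSeries.coeff n F ∈ forms k A Unit p n)
    (hG : ∀ n : ℕ, PowerSeries.coeff n G ∈ forms k A Unit p' n) (n : ℕ) :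
    PowerSeries.coeff n (F * G) ∈ forms k A Unit (p + p') n := by
  rw [PowerSeries.coeff_mul]
  refine Submodule.sum_mem _ fun ij hij => ?_
  have := forms_mul k (hF ij.1) (hG ij.2)
  rwa [← Nat.cast_add, Finset.HasAntidiagonal.mem_antidiagonal.1 hij] at this

theorem coeff_dSeries_mem (l : List A) (n : ℕ) :
    PowerSeries.coeff n (dSeries k l) ∈ forms k A Unit l.length n := by
  induction l generalizing n with
  | nil =>
    rw [dSeries_nil, PowerSeries.coeff_one]
    rcases n with _ | n
    · simpa using one_mem_forms k
    · simp
  | cons a l ih =>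
    have h : ∀ n : ℕ, PowerSeries.coeff n (PowerSeries.C (dA k A Unit a) * geomSeries k A) ∈
        forms k A Unit 1 n := fun n => by
      rw [PowerSeries.coeff_C_mul]
      simpa using forms_mul k (dA_mem k a) (coeff_geomSeries_mem k n)
    rw [dSeries_cons, List.length_cons, Nat.cast_succ, add_comm]
    exact coeff_mul_mem k h ih n

theorem nat_coeff_mul_comm {p p' : ℤ} {F G : PowerSeries (Forms k A Unit)}
    (hF : ∀ n : ℕ, PowerSeries.coeff n F ∈ forms k A Unit p n)
    (hG : ∀ n : ℕ, PowerSeries.coeff n G ∈ forms k A Unit p' n) (n : ℕ) :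
    nat k A Unit (PowerSeries.coeff n (F * G)) =
      (p * p').negOnePow • nat k A Unit (PowerSeries.coeff n (G * F)) := by
  rw [PowerSeries.coeff_mul, PowerSeries.coeff_mul, map_sum, map_sum, Finset.smul_sum,
    ← Finset.Nat.sum_antidiagonal_swap]
  exact Finset.sum_congr rfl fun ij _ => nat_mul_comm (hF ij.2) (hG ij.1)

theorem dOmega_coeff_geomSeries (n : ℕ) :
    dOmega k A Unit (PowerSeries.coeff n (geomSeries k A)) = 0 := by
  rw [coeff_geomSeries, dOmega_consts k (t_pow_mem k A n)]

theorem dOmega_coeff_mul {F G : PowerSeries (Forms k A Unit)}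
    (hF : ∀ n : ℕ, dOmega k A Unit (PowerSeries.coeff n F) = 0)
    (hG : ∀ n : ℕ, dOmega k A Unit (PowerSeries.coeff n G) = 0) (n : ℕ) :
    dOmega k A Unit (PowerSeries.coeff n (F * G)) = 0 := by
  rw [PowerSeries.coeff_mul, map_sum]
  refine Finset.sum_eq_zero fun ij _ => ?_
  rw [dOmega_mul, hF, hG, zero_mul, mul_zero, add_zero]

theorem dOmega_coeff_dSeries (l : List A) (n : ℕ) :
    dOmega k A Unit (PowerSeries.coeff n (dSeries k l)) = 0 := by
  induction l generalizing n with
  | nil =>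
    rw [dSeries_nil, PowerSeries.coeff_one]
    split_ifs
    · exact dOmega_one k
    · exact map_zero _
  | cons a l ih =>
    rw [dSeries_cons]
    refine dOmega_coeff_mul k (fun n => ?_) ih n
    rw [PowerSeries.coeff_C_mul, dOmega_mul, dOmega_dA, dOmega_coeff_geomSeries]
    simp

/-- The spreads of `a₀ d a₁ ⋯ d aₙ` are the coefficients of a product of series. -/
theorem spread_normal (a : A) (l : List A) (q : ℕ) :
    spread k A l.length q (ofA k A Empty a * dword k l) =
      ofA k A Unit a * PowerSeries.coeff q (geomSeries k A * dSeries k l) := by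
  induction l using List.reverseRecOn generalizing q with
  | nil => simp [dword, dSeries_nil, spread_zero_ofA, coeff_geomSeries]
  | append_singleton l b ih =>
    rw [List.length_append, List.length_singleton, dword_concat, ← mul_assoc, spread_succ_mul_dA,
      dSeries_append, dSeries_cons, dSeries_nil, mul_one, ← mul_assoc, ← mul_assoc,
      PowerSeries.coeff_mul, Finset.mul_sum]
    refine Finset.sum_congr rfl fun ij _ => ?_
    rw [ih, PowerSeries.coeff_mul_C, coeff_geomSeries]
    simp only [mul_assoc]

theorem spread_dword (l : List A) (q : ℕ) :
    spread k A l.length q (dword k l) = PowerSeries.coeff q (geomSeries k A * dSeries k l) := by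
  simpa using spread_normal k 1 l q

theorem spread_normal_of_ne {n : ℕ} (a : A) (l : List A) (h : l.length ≠ n) (q : ℕ) :
    spread k A n q (ofA k A Empty a * dword k l) = 0 := by
  induction l using List.reverseRecOn generalizing n q with
  | nil =>
    rcases n with _ | n
    · exact absurd rfl h
    · simp [dword, spread_succ_ofA]
  | append_singleton l b ih =>
    rw [dword_concat, ← mul_assoc]
    rcases n with _ | n
    · exact spread_zero_mul_dA k q _ b
    · rw [spread_succ_mul_dA]
      refine Finset.sum_eq_zero fun ij _ => ?_
      rw [ih (fun h' => h (by simp [h'])), zero_mul, zero_mul]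

theorem spread_eq_zero_of_mem {n : ℕ} {p : ℤ} (hp : p ≠ n) {x : Omega k A}
    (hx : x ∈ forms k A Empty p 0) (q : ℕ) : spread k A n q x = 0 := by
  replace hx := mem_normal k hx
  induction hx using Submodule.span_induction with
  | zero => exact map_zero _
  | add x y _ _ hx hy => rw [map_add, hx, hy, add_zero]
  | smul r x _ hx => rw [map_smul, hx, smul_zero]
  | mem x hx =>
    obtain ⟨a, l, rfl, rfl⟩ := hx
    exact spread_normal_of_ne k a l (fun h => hp (by rw [h])) q

/-- Both `t` and the `d aᵢ` are closed, so only `a₀` is differentiated. The series loses its leading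
coefficient and becomes a product over `a₀, …, aₙ` on an equal footing. -/
theorem dOmega_spread_normal (a : A) (l : List A) (q : ℕ) :
    dOmega k A Unit (spread k A l.length q (ofA k A Empty a * dword k l)) =
      PowerSeries.coeff q (dSeries k (a :: l)) := by
  rw [spread_normal, dOmega_mul, dOmega_ofA, dOmega_coeff_mul k (dOmega_coeff_geomSeries k)
    (dOmega_coeff_dSeries k l), dSeries_cons, mul_assoc, PowerSeries.coeff_C_mul]
  simp

/-- A power of `κ` rotates the last block of differentials to the front, and spreading inserts a
factor `∑ t ^ n z ^ n` before it. Rotating back in the commutator quotient cancels the sign and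
leaves this extra factor between the blocks, next to the one ending the first block. -/
theorem nat_spread_karoubi_pow (l l' : List A) (q : ℕ) :
    nat k A Unit (spread k A (l ++ l').length q ((karoubi k A ^ l'.length) (dword k (l ++ l')))) =
      nat k A Unit (PowerSeries.coeff q (dSeries k l * (geomSeries k A * dSeries k l'))) := by
  have h1 : dword k l ∈ forms k A Empty l.length 0 := by simpa using normal_mem k 1 l
  have h2 : ∀ n : ℕ, PowerSeries.coeff n (geomSeries k A * dSeries k l') ∈
      forms k A Unit l'.length n := fun n => by
    simpa using coeff_mul_mem k (coeff_geomSeries_mem k) (coeff_dSeries_mem k l') n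
  rw [dword_append, karoubi_pow_dword, parity_pow_apply k (parity_of_mem k h1), Units.smul_def,
    mul_smul_comm, ← dword_append, map_zsmul, map_zsmul,
    show (l ++ l').length = (l' ++ l).length by simp [add_comm], spread_dword, dSeries_append,
    ← mul_assoc, nat_coeff_mul_comm k h2 (coeff_dSeries_mem k l), Units.smul_def, smul_smul,
    ← Units.val_mul, ← Int.negOnePow_add, mul_comm (l'.length : ℤ), Int.negOnePow_even _ ⟨_, rfl⟩]
  simp

theorem spread_connes_normal_of_ne {n : ℕ} (a : A) (l : List A) (h : l.length + 1 ≠ n) (q : ℕ) :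
    spread k A n q (connes k A (ofA k A Empty a * dword k l)) = 0 := by
  have hj : ∀ j, (karoubi k A ^ j) (dword k (a :: l)) ∈
      forms k A Empty ((l.length : ℤ) + 1) 0 := fun j => by
    induction j with
    | zero => simpa using normal_mem k 1 (a :: l)
    | succ j ih => rw [pow_succ', Module.End.mul_apply]; exact karoubi_mem k ih
  rw [connes_of_mem k (normal_mem k a l), dOmega_normal, map_sum]
  exact Finset.sum_eq_zero fun j _ =>
    spread_eq_zero_of_mem k (fun h' => h (by exact_mod_cast h')) (hj j) q

theorem spread_zero_connes (q : ℕ) (x : Omega k A) : spread k A 0 q (connes k A x) = 0 := by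
  suffices h : spread k A 0 q ∘ₗ connes k A = 0 from LinearMap.congr_fun h x
  exact Omega.hom_ext k fun a l => spread_connes_normal_of_ne k a l (Nat.succ_ne_zero _) q

/-- Spreading intertwines the Connes and the de Rham differentials, up to a factor. -/
theorem nat_spread_connes (n q : ℕ) (x : Omega k A) :
    nat k A Unit (spread k A (n + 1) q (connes k A x)) =
      (q + n + 1) • nat k A Unit (dOmega k A Unit (spread k A n q x)) := by
  suffices h : nat k A Unit ∘ₗ spread k A (n + 1) q ∘ₗ connes k A =
      (q + n + 1) • (nat k A Unit ∘ₗ dOmega k A Unit ∘ₗ spread k A n q) from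
    LinearMap.congr_fun h x
  refine Omega.hom_ext k fun a l => ?_
  simp only [LinearMap.comp_apply, LinearMap.smul_apply]
  rw [connes_of_mem k (normal_mem k a l), dOmega_normal]
  by_cases hl : l.length = n
  · subst hl
    -- The power `κ ^ (n - j)` doubles the factor following the differential in position `j`
    -- (counted from zero), which is why the sum over powers is reversed below.
    have h : ∀ j ∈ Finset.range (a :: l).length,
        nat k A Unit (spread k A (a :: l).length q
          ((karoubi k A ^ ((a :: l).length - 1 - j)) (dword k (a :: l)))) =
        nat k A Unit (PowerSeries.coeff q (dSeries k ((a :: l).take (j + 1)) *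
          (geomSeries k A * dSeries k ((a :: l).drop (j + 1))))) := by
      intro j hj
      have h1 := nat_spread_karoubi_pow k ((a :: l).take (j + 1)) ((a :: l).drop (j + 1)) q
      rw [List.take_append_drop, List.length_drop] at h1
      rw [← h1, List.length_cons, Nat.sub_sub, add_comm 1 j]
    rw [map_sum, map_sum, ← List.length_cons (a := a), ← Finset.sum_range_reflect,
      Finset.sum_congr rfl h, ← map_sum, ← map_sum, sum_dSeries_mul_geomSeries,
      dOmega_spread_normal, map_add, coeff_eulerOp, map_nsmul, map_add, map_nsmul, map_nsmul,
      ← add_smul, List.length_cons, add_assoc]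
  · rw [spread_normal_of_ne k a l hl, map_zero, map_zero, smul_zero, ← dOmega_normal,
      ← connes_of_mem k (normal_mem k a l), spread_connes_normal_of_ne k a l (by omega), map_zero]

end GeneratingSeries

end ExtendedCyclic

namespace ExtendedCyclic

universe u v

/-! ### The Tsygan map as a morphism of complexes -/

section TsyganMap

variable (k : Type u) [CommRing k] [Algebra ℚ k] {A : Type v} [Ring A] [Algebra k A]

theorem tsyganBi_mk (n q : ℕ) (x : Omega k A) : tsyganBi k A n q ((consts k A Empty).mkQ x) =
    algebraMap ℚ k (1 / (q + n).factorial) • nat k A Unit (spread k A n q x) := rfl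

theorem tsyganBi_mem (n q : ℕ) (x : OmegaR k A) : tsyganBi k A n q x ∈ drForms k A Unit n q := by
  obtain ⟨x, rfl⟩ := Submodule.mkQ_surjective _ x
  rw [tsyganBi_mk]
  exact Submodule.smul_mem _ _ ⟨_, spread_mem k n q x, rfl⟩

theorem tsyganBi_eq_zero {n : ℕ} {p : ℤ} (hp : p ≠ n) (q : ℕ) {x : OmegaR k A}
    (hx : x ∈ omegaForms k A p) : tsyganBi k A n q x = 0 := by
  obtain ⟨x, hx, rfl⟩ := hx
  rw [tsyganBi_mk, spread_eq_zero_of_mem k hp hx, map_zero, smul_zero]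

/-- The factorial depends only on `q + n`, which is unchanged when `i_t` or `b` trades a
differential for a power of `t`. -/
theorem contrDR_tsyganBi_succ (n q : ℕ) (x : OmegaR k A) :
    contrDR k A (tsyganBi k A (n + 1) q x) = tsyganBi k A n (q + 1) (hochschildR k A x) := by
  obtain ⟨x, rfl⟩ := Submodule.mkQ_surjective _ x
  rw [hochschildR_mk, tsyganBi_mk, tsyganBi_mk, map_smul, contrDR_nat_spread,
    show q + (n + 1) = q + 1 + n by ring]

theorem contrDR_tsyganBi_zero (q : ℕ) (x : OmegaR k A) :
    contrDR k A (tsyganBi k A 0 q x) = 0 := by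
  obtain ⟨x, rfl⟩ := Submodule.mkQ_surjective _ x
  rw [tsyganBi_mk, map_smul, contrDR_nat, contr_spread_zero, map_zero, smul_zero]

theorem tsyganBi_hochschildR_zero (n : ℕ) (x : OmegaR k A) :
    tsyganBi k A n 0 (hochschildR k A x) = 0 := by
  obtain ⟨x, rfl⟩ := Submodule.mkQ_surjective _ x
  rw [hochschildR_mk, tsyganBi_mk, nat_spread_zero_hochschild, smul_zero]

/-- The factor `q + n + 1` from spreading `B x` is exactly the quotient of the factorials in
bidegrees `(n + 1, q)` and `(n, q)`. -/
theorem dDR_tsyganBi (n q : ℕ) (x : OmegaR k A) :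
    dDR k A Unit (tsyganBi k A n q x) = tsyganBi k A (n + 1) q (connesR k A x) := by
  obtain ⟨x, rfl⟩ := Submodule.mkQ_surjective _ x
  rw [connesR_mk, tsyganBi_mk, tsyganBi_mk, nat_spread_connes, map_smul, dDR_nat,
    ← Nat.cast_smul_eq_nsmul k, smul_smul, ← map_natCast (algebraMap ℚ k), ← map_mul]
  congr 2
  have h : ((q + n).factorial : ℚ) ≠ 0 := by exact_mod_cast Nat.factorial_ne_zero _
  rw [← add_assoc, Nat.factorial_succ]
  push_cast
  have h' : (q : ℚ) + n + 1 ≠ 0 := by positivity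
  field_simp

theorem tsyganBi_zero_connesR (q : ℕ) (x : OmegaR k A) :
    tsyganBi k A 0 q (connesR k A x) = 0 := by
  obtain ⟨x, rfl⟩ := Submodule.mkQ_surjective _ x
  rw [connesR_mk, tsyganBi_mk, spread_zero_connes, map_zero, smul_zero]

theorem tsygan_of_mem {n : ℕ} (q : ℕ) {x : OmegaR k A} (hx : x ∈ omegaForms k A n) :
    tsygan k A q x = tsyganBi k A n q x := by
  obtain ⟨x, hx, rfl⟩ := hx
  exact byDegree_of_mem _ hx

theorem tsygan_mem {p : ℤ} (q : ℕ) {x : OmegaR k A} (hx : x ∈ omegaForms k A p) :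
    tsygan k A q x ∈ drForms k A Unit p q := by
  rcases lt_or_ge p 0 with hp | hp
  · rw [omegaForms_eq_zero k hp hx, map_zero]; exact Submodule.zero_mem _
  · obtain ⟨n, rfl⟩ := Int.eq_ofNat_of_zero_le hp
    rw [tsygan_of_mem k q hx]; exact tsyganBi_mem k n q x

theorem tsygan_connesR (q : ℕ) (x : OmegaR k A) :
    tsygan k A q (connesR k A x) = dDR k A Unit (tsygan k A q x) := by
  induction x using OmegaR.induction with
  | h0 => simp
  | hadd x y hx hy => simp only [map_add, hx, hy]
  | h n x hx =>
    have h : connesR k A x ∈ omegaForms k A ((n + 1 : ℕ) : ℤ) := by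
      exact_mod_cast connesR_mem k hx
    rw [tsygan_of_mem k q hx, tsygan_of_mem k q h, dDR_tsyganBi]

theorem contrDR_tsygan (q : ℕ) (x : OmegaR k A) :
    contrDR k A (tsygan k A q x) = tsygan k A (q + 1) (hochschildR k A x) := by
  induction x using OmegaR.induction with
  | h0 => simp
  | hadd x y hx hy => simp only [map_add, hx, hy]
  | h n x hx =>
    have h := hochschildR_mem k hx
    rw [tsygan_of_mem k q hx]
    cases n with
    | zero => rw [contrDR_tsyganBi_zero, omegaForms_eq_zero k (by simp) h, map_zero]
    | succ n =>
      rw [Nat.cast_succ, add_sub_cancel_right] at h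
      rw [tsygan_of_mem k _ h, contrDR_tsyganBi_succ]

theorem tsygan_zero_hochschildR (x : OmegaR k A) : tsygan k A 0 (hochschildR k A x) = 0 := by
  induction x using OmegaR.induction with
  | h0 => simp
  | hadd x y hx hy => simp only [map_add, hx, hy, add_zero]
  | h n x hx =>
    have h := hochschildR_mem k hx
    cases n with
    | zero => rw [omegaForms_eq_zero k (by simp) h, map_zero]
    | succ n =>
      rw [Nat.cast_succ, add_sub_cancel_right] at h
      rw [tsygan_of_mem k _ h, tsyganBi_hochschildR_zero]

/-- The component of the Tsygan map of total degree `K - r` in forms and `t`. -/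
noncomputable def tsyganTotal (A : Type v) [Ring A] [Algebra k A] (K : ℤ) (r : ℕ) :
    OmegaR k A →ₗ[k] DRBar k A Unit :=
  if (r : ℤ) ≤ K then
    ∑ pq ∈ Finset.HasAntidiagonal.antidiagonal (K - r).toNat, tsyganBi k A pq.1 pq.2
  else 0

theorem tsyganTotal_of_le {K : ℤ} {r N : ℕ} (h : K = N + r) (x : OmegaR k A) :
    tsyganTotal k A K r x =
      ∑ pq ∈ Finset.HasAntidiagonal.antidiagonal N, tsyganBi k A pq.1 pq.2 x := by
  rw [tsyganTotal, if_pos (by omega), LinearMap.sum_apply, h, add_sub_cancel_right, Int.toNat_natCast]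

theorem tsyganTotal_of_lt {K : ℤ} {r : ℕ} (h : K < r) (x : OmegaR k A) :
    tsyganTotal k A K r x = 0 := by
  rw [tsyganTotal, if_neg (by omega), LinearMap.zero_apply]

theorem tsyganWeight_apply (K : ℤ) (f : ℕ →₀ OmegaR k A) (r : ℕ) :
    tsyganWeight k A K f r = tsyganTotal k A K r (f r) := by
  classical
  have h : Finsupp.lapply r ∘ₗ tsyganWeight k A K = tsyganTotal k A K r ∘ₗ Finsupp.lapply r := by
    refine Finsupp.lhom_ext fun s x => ?_
    by_cases hs : s = r
    · subst hs
      simp [tsyganWeight, tsyganTotal]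
    · simp [tsyganWeight, Finsupp.single_eq_of_ne (Ne.symm hs)]
  exact LinearMap.congr_fun h f

/-- Along an antidiagonal `i_t` shifts each component to the next. The two unmatched ends vanish:
`i_t` kills the components without differentials, and `b` becomes zero in `t`-degree zero. -/
theorem contrDR_tsyganTotal (K : ℤ) (r : ℕ) (x : OmegaR k A) :
    contrDR k A (tsyganTotal k A K r x) = tsyganTotal k A K r (hochschildR k A x) := by
  rcases lt_or_ge K r with h | h
  · rw [tsyganTotal_of_lt k h, tsyganTotal_of_lt k h, map_zero]
  · obtain ⟨N, hN⟩ := Int.eq_ofNat_of_zero_le (sub_nonneg.2 h)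
    have hK := eq_add_of_sub_eq hN
    rw [tsyganTotal_of_le k hK, tsyganTotal_of_le k hK, map_sum]
    cases N with
    | zero => simp [contrDR_tsyganBi_zero, tsyganBi_hochschildR_zero]
    | succ N =>
      rw [Finset.Nat.sum_antidiagonal_succ, Finset.Nat.sum_antidiagonal_succ',
        contrDR_tsyganBi_zero, tsyganBi_hochschildR_zero]
      simp only [contrDR_tsyganBi_succ]

/-- Lowering `r` by one lengthens the antidiagonal by one. The additional component, in de Rham
degree zero, sees nothing of the image of `B`. -/
theorem dDR_tsyganTotal_succ (K : ℤ) (r : ℕ) (x : OmegaR k A) :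
    dDR k A Unit (tsyganTotal k A K (r + 1) x) = tsyganTotal k A K r (connesR k A x) := by
  rcases lt_or_ge K r with h | h
  · rw [tsyganTotal_of_lt k h, tsyganTotal_of_lt k (by omega), map_zero]
  · obtain ⟨N, hN⟩ := Int.eq_ofNat_of_zero_le (sub_nonneg.2 h)
    have hK := eq_add_of_sub_eq hN
    rw [tsyganTotal_of_le k hK]
    cases N with
    | zero =>
      rw [tsyganTotal_of_lt k (by omega)]
      simp [tsyganBi_zero_connesR]
    | succ N =>
      rw [tsyganTotal_of_le k (N := N) (by push_cast at hK ⊢; omega), map_sum,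
        Finset.Nat.sum_antidiagonal_succ, tsyganBi_zero_connesR, zero_add]
      simp only [dDR_tsyganBi]

theorem tsyganTotal_mem {K p : ℤ} {r : ℕ} {x : OmegaR k A} (hx : x ∈ omegaForms k A p) :
    tsyganTotal k A K r x ∈ drForms k A Unit p (K - p - r) := by
  rcases lt_or_ge K r with h | h
  · rw [tsyganTotal_of_lt k h]; exact Submodule.zero_mem _
  · obtain ⟨N, hN⟩ := Int.eq_ofNat_of_zero_le (sub_nonneg.2 h)
    rw [tsyganTotal_of_le k (eq_add_of_sub_eq hN)]
    refine Submodule.sum_mem _ fun pq hpq => ?_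
    by_cases hp : p = pq.1
    · have h1 := Finset.HasAntidiagonal.mem_antidiagonal.1 hpq
      convert tsyganBi_mem k pq.1 pq.2 x using 2
      omega
    · rw [tsyganBi_eq_zero k hp pq.2 hx]; exact Submodule.zero_mem _

/-- On `ℓ`-forms only the component of de Rham degree `ℓ` survives, so fixing the internal degree `ℓ
+ q` at `r = 0` selects the single component `E ^ q`. -/
theorem tsyganTotal_zero {ℓ : ℤ} (q : ℕ) {x : OmegaR k A} (hx : x ∈ omegaForms k A ℓ) :
    tsyganTotal k A (ℓ + q) 0 x = tsygan k A q x := by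
  rcases lt_or_ge ℓ 0 with hp | hp
  · rw [omegaForms_eq_zero k hp hx, map_zero, map_zero]
  · obtain ⟨n, rfl⟩ := Int.eq_ofNat_of_zero_le hp
    rw [tsyganTotal_of_le k (N := n + q) (by push_cast; ring), tsygan_of_mem k q hx]
    refine Finset.sum_eq_single (n, q) (fun pq hpq hne => ?_) fun h => ?_
    · refine tsyganBi_eq_zero k (fun h => hne ?_) pq.2 hx
      have h1 := Finset.HasAntidiagonal.mem_antidiagonal.1 hpq
      ext
      · exact_mod_cast h.symm
      · change pq.2 = q; omega
    · exact absurd (Finset.HasAntidiagonal.mem_antidiagonal.2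
        (show (n, q).1 + (n, q).2 = n + q from rfl)) h

/-- The components of the Tsygan map are morphisms of complexes. -/
theorem totalDiff_tsyganWeight (K : ℤ) (f : ℕ →₀ OmegaR k A) :
    totalDiff (contrDR k A) (dDR k A Unit) (tsyganWeight k A K f) =
      tsyganWeight k A K (totalDiff (hochschildR k A) (connesR k A) f) := by
  ext r
  rw [totalDiff_apply, tsyganWeight_apply, tsyganWeight_apply, tsyganWeight_apply, totalDiff_apply,
    map_sub, contrDR_tsyganTotal, dDR_tsyganTotal_succ]

theorem tsyganWeight_mem (K : ℤ) {ℓ : ℤ} {f : ℕ →₀ OmegaR k A} (hf : f ∈ cyclicForms k A ℓ) :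
    tsyganWeight k A K f ∈ extForms k A ℓ K := fun r => by
  rw [tsyganWeight_apply]
  exact tsyganTotal_mem k (hf r)

theorem exists_tsyganWeight_map (ℓ m : ℤ) : ∃ wE : HC k A ℓ →ₗ[k] EHC k A ℓ m,
    Induces id (tsyganWeight k A (ℓ - m)) wE := by
  refine ⟨HomologyAt.map (tsyganWeight k A (ℓ - m)) (fun f hf => ⟨tsyganWeight_mem k _ hf.1, ?_⟩)
    (fun f hf => ⟨_, tsyganWeight_mem k _ hf, totalDiff_tsyganWeight k _ f⟩), fun f hf => ⟨_, rfl⟩⟩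
  refine LinearMap.mem_ker.2 ?_
  rw [totalDiff_tsyganWeight, LinearMap.mem_ker.1 hf.2, map_zero]

/-- The map induced by a component of the Tsygan map modulo the images of `B` and of `d`. -/
noncomputable def tsyganMod (A : Type v) [Ring A] [Algebra k A] (q : ℕ) :
    (OmegaR k A ⧸ LinearMap.range (connesR k A)) →ₗ[k]
      (DRBar k A Unit ⧸ LinearMap.range (dDR k A Unit)) :=
  Submodule.mapQ _ _ (tsygan k A q) (by
    rintro _ ⟨x, rfl⟩
    rw [Submodule.mem_comap, tsygan_connesR]
    exact LinearMap.mem_range_self _ _)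

theorem exists_tsygan_map (ℓ m : ℤ) (hm : m ≤ 0) : ∃ Em : HModB k A ℓ →ₗ[k] HModD k A ℓ (-m),
    Induces (LinearMap.range (connesR k A)).mkQ
      (fun f => (LinearMap.range (dDR k A Unit)).mkQ (tsygan k A (-m).toNat f)) Em := by
  have hq : ((-m).toNat : ℤ) = -m := Int.toNat_of_nonneg (by omega)
  refine ⟨HomologyAt.map (tsyganMod k A (-m).toNat) ?_ ?_, fun f hf => ⟨_, rfl⟩⟩
  · rintro _ ⟨⟨x, hx, rfl⟩, hk⟩
    refine ⟨⟨_, hq ▸ tsygan_mem k (-m).toNat hx, rfl⟩, ?_⟩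
    obtain ⟨y, hy⟩ := (Submodule.Quotient.mk_eq_zero _).1 (LinearMap.mem_ker.1 hk)
    refine (Submodule.Quotient.mk_eq_zero _).2 ?_
    rw [contrDR_tsygan, ← hy, tsygan_connesR]
    exact LinearMap.mem_range_self _ _
  · rintro _ ⟨x, hx, rfl⟩
    change (LinearMap.range (dDR k A Unit)).mkQ (tsygan k A (-m).toNat (hochschildR k A x)) ∈ _
    -- In `t`-degree zero there are no chains for `i_t` to come from, so `E ^ 0 b` has to vanish;
    -- otherwise `E ^ (q + 1) b = i_t E ^ q` exhibits the boundary.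
    rcases h : (-m).toNat with _ | q
    · rw [tsygan_zero_hochschildR, map_zero]; exact Submodule.zero_mem _
    · rw [← contrDR_tsygan]
      have hq' : (q : ℤ) = -m - 1 := by omega
      exact ⟨_, ⟨_, hq' ▸ tsygan_mem k q hx, rfl⟩, rfl⟩

end TsyganMap

end ExtendedCyclic

open ExtendedCyclic

/-! ### The proposition -/

theorem propositionp {k : Type*} [CommRing k] [Algebra ℚ k] {A : Type*} [Ring A] [Algebra k A]
    (hsplit : ∃ s : A →ₗ[k] k, s 1 = 1) :
    (∀ ℓ m : ℤ, 0 < m →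
      ∃ πm : EHC k A ℓ m ≃ₗ[k] HD k A (ℓ - 2 * m),
        Induces id (piCoeff k A m.toNat) πm.toLinearMap) ∧
    (∀ ℓ m : ℤ, m ≤ 0 →
      ∃ (πminus : EHC k A ℓ m ≃ₗ[k] HModD k A ℓ (-m))
        (cq : HC k A ℓ ≃ₗ[k] HModB k A ℓ)
        (wE : HC k A ℓ →ₗ[k] EHC k A ℓ m)
        (Em : HModB k A ℓ →ₗ[k] HModD k A ℓ (-m)),
        Induces id (piMinus k A) πminus.toLinearMap ∧
        Induces id (cuntzQuillen k A) cq.toLinearMap ∧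
        Induces id (tsyganWeight k A (ℓ - m)) wE ∧
        Induces (LinearMap.range (connesR k A)).mkQ
          (fun f => (LinearMap.range (dDR k A Unit)).mkQ (tsygan k A (-m).toNat f)) Em ∧
        πminus.toLinearMap ∘ₗ wE = Em ∘ₗ cq.toLinearMap) := by
  obtain ⟨s, hs⟩ := hsplit
  refine ⟨fun ℓ m hm => exists_piCoeff_equiv hs ℓ m hm, fun ℓ m hm => ?_⟩
  obtain ⟨πminus, hπ⟩ := exists_piMinus_equiv (A := A) hs ℓ m hm
  obtain ⟨cq, hcq⟩ := exists_cuntzQuillen_equiv hs ℓ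
  obtain ⟨wE, hwE⟩ := exists_tsyganWeight_map k (A := A) ℓ m
  obtain ⟨Em, hEm⟩ := exists_tsygan_map k (A := A) ℓ m hm
  refine ⟨πminus, cq, wE, Em, hπ, hcq, hwE, hEm, LinearMap.ext fun c => ?_⟩
  obtain ⟨f, hf, rfl⟩ := HomologyAt.exists_cls c
  obtain ⟨h1, e1⟩ := hwE f hf
  obtain ⟨h2, e2⟩ := hπ _ h1
  obtain ⟨h3, e3⟩ := hcq f hf
  obtain ⟨h4, e4⟩ := hEm (f 0) h3
  have hf0 : f 0 ∈ omegaForms k A ℓ := by simpa using hf.1 0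
  -- Both composites depend only on the coefficient of `u ^ 0`, where internal degree `ℓ - m` means
  -- `t`-degree `-m`; the square thus commutes on representatives.
  have key : tsyganWeight k A (ℓ - m) f 0 = tsygan k A (-m).toNat (f 0) := by
    rw [tsyganWeight_apply, ← tsyganTotal_zero k _ hf0, Int.toNat_of_nonneg (by omega),
      sub_eq_add_neg]
  rw [LinearMap.comp_apply, LinearMap.comp_apply]
  refine ((congrArg _ e1).trans e2).trans (((congrArg _ e3).trans e4).trans ?_).symm
  rw [HomologyAt.cls_eq_iff, piMinus, key, sub_self]
  exact Submodule.zero_mem _
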